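/- Consider pairs $(A,u)$, where $A$ is a nonzero unital $C^*$-algebra and $u\in M_n(A)$ is a unitary matrix such that: (w1) the coefficients of $u$ generate a dense $*$-subalgebra $A_s$ of $A$; (w2) there is a $C^*$-morphism $\delta:A\to A\otimes_{\min}A$ with $\delta(u_{ij})=\sum_k u_{ik}\otimes u_{kj}$ for all $i,j$; (w3) there is a linear antimultiplicative map $\kappa:A_s\to A_s$ with $\kappa(\kappa(a^*)^*)=a$ for all $a\in A_s$ and $(\mathrm{id}\otimes\kappa)u=u^{-1}$. A (finite dimensional, nondegenerate) corepresentation of $A$ of dimension $d$ is an invertible matrix $r\in M_d(A_s)$ with $\delta(r_{ij})=\sum_k r_{ik}\otimes r_{kj}$; two corepresentations $r,s$ are equivalent if $Tr=sT$ for some invertible scalar matrix $T$. The fusion semiring $R^+(A)$ is the semiring of equivalence classes of such corepresentations, with the operations induced by direct sum and tensor product; $\dim r$ denotes the dimension of a class $r\in R^+(A)$. Let $h\in A^*$ be the Haar measure of $A$, i.e. the state with $(h\otimes\mathrm{id})\delta=h(\cdot)1=(\mathrm{id}\otimes h)\delta$, let $A_{red}=A/\{x\in A\mid h(x^*x)=0\}$,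 and let $A_p$ be the enveloping $C^*$-algebra of $A_s$. The algebra $A$ is called amenable if the canonical surjection $A_p\to A_{red}$ (the identity on $A_s$) is an isomorphism. Proposition 6.1. Let $(A,u)$ and $(B,v)$ satisfy (w1)–(w3), and let $f:R^+(A)\to R^+(B)$ be an isomorphism of semirings sending the class of $u$ to the class of $v$. If $A$ is amenable, then $\dim f(r)\ge\dim r$ for all $r\in R^+(A)$, and the following conditions are equivalent: (i) $\dim f(r)=\dim r$ for all $r\in R^+(A)$; (ii) $\dim v=\dim u$; (iii) $B$ is amenable. -/

import Mathlib

open scoped ComplexOrder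

universe u v

set_option linter.unusedSectionVars false

noncomputable section

/-! ### The Hilbert space tensor product -/

section HilbertTensor

variable (H : Type u) (K : Type v) [NormedAddCommGroup H] [InnerProductSpace ℂ H]
  [NormedAddCommGroup K] [InnerProductSpace ℂ K]

/-- The Hilbert space tensor product `H ⊗ K`: the completion of the algebraic tensor product for
its canonical inner product. -/
def HilbertTensor : Type (max u v) := UniformSpace.Completion (TensorProduct ℂ H K)

instance : NormedAddCommGroup (HilbertTensor H K) :=
  inferInstanceAs (NormedAddCommGroup (UniformSpace.Completion (TensorProduct ℂ H K)))

instance : InnerProductSpace ℂ (HilbertTensor H K) :=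
  inferInstanceAs (InnerProductSpace ℂ (UniformSpace.Completion (TensorProduct ℂ H K)))

instance : CompleteSpace (HilbertTensor H K) :=
  inferInstanceAs (CompleteSpace (UniformSpace.Completion (TensorProduct ℂ H K)))

variable {H K}

/-- The bounded operator `S ⊗ T` on `H ⊗ K`. -/
def opTensor (S : H →L[ℂ] H) (T : K →L[ℂ] K) : HilbertTensor H K →L[ℂ] HilbertTensor H K :=
  ((TensorProduct.mapL S T).completion :
    UniformSpace.Completion (TensorProduct ℂ H K) →L[ℂ]
      UniformSpace.Completion (TensorProduct ℂ H K))

theorem opTensor_coe (S : H →L[ℂ] H) (T : K →L[ℂ] K) (x : TensorProduct ℂ H K) :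
    opTensor S T (x : UniformSpace.Completion (TensorProduct ℂ H K)) =
      (TensorProduct.mapL S T x : UniformSpace.Completion (TensorProduct ℂ H K)) :=
  ContinuousLinearMap.completion_apply_coe _ _

theorem hilbertTensor_clm_ext {P Q : HilbertTensor H K →L[ℂ] HilbertTensor H K}
    (h : ∀ x : TensorProduct ℂ H K,
      P (x : UniformSpace.Completion (TensorProduct ℂ H K)) =
        Q (x : UniformSpace.Completion (TensorProduct ℂ H K))) : P = Q := by
  ext x
  induction x using UniformSpace.Completion.induction_on with
  | hp => exact isClosed_eq P.continuous Q.continuous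
  | ih x => exact h x

theorem opTensor_mul (S S' : H →L[ℂ] H) (T T' : K →L[ℂ] K) :
    opTensor S T * opTensor S' T' = opTensor (S * S') (T * T') := by
  apply hilbertTensor_clm_ext
  intro x
  change opTensor S T (opTensor S' T' _) = _
  rw [opTensor_coe, opTensor_coe, opTensor_coe, TensorProduct.mapL_mul]
  rfl

theorem opTensor_zero_left (T : K →L[ℂ] K) : opTensor (0 : H →L[ℂ] H) T = 0 := by
  apply hilbertTensor_clm_ext
  intro x
  rw [opTensor_coe, TensorProduct.mapL_zero_left]
  rfl

theorem opTensor_zero_right (S : H →L[ℂ] H) : opTensor S (0 : K →L[ℂ] K) = 0 := by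
  apply hilbertTensor_clm_ext
  intro x
  rw [opTensor_coe, TensorProduct.mapL_zero_right]
  rfl

theorem opTensor_one : opTensor (1 : H →L[ℂ] H) (1 : K →L[ℂ] K) = 1 := by
  apply hilbertTensor_clm_ext
  intro x
  rw [opTensor_coe]
  have : TensorProduct.mapL (1 : H →L[ℂ] H) (1 : K →L[ℂ] K) = 1 := TensorProduct.mapL_id_id
  rw [this]
  rfl

end HilbertTensor

/-! ### The minimal tensor product of C*-algebras -/

/-- A faithful unital `*`-representation of a unital C*-algebra on a Hilbert space. -/
structure FaithfulRep (A : Type u) [CStarAlgebra A] where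
  /-- The Hilbert space. -/
  H : Type u
  [normedAddCommGroup : NormedAddCommGroup H]
  [innerProductSpace : InnerProductSpace ℂ H]
  [completeSpace : CompleteSpace H]
  /-- The representation. -/
  π : A →⋆ₐ[ℂ] (H →L[ℂ] H)
  injective : Function.Injective π

attribute [instance] FaithfulRep.normedAddCommGroup FaithfulRep.innerProductSpace
  FaithfulRep.completeSpace

section MinTensor

variable {A : Type u} [CStarAlgebra A] {B : Type v} [CStarAlgebra B]

/-- The minimal (spatial) tensor product of two C*-algebras, realised with the help of faithful
representations on `H` and `K`: the C*-algebra of operators on `H ⊗ K` generated by the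
`π(a) ⊗ σ(b)`. Up to canonical isomorphism it does not depend on the representations. -/
def minTensor (ρ : FaithfulRep A) (σ : FaithfulRep B) :
    StarSubalgebra ℂ (HilbertTensor ρ.H σ.H →L[ℂ] HilbertTensor ρ.H σ.H) :=
  (StarAlgebra.adjoin ℂ {T | ∃ a b, T = opTensor (ρ.π a) (σ.π b)}).topologicalClosure

/-- The elementary tensor `a ⊗ b` in the minimal tensor product. -/
def elemTensor (ρ : FaithfulRep A) (σ : FaithfulRep B) (a : A) (b : B) : minTensor ρ σ :=
  ⟨opTensor (ρ.π a) (σ.π b), StarSubalgebra.le_topologicalClosure _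
    (StarAlgebra.subset_adjoin ℂ _ ⟨a, b, rfl⟩)⟩

theorem elemTensor_mul (ρ : FaithfulRep A) (σ : FaithfulRep B) (a c : A) (b d : B) :
    elemTensor ρ σ a b * elemTensor ρ σ c d = elemTensor ρ σ (a * c) (b * d) := by
  apply Subtype.ext
  change opTensor _ _ * opTensor _ _ = opTensor _ _
  rw [opTensor_mul, map_mul, map_mul]

theorem elemTensor_zero_left (ρ : FaithfulRep A) (σ : FaithfulRep B) (b : B) :
    elemTensor ρ σ 0 b = 0 := by
  apply Subtype.ext
  change opTensor _ _ = 0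
  rw [map_zero, opTensor_zero_left]

theorem elemTensor_zero_right (ρ : FaithfulRep A) (σ : FaithfulRep B) (a : A) :
    elemTensor ρ σ a 0 = 0 := by
  apply Subtype.ext
  change opTensor _ _ = 0
  rw [map_zero, opTensor_zero_right]

theorem elemTensor_one (ρ : FaithfulRep A) (σ : FaithfulRep B) :
    elemTensor ρ σ 1 1 = 1 := by
  apply Subtype.ext
  change opTensor _ _ = 1
  rw [map_one, map_one, opTensor_one]

end MinTensor

/-! ### Woronowicz algebras of finite type -/

/-- The `*`-subalgebra `A_s` of `A` generated by the coefficients of `u`. -/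
def coeffAlgebra {A : Type u} [CStarAlgebra A] {n : ℕ} (u : Matrix (Fin n) (Fin n) A) :
    StarSubalgebra ℂ A :=
  StarAlgebra.adjoin ℂ {a | ∃ i j, a = u i j}

/-- The entry `u i j` as an element of the `*`-algebra `A_s`. -/
def coeffEntry {A : Type u} [CStarAlgebra A] {n : ℕ} (u : Matrix (Fin n) (Fin n) A)
    (i j : Fin n) : coeffAlgebra u :=
  ⟨u i j, StarAlgebra.subset_adjoin ℂ _ ⟨i, j, rfl⟩⟩

/-- A pair `(A, u)` consisting of a unital C*-algebra `A` and a unitary `u ∈ M_n(A)` with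
Woronowicz's conditions: the coefficients of `u` generate a dense `*`-subalgebra `A_s`; there is
a comultiplication `δ : A → A ⊗_min A`; there is an antipode `κ` on `A_s`. The maps `δ` and `κ` are
determined by `u`; the faithful representation `rep` only serves to realise `A ⊗_min A`. -/
structure WoronowiczPair (A : Type u) [CStarAlgebra A] (n : ℕ) where
  u : Matrix (Fin n) (Fin n) A
  u_unitary : u ∈ unitary (Matrix (Fin n) (Fin n) A)
  dense : Dense (coeffAlgebra u : Set A)
  rep : FaithfulRep A
  δ : A →⋆ₐ[ℂ] minTensor rep rep
  δ_u : ∀ i j, δ (u i j) = ∑ k, elemTensor rep rep (u i k) (u k j)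
  κ : coeffAlgebra u →ₗ[ℂ] coeffAlgebra u
  κ_mul : ∀ a b, κ (a * b) = κ b * κ a
  κ_star : ∀ a, κ (star (κ (star a))) = a
  /-- `(id ⊗ κ) u = u⁻¹`, the inverse of the unitary `u` being its adjoint. -/
  κ_u : ∀ i j, κ (coeffEntry u i j) = star (coeffEntry u j i)

/-! ### Equivalence of square matrices over an algebra up to invertible scalar matrices -/

section MatEquiv

variable {S : Type*} [Ring S] [Algebra ℂ S]
variable {ι κ μ ι' κ' : Type*} [Fintype ι] [DecidableEq ι] [Fintype κ] [DecidableEq κ]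
  [Fintype μ] [DecidableEq μ] [Fintype ι'] [DecidableEq ι'] [Fintype κ'] [DecidableEq κ']

/-- `T r = s T` for some invertible scalar matrix `T`. -/
def MatEquiv (r : Matrix ι ι S) (s : Matrix κ κ S) : Prop :=
  ∃ (T : Matrix κ ι ℂ) (T' : Matrix ι κ ℂ), T * T' = 1 ∧ T' * T = 1 ∧
    T.map (algebraMap ℂ S) * r = s * T.map (algebraMap ℂ S)

/-- The tensor product of two matrices, with entries `r i j * s k l`. -/
def matTensor (r : Matrix ι ι' S) (s : Matrix κ κ' S) : Matrix (ι × κ) (ι' × κ') S :=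
  Matrix.of fun p q => r p.1 q.1 * s p.2 q.2

theorem MatEquiv.refl (r : Matrix ι ι S) : MatEquiv r r :=
  ⟨1, 1, by simp, by simp, by simp [Matrix.map_one]⟩

theorem MatEquiv.symm {r : Matrix ι ι S} {s : Matrix κ κ S} (h : MatEquiv r s) :
    MatEquiv s r := by
  obtain ⟨T, T', h1, h2, h3⟩ := h
  refine ⟨T', T, h2, h1, ?_⟩
  have h1' : T.map (algebraMap ℂ S) * T'.map (algebraMap ℂ S) = 1 := by
    rw [← Matrix.map_mul, h1]; simp [Matrix.map_one]
  have h2' : T'.map (algebraMap ℂ S) * T.map (algebraMap ℂ S) = 1 := by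
    rw [← Matrix.map_mul, h2]; simp [Matrix.map_one]
  calc T'.map (algebraMap ℂ S) * s
      = T'.map (algebraMap ℂ S) * (s * T.map (algebraMap ℂ S)) * T'.map (algebraMap ℂ S) := by
        rw [Matrix.mul_assoc, Matrix.mul_assoc, h1', Matrix.mul_one]
    _ = r * T'.map (algebraMap ℂ S) := by
        rw [← h3, ← Matrix.mul_assoc, h2', Matrix.one_mul]

theorem MatEquiv.trans {r : Matrix ι ι S} {s : Matrix κ κ S} {t : Matrix μ μ S}
    (h : MatEquiv r s) (h' : MatEquiv s t) : MatEquiv r t := by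
  obtain ⟨T, T', h1, h2, h3⟩ := h
  obtain ⟨U, U', k1, k2, k3⟩ := h'
  refine ⟨U * T, T' * U', ?_, ?_, ?_⟩
  · rw [Matrix.mul_assoc, ← Matrix.mul_assoc T, h1, Matrix.one_mul, k1]
  · rw [Matrix.mul_assoc, ← Matrix.mul_assoc U', k2, Matrix.one_mul, h2]
  · rw [Matrix.map_mul, Matrix.mul_assoc, h3, ← Matrix.mul_assoc, k3, Matrix.mul_assoc]

theorem MatEquiv.of_equiv {r : Matrix ι ι S} {s : Matrix κ κ S} (e : ι ≃ κ)
    (h : ∀ i j, r i j = s (e i) (e j)) : MatEquiv r s := by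
  refine ⟨(1 : Matrix κ κ ℂ).submatrix id e, (1 : Matrix κ κ ℂ).submatrix e id, ?_, ?_, ?_⟩
  · rw [Matrix.submatrix_mul_equiv]; simp
  · ext i j
    simp [Matrix.mul_apply, Matrix.one_apply, Matrix.submatrix_apply]
  · ext i j
    have hi : ∀ x, (i = e x) ↔ (e.symm i = x) := fun x => (Equiv.symm_apply_eq e).symm
    simp [Matrix.mul_apply, Matrix.one_apply, Matrix.submatrix_apply, apply_ite, h, hi]

theorem MatEquiv.card_eq {r : Matrix ι ι S} {s : Matrix κ κ S} (h : MatEquiv r s) :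
    Fintype.card ι = Fintype.card κ := by
  obtain ⟨T, T', h1, h2, -⟩ := h
  exact (Matrix.square_of_invertible T' T h2 h1)

theorem matTensor_mul {ι'' κ'' : Type*} [Fintype ι''] [Fintype κ'']
    (a : Matrix ι ι' S) (b : Matrix ι' ι'' S) (c : Matrix κ κ' S) (d : Matrix κ' κ'' S)
    (h : ∀ i j k l, Commute (b i j) (c k l)) :
    matTensor a c * matTensor b d = matTensor (a * b) (c * d) := by
  ext p q
  simp only [matTensor, Matrix.mul_apply, Matrix.of_apply, Fintype.sum_prod_type,
    Finset.sum_mul_sum]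
  refine Finset.sum_congr rfl fun x _ => Finset.sum_congr rfl fun y _ => ?_
  have := (h x q.1 p.2 y).eq
  calc a p.1 x * c p.2 y * (b x q.1 * d y q.2)
      = a p.1 x * (c p.2 y * b x q.1) * d y q.2 := by simp only [mul_assoc]
    _ = a p.1 x * b x q.1 * (c p.2 y * d y q.2) := by rw [← this]; simp only [mul_assoc]

theorem matTensor_one : matTensor (1 : Matrix ι ι S) (1 : Matrix κ κ S) = 1 := by
  ext ⟨i, k⟩ ⟨j, l⟩
  simp only [matTensor, Matrix.of_apply, Matrix.one_apply, Prod.mk.injEq]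
  split_ifs <;> simp_all

theorem commute_one_apply (i j : ι) (x : S) : Commute ((1 : Matrix ι ι S) i j) x := by
  rw [Matrix.one_apply]
  split_ifs
  · exact Commute.one_left x
  · exact Commute.zero_left x

theorem isUnit_matTensor {r : Matrix ι ι S} {s : Matrix κ κ S} (hr : IsUnit r)
    (hs : IsUnit s) : IsUnit (matTensor r s) := by
  obtain ⟨⟨r, r', h1, h2⟩, rfl⟩ := hr
  obtain ⟨⟨s, s', k1, k2⟩, rfl⟩ := hs
  have e : matTensor r s = matTensor r 1 * matTensor 1 s := by
    rw [matTensor_mul _ _ _ _ fun i j k l => commute_one_apply i j _, Matrix.mul_one,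
      Matrix.one_mul]
  have hr : IsUnit (matTensor r (1 : Matrix κ κ S)) := by
    refine ⟨⟨matTensor r 1, matTensor r' 1, ?_, ?_⟩, rfl⟩
    · rw [matTensor_mul r r' 1 1 fun i j k l => (commute_one_apply k l _).symm, h1,
        Matrix.mul_one, matTensor_one]
    · rw [matTensor_mul r' r 1 1 fun i j k l => (commute_one_apply k l _).symm, h2,
        Matrix.mul_one, matTensor_one]
  have hs : IsUnit (matTensor (1 : Matrix ι ι S) s) := by
    refine ⟨⟨matTensor 1 s, matTensor 1 s', ?_, ?_⟩, rfl⟩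
    · rw [matTensor_mul _ _ _ _ fun i j k l => commute_one_apply i j _, k1,
        Matrix.mul_one, matTensor_one]
    · rw [matTensor_mul _ _ _ _ fun i j k l => commute_one_apply i j _, k2,
        Matrix.mul_one, matTensor_one]
  change IsUnit (matTensor r s)
  rw [e]
  exact hr.mul hs

theorem isUnit_fromBlocks {r : Matrix ι ι S} {s : Matrix κ κ S} (hr : IsUnit r)
    (hs : IsUnit s) : IsUnit (Matrix.fromBlocks r 0 0 s) := by
  obtain ⟨⟨r, r', h1, h2⟩, rfl⟩ := hr
  obtain ⟨⟨s, s', k1, k2⟩, rfl⟩ := hs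
  refine ⟨⟨Matrix.fromBlocks r 0 0 s, Matrix.fromBlocks r' 0 0 s', ?_, ?_⟩, rfl⟩
  · simp [Matrix.fromBlocks_multiply, h1, k1]
  · simp [Matrix.fromBlocks_multiply, h2, k2]

theorem isUnit_submatrix {r : Matrix ι ι S} (hr : IsUnit r) (e : κ ≃ ι) :
    IsUnit (r.submatrix e e) := by
  obtain ⟨⟨r, r', h1, h2⟩, rfl⟩ := hr
  refine ⟨⟨r.submatrix e e, r'.submatrix e e, ?_, ?_⟩, rfl⟩
  · rw [Matrix.submatrix_mul_equiv, h1]; simp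
  · rw [Matrix.submatrix_mul_equiv, h2]; simp

theorem MatEquiv.fromBlocks {r : Matrix ι ι S} {s : Matrix κ κ S} {r' : Matrix ι' ι' S}
    {s' : Matrix κ' κ' S} (h : MatEquiv r r') (k : MatEquiv s s') :
    MatEquiv (Matrix.fromBlocks r 0 0 s) (Matrix.fromBlocks r' 0 0 s') := by
  obtain ⟨T, T', h1, h2, h3⟩ := h
  obtain ⟨U, U', k1, k2, k3⟩ := k
  refine ⟨Matrix.fromBlocks T 0 0 U, Matrix.fromBlocks T' 0 0 U', ?_, ?_, ?_⟩
  · simp [Matrix.fromBlocks_multiply, h1, k1]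
  · simp [Matrix.fromBlocks_multiply, h2, k2]
  · simp [Matrix.fromBlocks_multiply, Matrix.fromBlocks_map, Matrix.map_zero, h3, k3]

theorem MatEquiv.matTensor {r : Matrix ι ι S} {s : Matrix κ κ S} {r' : Matrix ι' ι' S}
    {s' : Matrix κ' κ' S} (h : MatEquiv r r') (k : MatEquiv s s') :
    MatEquiv (matTensor r s) (matTensor r' s') := by
  obtain ⟨T, T', h1, h2, h3⟩ := h
  obtain ⟨U, U', k1, k2, k3⟩ := k
  refine ⟨_root_.matTensor T U, _root_.matTensor T' U', ?_, ?_, ?_⟩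
  · rw [matTensor_mul _ _ _ _ fun i j k l => Commute.all _ _, h1, k1, matTensor_one]
  · rw [matTensor_mul _ _ _ _ fun i j k l => Commute.all _ _, h2, k2, matTensor_one]
  · have e : (_root_.matTensor T U).map (algebraMap ℂ S) =
        _root_.matTensor (T.map (algebraMap ℂ S)) (U.map (algebraMap ℂ S)) := by
      ext p q
      simp [_root_.matTensor]
    rw [e, matTensor_mul _ _ _ _ fun i j k l => ?_, matTensor_mul _ _ _ _ fun i j k l => ?_,
      h3, k3]
    · exact Algebra.commutes' _ _
    · exact (Algebra.commutes' _ _).symm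

end MatEquiv

/-! ### The fusion semiring -/

namespace WoronowiczPair

variable {A : Type u} [CStarAlgebra A] {n : ℕ} (G : WoronowiczPair A n)

/-- The elementary tensor `a ⊗ b` in `A ⊗_min A`. -/
abbrev tmul (a b : A) : minTensor G.rep G.rep := elemTensor G.rep G.rep a b

/-- A matrix `r` over `A_s` is a (nondegenerate) corepresentation if it is invertible and
`(id ⊗ δ) r = r₁₂ r₁₃`, that is, `δ(r i j) = ∑ k, r i k ⊗ r k j`. -/
structure IsCorep {ι : Type*} [Fintype ι] [DecidableEq ι]
    (r : Matrix ι ι (coeffAlgebra G.u)) : Prop where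
  isUnit : IsUnit r
  δ_apply : ∀ i j, G.δ (r i j : A) = ∑ k, G.tmul (r i k : A) (r k j : A)

/-- A finite dimensional (nondegenerate) corepresentation, in coordinates. -/
structure Corep where
  dim : ℕ
  mat : Matrix (Fin dim) (Fin dim) (coeffAlgebra G.u)
  isCorep : G.IsCorep mat

variable {G}

section

variable {ι κ : Type*} [Fintype ι] [DecidableEq ι] [Fintype κ] [DecidableEq κ]

theorem IsCorep.submatrix {r : Matrix ι ι (coeffAlgebra G.u)} (hr : G.IsCorep r) (e : κ ≃ ι) :
    G.IsCorep (r.submatrix e e) where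
  isUnit := isUnit_submatrix hr.isUnit e
  δ_apply i j := by
    simp only [Matrix.submatrix_apply]
    rw [hr.δ_apply, ← e.sum_comp]

theorem IsCorep.fromBlocks {r : Matrix ι ι (coeffAlgebra G.u)}
    {s : Matrix κ κ (coeffAlgebra G.u)} (hr : G.IsCorep r) (hs : G.IsCorep s) :
    G.IsCorep (Matrix.fromBlocks r 0 0 s) where
  isUnit := isUnit_fromBlocks hr.isUnit hs.isUnit
  δ_apply i j := by
    have h0 : ∀ a, G.tmul a 0 = 0 := fun a => elemTensor_zero_right _ _ a
    have h0' : ∀ a, G.tmul 0 a = 0 := fun a => elemTensor_zero_left _ _ a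
    rcases i with i | i <;> rcases j with j | j <;>
      simp [hr.δ_apply, hs.δ_apply, h0, h0']

theorem IsCorep.matTensor {r : Matrix ι ι (coeffAlgebra G.u)}
    {s : Matrix κ κ (coeffAlgebra G.u)} (hr : G.IsCorep r) (hs : G.IsCorep s) :
    G.IsCorep (matTensor r s) where
  isUnit := isUnit_matTensor hr.isUnit hs.isUnit
  δ_apply i j := by
    simp only [_root_.matTensor, Matrix.of_apply, MulMemClass.coe_mul, map_mul, hr.δ_apply,
      hs.δ_apply, Fintype.sum_prod_type, Finset.sum_mul_sum, tmul, elemTensor_mul]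

theorem isCorep_one [Unique ι] : G.IsCorep (1 : Matrix ι ι (coeffAlgebra G.u)) where
  isUnit := isUnit_one
  δ_apply i j := by
    have h1 : G.tmul 1 1 = 1 := elemTensor_one _ _
    obtain rfl := Subsingleton.elim i default
    obtain rfl := Subsingleton.elim j default
    simp [h1]

theorem isCorep_of_isEmpty [IsEmpty ι] (r : Matrix ι ι (coeffAlgebra G.u)) : G.IsCorep r where
  isUnit := by rw [Subsingleton.elim r 1]; exact isUnit_one
  δ_apply i := isEmptyElim i

end

namespace Corep

/-- The corepresentation with an arbitrary finite index set, renumbered. -/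
def ofMatrix {ι : Type*} [Fintype ι] [DecidableEq ι] {m : ℕ} (e : Fin m ≃ ι)
    {r : Matrix ι ι (coeffAlgebra G.u)} (hr : G.IsCorep r) : G.Corep where
  dim := m
  mat := r.submatrix e e
  isCorep := hr.submatrix e

theorem ofMatrix_equiv {ι : Type*} [Fintype ι] [DecidableEq ι] {m : ℕ} (e : Fin m ≃ ι)
    {r : Matrix ι ι (coeffAlgebra G.u)} (hr : G.IsCorep r) :
    MatEquiv (ofMatrix e hr).mat r :=
  MatEquiv.of_equiv e fun _ _ => rfl

/-- The direct sum of corepresentations. -/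
def add (r s : G.Corep) : G.Corep :=
  ofMatrix finSumFinEquiv.symm (r.isCorep.fromBlocks s.isCorep)

/-- The tensor product of corepresentations, `r₁₃ s₂₃`. -/
def mul (r s : G.Corep) : G.Corep :=
  ofMatrix finProdFinEquiv.symm (r.isCorep.matTensor s.isCorep)

variable (G) in
/-- The zero-dimensional corepresentation. -/
def zero : G.Corep where
  dim := 0
  mat := 0
  isCorep := isCorep_of_isEmpty _

variable (G) in
/-- The trivial one-dimensional corepresentation. -/
def one : G.Corep where
  dim := 1
  mat := 1
  isCorep := isCorep_one

variable (G) in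
/-- The fundamental corepresentation `u`. -/
def fundamental : G.Corep where
  dim := n
  mat := Matrix.of fun i j => coeffEntry G.u i j
  isCorep :=
    { isUnit := by
        refine ⟨⟨Matrix.of fun i j => coeffEntry G.u i j,
          Matrix.of fun i j => star (coeffEntry G.u j i), ?_, ?_⟩, rfl⟩
        · ext i j
          have h : (G.u * star G.u) i j = (1 : Matrix (Fin n) (Fin n) A) i j := by
            rw [Unitary.mul_star_self_of_mem G.u_unitary]
          simp only [Matrix.mul_apply, Matrix.star_apply, Matrix.one_apply] at h
          rw [Matrix.mul_apply, Matrix.one_apply, AddSubmonoidClass.coe_finsetSum,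
            apply_ite Subtype.val]
          exact h
        · ext i j
          have h : (star G.u * G.u) i j = (1 : Matrix (Fin n) (Fin n) A) i j := by
            rw [Unitary.star_mul_self_of_mem G.u_unitary]
          simp only [Matrix.mul_apply, Matrix.star_apply, Matrix.one_apply] at h
          rw [Matrix.mul_apply, Matrix.one_apply, AddSubmonoidClass.coe_finsetSum,
            apply_ite Subtype.val]
          exact h
      δ_apply := fun i j => G.δ_u i j }

end Corep

variable (G) in
/-- Equivalence of corepresentations: `T r = s T` for some invertible scalar matrix `T`. -/
instance corepSetoid : Setoid G.Corep where
  r r s := MatEquiv r.mat s.mat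
  iseqv := ⟨fun r => MatEquiv.refl r.mat, MatEquiv.symm, MatEquiv.trans⟩

variable (G) in
/-- The fusion semiring `R⁺(A)`: equivalence classes of finite dimensional corepresentations. -/
def FusionSemiring : Type u := Quotient (corepSetoid G)

namespace FusionSemiring

/-- The class of a corepresentation. -/
def mk (r : G.Corep) : G.FusionSemiring := Quotient.mk (corepSetoid G) r

theorem mk_eq {r s : G.Corep} (h : MatEquiv r.mat s.mat) : mk r = mk s := Quotient.sound h

instance : Add G.FusionSemiring where
  add := Quotient.map₂ Corep.add fun _ _ h _ _ k =>
    ((Corep.ofMatrix_equiv _ _).trans (MatEquiv.fromBlocks h k)).trans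
      (Corep.ofMatrix_equiv _ _).symm

instance : Mul G.FusionSemiring where
  mul := Quotient.map₂ Corep.mul fun _ _ h _ _ k =>
    ((Corep.ofMatrix_equiv _ _).trans (MatEquiv.matTensor h k)).trans
      (Corep.ofMatrix_equiv _ _).symm

instance : Zero G.FusionSemiring := ⟨mk (Corep.zero G)⟩

instance : One G.FusionSemiring := ⟨mk (Corep.one G)⟩

theorem add_def (r s : G.Corep) : mk r + mk s = mk (r.add s) := rfl

theorem mul_def (r s : G.Corep) : mk r * mk s = mk (r.mul s) := rfl

theorem zero_def : (0 : G.FusionSemiring) = mk (Corep.zero G) := rfl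

theorem one_def : (1 : G.FusionSemiring) = mk (Corep.one G) := rfl

theorem add_equiv (r s : G.Corep) :
    MatEquiv (r.add s).mat (Matrix.fromBlocks r.mat 0 0 s.mat) := Corep.ofMatrix_equiv _ _

theorem mul_equiv (r s : G.Corep) :
    MatEquiv (r.mul s).mat (matTensor r.mat s.mat) := Corep.ofMatrix_equiv _ _

theorem ind {p : G.FusionSemiring → Prop} (h : ∀ r, p (mk r)) (x : G.FusionSemiring) : p x :=
  Quotient.inductionOn x h

instance : Semiring G.FusionSemiring where
  add_assoc x y z := by
    induction x using ind with | _ r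
    induction y using ind with | _ s
    induction z using ind with | _ t
    refine mk_eq ?_
    refine ((add_equiv _ _).trans ((add_equiv r s).fromBlocks (MatEquiv.refl t.mat))).trans
      (MatEquiv.trans ?_
        ((add_equiv _ _).trans ((MatEquiv.refl r.mat).fromBlocks (add_equiv s t))).symm)
    refine MatEquiv.of_equiv (Equiv.sumAssoc _ _ _) ?_
    rintro ((i | i) | i) ((j | j) | j) <;> rfl
  zero_add x := by
    induction x using ind with | _ r
    refine mk_eq ((add_equiv _ _).trans ?_)
    refine MatEquiv.of_equiv (Equiv.emptySum (Fin 0) _) ?_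
    rintro (i | i) (j | j)
    · exact i.elim0
    · exact i.elim0
    · exact j.elim0
    · rfl
  add_zero x := by
    induction x using ind with | _ r
    refine mk_eq ((add_equiv _ _).trans ?_)
    refine MatEquiv.of_equiv (Equiv.sumEmpty _ (Fin 0)) ?_
    rintro (i | i) (j | j)
    · rfl
    · exact j.elim0
    · exact i.elim0
    · exact i.elim0
  add_comm x y := by
    induction x using ind with | _ r
    induction y using ind with | _ s
    refine mk_eq ((add_equiv _ _).trans (MatEquiv.trans ?_ (add_equiv _ _).symm))
    refine MatEquiv.of_equiv (Equiv.sumComm _ _) ?_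
    rintro (i | i) (j | j) <;> rfl
  nsmul := nsmulRec
  mul_assoc x y z := by
    induction x using ind with | _ r
    induction y using ind with | _ s
    induction z using ind with | _ t
    refine mk_eq ?_
    refine ((mul_equiv _ _).trans ((mul_equiv r s).matTensor (MatEquiv.refl t.mat))).trans
      (MatEquiv.trans ?_
        ((mul_equiv _ _).trans ((MatEquiv.refl r.mat).matTensor (mul_equiv s t))).symm)
    refine MatEquiv.of_equiv (Equiv.prodAssoc _ _ _) ?_
    rintro ⟨⟨i, i'⟩, i''⟩ ⟨⟨j, j'⟩, j''⟩
    exact mul_assoc _ _ _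
  one_mul x := by
    induction x using ind with | _ r
    refine mk_eq ((mul_equiv _ _).trans ?_)
    refine MatEquiv.of_equiv (Equiv.uniqueProd _ (Fin 1)) ?_
    rintro ⟨i, i'⟩ ⟨j, j'⟩
    obtain rfl : i = j := Subsingleton.elim (α := Fin 1) i j
    have h : (Corep.one G).mat i i = 1 := Matrix.one_apply_eq i
    exact (congrArg (· * r.mat i' j') h).trans (one_mul _)
  mul_one x := by
    induction x using ind with | _ r
    refine mk_eq ((mul_equiv _ _).trans ?_)
    refine MatEquiv.of_equiv (Equiv.prodUnique _ (Fin 1)) ?_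
    rintro ⟨i, i'⟩ ⟨j, j'⟩
    obtain rfl : i' = j' := Subsingleton.elim (α := Fin 1) i' j'
    have h : (Corep.one G).mat i' i' = 1 := Matrix.one_apply_eq i'
    exact (congrArg (r.mat i j * ·) h).trans (mul_one _)
  left_distrib x y z := by
    induction x using ind with | _ r
    induction y using ind with | _ s
    induction z using ind with | _ t
    refine mk_eq ?_
    refine ((mul_equiv _ _).trans ((MatEquiv.refl r.mat).matTensor (add_equiv s t))).trans
      (MatEquiv.trans ?_
        ((add_equiv _ _).trans ((mul_equiv r s).fromBlocks (mul_equiv r t))).symm)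
    refine MatEquiv.of_equiv (Equiv.prodSumDistrib _ _ _) ?_
    rintro ⟨i, i' | i'⟩ ⟨j, j' | j'⟩
    · rfl
    · exact mul_zero _
    · exact mul_zero _
    · rfl
  right_distrib x y z := by
    induction x using ind with | _ r
    induction y using ind with | _ s
    induction z using ind with | _ t
    refine mk_eq ?_
    refine ((mul_equiv _ _).trans ((add_equiv r s).matTensor (MatEquiv.refl t.mat))).trans
      (MatEquiv.trans ?_
        ((add_equiv _ _).trans ((mul_equiv r t).fromBlocks (mul_equiv s t))).symm)
    refine MatEquiv.of_equiv (Equiv.sumProdDistrib _ _ _) ?_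
    rintro ⟨i | i, i'⟩ ⟨j | j, j'⟩
    · rfl
    · exact zero_mul _
    · exact zero_mul _
    · rfl
  zero_mul x := by
    induction x using ind with | _ r
    refine mk_eq ((mul_equiv _ _).trans ?_)
    have : IsEmpty (Fin (Corep.zero G).dim) := Fin.isEmpty
    exact MatEquiv.of_equiv (Equiv.equivOfIsEmpty _ (Fin 0)) fun i => i.1.elim0
  mul_zero x := by
    induction x using ind with | _ r
    refine mk_eq ((mul_equiv _ _).trans ?_)
    have : IsEmpty (Fin (Corep.zero G).dim) := Fin.isEmpty
    exact MatEquiv.of_equiv (Equiv.equivOfIsEmpty _ (Fin 0)) fun i => i.2.elim0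

/-- The dimension of a class of corepresentations. -/
def dim : G.FusionSemiring → ℕ :=
  Quotient.lift Corep.dim fun _ _ h => by simpa using MatEquiv.card_eq h

variable (G) in
/-- The class of the fundamental corepresentation `u`. -/
def fundamental : G.FusionSemiring := mk (Corep.fundamental G)

end FusionSemiring

/-! ### Amenability -/

variable (G)

/-- The Haar measure of `A`: a state `h` with `(h ⊗ id) δ = h(·) 1 = (id ⊗ h) δ`. The invariance is
imposed on the dense subalgebra `A_s`, on which `δ` takes values in algebraic tensors
`∑ x_k ⊗ y_k`. -/
structure IsHaarMeasure (h : A →L[ℂ] ℂ) : Prop where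
  map_one : h 1 = 1
  nonneg : ∀ a, 0 ≤ h (star a * a)
  left_invariant : ∀ a ∈ coeffAlgebra G.u, ∀ (m : ℕ) (x y : Fin m → A),
    G.δ a = ∑ k, G.tmul (x k) (y k) → ∑ k, h (x k) • y k = h a • (1 : A)
  right_invariant : ∀ a ∈ coeffAlgebra G.u, ∀ (m : ℕ) (x y : Fin m → A),
    G.δ a = ∑ k, G.tmul (x k) (y k) → ∑ k, h (y k) • x k = h a • (1 : A)

/-- `ι : A_s → P` exhibits the C*-algebra `P` as the enveloping C*-algebra `A_p` of `A_s`: it has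
dense range, and every `*`-morphism from `A_s` to a C*-algebra factors through it. -/
structure IsFullVersion {P : Type u} [CStarAlgebra P] (ι : coeffAlgebra G.u →⋆ₐ[ℂ] P) : Prop where
  dense : DenseRange ι
  exists_lift : ∀ (D : Type u) [CStarAlgebra D] (φ : coeffAlgebra G.u →⋆ₐ[ℂ] D),
    ∃ ψ : P →⋆ₐ[ℂ] D, ∀ a, ψ (ι a) = φ a

/-- `q : A → R` exhibits the C*-algebra `R` as the quotient `A_red = A / {x | h(x* x) = 0}`, where
`h` is the Haar measure of `A`. -/
structure IsReducedVersion {R : Type u} [CStarAlgebra R] (q : A →⋆ₐ[ℂ] R) : Prop where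
  surjective : Function.Surjective q
  ker : ∃ h : A →L[ℂ] ℂ, G.IsHaarMeasure h ∧ ∀ x, q x = 0 ↔ h (star x * x) = 0

/-- `A` is amenable (as a Woronowicz algebra): the canonical surjection `θ : A_p → A_red`, which
is the identity on `A_s`, is an isomorphism. -/
def IsAmenable : Prop :=
  ∃ (P : Type u) (_ : CStarAlgebra P) (ι : coeffAlgebra G.u →⋆ₐ[ℂ] P)
    (R : Type u) (_ : CStarAlgebra R) (q : A →⋆ₐ[ℂ] R) (θ : P →⋆ₐ[ℂ] R),
    G.IsFullVersion ι ∧ G.IsReducedVersion q ∧ (∀ a, θ (ι a) = q (a : A)) ∧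
      Function.Bijective θ

end WoronowiczPair

end

/-! Write `χ(x)` for the character of a class `x` and `h`, `k` for the Haar measures of `A`, `B`.
The number `h(χ(x))` is the multiplicity of the trivial corepresentation in `x`. A semiring
isomorphism `f` preserves `1` and sums, hence these multiplicities (`res_character_map`). It also
preserves conjugation, because the conjugate of an indecomposable `x` is the only indecomposable `t`
such that `t * x` contains `1` (`map_conj`). So the self-adjoint elements `χ(x̄x)` and `χ(f(x̄x))`
have the same moments under `h` and `k`.

Moments control the norm in the reduced algebra (`norm_le_of_moments`): if the even ones grow at
most like `C ^ (2 * j)`, the image of `χ(x̄x)` in `A_red` has norm at most `C`. If `A` is amenable,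
its counit is bounded by the reduced norm, and it sends `χ(x̄x)` to `(dim x)²`; hence `(dim x)² ≤ C`
(`dim_sq_le_of_moments_map`). On the `B` side the moments are bounded with `C = (dim f(x))²`, since
characters of unitary corepresentations have norm at most the dimension. This gives `dim x ≤ dim
f(x)`. If `B` is amenable too, the same inequality for the inverse of `f` gives equality.

The implication from `dim v = dim u` to amenability of `B` is a Kesten type criterion
(`isAmenable_of_moments`). By the transfer of moments, those of `χ(1 + v)` see the full dimension of
`1 + v`, so there are unit GNS vectors on which `1 + ∑ v i i` nearly attains its maximal norm.
Uniform convexity makes them almost invariant under the diagonal entries, unitarity under the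
others, so their vector states converge to the counit. Slicing the comultiplication by a vector
state is a unital completely positive map dominated by the reduced norm (`norm_slice_le`); in the
limit the reduced norm dominates every C*-seminorm of `A_s`, and `A_red` is the enveloping algebra.

All this rests on Woronowicz's theory, derived here from the axioms: counit, existence and two-sided
invariance of the Haar measure, unitarisation, Schur orthogonality, faithfulness on `A_s`, and the
modular property that makes the null space of `h` a two-sided ideal. -/

noncomputable section

open TensorProduct

/-! ### Algebraic tensors inside the minimal tensor product -/

section OpTensor

variable {H : Type u} {K : Type v} [NormedAddCommGroup H] [InnerProductSpace ℂ H]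
  [NormedAddCommGroup K] [InnerProductSpace ℂ K]

/-- The elementary vector `ξ ⊗ η`. -/
def vecTensor (ξ : H) (η : K) : HilbertTensor H K :=
  ((ξ ⊗ₜ[ℂ] η : TensorProduct ℂ H K) : UniformSpace.Completion (TensorProduct ℂ H K))

theorem opTensor_vecTensor (S : H →L[ℂ] H) (T : K →L[ℂ] K) (ξ : H) (η : K) :
    opTensor S T (vecTensor ξ η) = vecTensor (S ξ) (T η) := by
  rw [vecTensor, opTensor_coe]
  rfl

theorem inner_vecTensor (ξ ξ' : H) (η η' : K) :
    inner ℂ (vecTensor ξ η) (vecTensor ξ' η') = inner ℂ ξ ξ' * inner ℂ η η' :=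
  (UniformSpace.Completion.inner_coe _ _).trans (TensorProduct.inner_tmul _ _ _ _ _)

theorem norm_vecTensor (ξ : H) (η : K) : ‖vecTensor ξ η‖ = ‖ξ‖ * ‖η‖ :=
  (UniformSpace.Completion.norm_coe _).trans (TensorProduct.norm_tmul _ _)

/-- Elementary vectors span a dense subspace, so their matrix coefficients determine a bounded
operator. This reduces the identities for `opTensor` to `inner_vecTensor`. -/
theorem vecTensor_ext {P Q : HilbertTensor H K →L[ℂ] HilbertTensor H K}
    (h : ∀ ξ ξ' η η', inner ℂ (vecTensor ξ η) (P (vecTensor ξ' η')) =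
      inner ℂ (vecTensor ξ η) (Q (vecTensor ξ' η'))) : P = Q := by
  apply hilbertTensor_clm_ext
  intro x
  induction x using TensorProduct.induction_on with
  | zero => 
    rw [show (((0 : TensorProduct ℂ H K)) : UniformSpace.Completion (TensorProduct ℂ H K)) = 0 from
      UniformSpace.Completion.coe_zero]
    exact (map_zero P).trans (map_zero Q).symm
  | add x y hx hy => 
    rw [show (((x + y : TensorProduct ℂ H K)) : UniformSpace.Completion (TensorProduct ℂ H K)) = 
      (x : UniformSpace.Completion (TensorProduct ℂ H K)) + y from
      UniformSpace.Completion.coe_add _ _]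
    exact (map_add P _ _).trans ((congrArg₂ _ hx hy).trans (map_add Q _ _).symm)
  | tmul ξ' η' =>
    refine ext_inner_left ℂ fun z => ?_
    induction z using UniformSpace.Completion.induction_on with
    | hp => 
      refine isClosed_eq ?_ ?_
      · exact continuous_id.inner continuous_const
      · exact continuous_id.inner continuous_const
    | ih z => 
      induction z using TensorProduct.induction_on with
      | zero => 
        rw [show (((0 : TensorProduct ℂ H K)) : UniformSpace.Completion (TensorProduct ℂ H K)) = 0
          from UniformSpace.Completion.coe_zero]
        exact (inner_zero_left _).trans (inner_zero_left _).symm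
      | add x y hx hy => 
        rw [show (((x + y : TensorProduct ℂ H K)) : 
          UniformSpace.Completion (TensorProduct ℂ H K)) = 
          (x : UniformSpace.Completion (TensorProduct ℂ H K)) + y from
          UniformSpace.Completion.coe_add _ _]
        exact (inner_add_left _ _ _).trans ((congrArg₂ _ hx hy).trans (inner_add_left _ _ _).symm)
      | tmul ξ η => exact h ξ ξ' η η'

theorem opTensor_add_left (S S' : H →L[ℂ] H) (T : K →L[ℂ] K) :
    opTensor (S + S') T = opTensor S T + opTensor S' T := by
  refine vecTensor_ext fun ξ ξ' η η' => ?_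
  rw [add_apply, inner_add_right]
  simp only [opTensor_vecTensor, inner_vecTensor, add_apply, inner_add_right, add_mul]

theorem opTensor_add_right (S : H →L[ℂ] H) (T T' : K →L[ℂ] K) :
    opTensor S (T + T') = opTensor S T + opTensor S T' := by
  refine vecTensor_ext fun ξ ξ' η η' => ?_
  rw [add_apply, inner_add_right]
  simp only [opTensor_vecTensor, inner_vecTensor, add_apply, inner_add_right, mul_add]

theorem opTensor_smul_left (c : ℂ) (S : H →L[ℂ] H) (T : K →L[ℂ] K) :
    opTensor (c • S) T = c • opTensor S T := by
  refine vecTensor_ext fun ξ ξ' η η' => ?_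
  rw [smul_apply, inner_smul_right]
  simp only [opTensor_vecTensor, inner_vecTensor, smul_apply, inner_smul_right, mul_assoc]

theorem opTensor_smul_right (c : ℂ) (S : H →L[ℂ] H) (T : K →L[ℂ] K) :
    opTensor S (c • T) = c • opTensor S T := by
  refine vecTensor_ext fun ξ ξ' η η' => ?_
  rw [smul_apply, inner_smul_right]
  simp only [opTensor_vecTensor, inner_vecTensor, smul_apply, inner_smul_right, mul_left_comm]

theorem star_opTensor [CompleteSpace H] [CompleteSpace K] (S : H →L[ℂ] H) (T : K →L[ℂ] K) :
    star (opTensor S T) = opTensor (star S) (star T) := by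
  refine vecTensor_ext fun ξ ξ' η η' => ?_
  rw [ContinuousLinearMap.star_eq_adjoint, ContinuousLinearMap.adjoint_inner_right,
    opTensor_vecTensor, opTensor_vecTensor, inner_vecTensor, inner_vecTensor,
    ContinuousLinearMap.star_eq_adjoint, ContinuousLinearMap.star_eq_adjoint,
    ContinuousLinearMap.adjoint_inner_right, ContinuousLinearMap.adjoint_inner_right]

end OpTensor

section AlgTensor

variable {A : Type u} [CStarAlgebra A] {B : Type v} [CStarAlgebra B]
  (ρ : FaithfulRep A) (σ : FaithfulRep B)

/-- The representation of the algebraic tensor product on `H ⊗ K`. -/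
def algTensorRep : A ⊗[ℂ] B →ₐ[ℂ] (HilbertTensor ρ.H σ.H →L[ℂ] HilbertTensor ρ.H σ.H) :=
  Algebra.TensorProduct.lift
    { toFun := fun a => opTensor (ρ.π a) 1
      map_one' := by rw [map_one, opTensor_one]
      map_mul' := fun a b => by rw [map_mul, opTensor_mul, one_mul]
      map_zero' := by rw [map_zero, opTensor_zero_left]
      map_add' := fun a b => by rw [map_add, opTensor_add_left]
      commutes' := fun c => by
        rw [AlgHomClass.commutes, Algebra.algebraMap_eq_smul_one, opTensor_smul_left, opTensor_one,
          Algebra.algebraMap_eq_smul_one] }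
    { toFun := fun b => opTensor 1 (σ.π b)
      map_one' := by rw [map_one, opTensor_one]
      map_mul' := fun a b => by rw [map_mul, opTensor_mul, one_mul]
      map_zero' := by rw [map_zero, opTensor_zero_right]
      map_add' := fun a b => by rw [map_add, opTensor_add_right]
      commutes' := fun c => by
        rw [AlgHomClass.commutes, Algebra.algebraMap_eq_smul_one, opTensor_smul_right, opTensor_one,
          Algebra.algebraMap_eq_smul_one] }
    fun a b => by
      change opTensor _ _ * opTensor _ _ = opTensor _ _ * opTensor _ _
      rw [opTensor_mul, opTensor_mul, one_mul, one_mul, mul_one, mul_one]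

theorem algTensorRep_tmul (a : A) (b : B) :
    algTensorRep ρ σ (a ⊗ₜ b) = opTensor (ρ.π a) (σ.π b) := by
  rw [algTensorRep, Algebra.TensorProduct.lift_tmul]
  change opTensor _ _ * opTensor _ _ = _
  rw [opTensor_mul, one_mul, mul_one]

theorem algTensorRep_star (t : A ⊗[ℂ] B) :
    algTensorRep ρ σ (star t) = star (algTensorRep ρ σ t) := by
  induction t using TensorProduct.induction_on with
  | zero => simp
  | add x y hx hy => rw [star_add, map_add, map_add, star_add, hx, hy]
  | tmul a b =>
    rw [TensorProduct.star_tmul, algTensorRep_tmul, algTensorRep_tmul, star_opTensor, map_star,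
      map_star]

/-- The slice of an algebraic tensor by a vector functional of the first factor. -/
theorem inner_algTensorRep (t : A ⊗[ℂ] B) (ξ ξ' : ρ.H) (η η' : σ.H) :
    inner ℂ (vecTensor ξ η) (algTensorRep ρ σ t (vecTensor ξ' η')) =
      inner ℂ η (σ.π (TensorProduct.lid ℂ B (TensorProduct.map
        ((innerₛₗ ℂ ξ) ∘ₗ (ContinuousLinearMap.apply ℂ ρ.H ξ').toLinearMap ∘ₗ
          ρ.π.toAlgHom.toLinearMap) LinearMap.id t)) η') := by
  induction t using TensorProduct.induction_on with
  | zero => simp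
  | add x y hx hy =>
    simp only [map_add, add_apply, inner_add_right, hx, hy]
  | tmul a b =>
    rw [algTensorRep_tmul, opTensor_vecTensor, inner_vecTensor]
    simp

/-- If `t` acts as zero, all slices of `t` by vector functionals of the first factor vanish, by
faithfulness of `σ`. Expanding `t` in a basis of `B`, each coefficient in `A` then has zero matrix
coefficients, and faithfulness of `ρ` kills it. Identities in the minimal tensor product between
algebraic tensors can therefore be read algebraically. -/
theorem algTensorRep_injective : Function.Injective (algTensorRep ρ σ) := by
  rw [injective_iff_map_eq_zero]
  intro t ht
  have h1 : ∀ ξ ξ' : ρ.H, TensorProduct.lid ℂ B (TensorProduct.map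
        ((innerₛₗ ℂ ξ) ∘ₗ (ContinuousLinearMap.apply ℂ ρ.H ξ').toLinearMap ∘ₗ
          ρ.π.toAlgHom.toLinearMap) LinearMap.id t) = 0 := by
    intro ξ ξ'
    apply σ.injective
    rw [map_zero]
    ext η'
    refine ext_inner_left ℂ fun η => ?_
    rw [← inner_algTensorRep, ht]
    simp
  classical
  let b := Module.Basis.ofVectorSpace ℂ B
  apply (TensorProduct.equivFinsuppOfBasisRight (M := A) b).injective
  rw [map_zero]
  ext i
  apply ρ.injective
  rw [Finsupp.zero_apply, map_zero]
  ext ξ'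
  refine ext_inner_left ℂ fun ξ => ?_
  have key : ∀ t : A ⊗[ℂ] B, inner ℂ ξ (ρ.π (TensorProduct.equivFinsuppOfBasisRight b t i) ξ') =
      b.repr (TensorProduct.lid ℂ B (TensorProduct.map
        ((innerₛₗ ℂ ξ) ∘ₗ (ContinuousLinearMap.apply ℂ ρ.H ξ').toLinearMap ∘ₗ
          ρ.π.toAlgHom.toLinearMap) LinearMap.id t)) i := by
    intro t
    induction t using TensorProduct.induction_on with
    | zero => simp
    | add x y hx hy =>
      simp only [map_add, Finsupp.add_apply, add_apply, inner_add_right, hx, hy]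
    | tmul a c =>
      simp [mul_comm]
  rw [key, h1]
  simp

theorem coe_elemTensor (a : A) (b : B) :
    (elemTensor ρ σ a b : HilbertTensor ρ.H σ.H →L[ℂ] HilbertTensor ρ.H σ.H) =
      algTensorRep ρ σ (a ⊗ₜ b) := (algTensorRep_tmul ρ σ a b).symm

end AlgTensor

/-! ### The algebraic comultiplication of `A_s`. -/

namespace WoronowiczPair

variable {A : Type u} [CStarAlgebra A] {n : ℕ} (G : WoronowiczPair A n)

/-- The comultiplication as a map into the bounded operators. -/
def δOp : A →⋆ₐ[ℂ] (HilbertTensor G.rep.H G.rep.H →L[ℂ] HilbertTensor G.rep.H G.rep.H) :=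
  (minTensor G.rep G.rep).subtype.comp G.δ

theorem coe_sum_tmul {ι : Type*} (s : Finset ι) (x y : ι → A) :
    ((∑ k ∈ s, G.tmul (x k) (y k) : minTensor G.rep G.rep) : _ →L[ℂ] _) =
      algTensorRep G.rep G.rep (∑ k ∈ s, x k ⊗ₜ y k) := by
  rw [AddSubmonoidClass.coe_finsetSum, map_sum]
  exact Finset.sum_congr rfl fun k _ => coe_elemTensor _ _ _ _

theorem δ_eq_sum_iff {ι : Type*} (a : A) (s : Finset ι) (x y : ι → A) :
    G.δ a = ∑ k ∈ s, G.tmul (x k) (y k) ↔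
      G.δOp a = algTensorRep G.rep G.rep (∑ k ∈ s, x k ⊗ₜ y k) := by
  rw [← coe_sum_tmul]
  exact Subtype.ext_iff

/-- The inclusion of `A_s ⊗ A_s` in the operators on `H ⊗ H`. -/
def coeffTensorRep : coeffAlgebra G.u ⊗[ℂ] coeffAlgebra G.u →ₐ[ℂ]
    (HilbertTensor G.rep.H G.rep.H →L[ℂ] HilbertTensor G.rep.H G.rep.H) :=
  (algTensorRep G.rep G.rep).comp (Algebra.TensorProduct.map
    (coeffAlgebra G.u).subtype.toAlgHom (coeffAlgebra G.u).subtype.toAlgHom)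

theorem coeffTensorRep_tmul (a b : coeffAlgebra G.u) :
    G.coeffTensorRep (a ⊗ₜ b) = algTensorRep G.rep G.rep ((a : A) ⊗ₜ (b : A)) := rfl

theorem coeffTensorRep_star (t : coeffAlgebra G.u ⊗[ℂ] coeffAlgebra G.u) :
    G.coeffTensorRep (star t) = star (G.coeffTensorRep t) := by
  induction t using TensorProduct.induction_on with
  | zero => simp
  | add x y hx hy => rw [star_add, map_add, map_add, star_add, hx, hy]
  | tmul a b =>
    rw [TensorProduct.star_tmul, coeffTensorRep_tmul, coeffTensorRep_tmul, ← algTensorRep_star,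
      TensorProduct.star_tmul]
    rfl

theorem coeffTensorRep_injective : Function.Injective G.coeffTensorRep := by
  refine (algTensorRep_injective G.rep G.rep).comp ?_
  exact TensorProduct.map_injective_of_flat_flat
    (coeffAlgebra G.u).subtype.toAlgHom.toLinearMap
    (coeffAlgebra G.u).subtype.toAlgHom.toLinearMap
    Subtype.val_injective Subtype.val_injective

/-- The elements sent into `A_s ⊗ A_s` form a `*`-subalgebra, which contains the entries of `u` by
`δ_u`. -/
theorem δOp_mem_range (a : coeffAlgebra G.u) : G.δOp a ∈ G.coeffTensorRep.range := by
  obtain ⟨a, ha⟩ := a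
  change G.δOp a ∈ _
  induction ha using StarAlgebra.adjoin_induction with
  | mem x hx =>
    obtain ⟨i, j, rfl⟩ := hx
    refine ⟨∑ k, coeffEntry G.u i k ⊗ₜ coeffEntry G.u k j, ?_⟩
    rw [(G.δ_eq_sum_iff _ _ _ _).1 (G.δ_u i j)]
    simp only [map_sum]
    rfl
  | algebraMap r =>
    rw [AlgHomClass.commutes]
    exact Subalgebra.algebraMap_mem _ _
  | add x y _ _ hx hy => rw [map_add]; exact add_mem hx hy
  | mul x y _ _ hx hy => rw [map_mul]; exact mul_mem hx hy
  | star x _ hx =>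
    obtain ⟨t, ht⟩ := hx
    exact ⟨star t, (G.coeffTensorRep_star t).trans ((congrArg star ht).trans (map_star G.δOp x).symm)⟩

/-- The comultiplication of the algebra `A_s`. -/
def comul : coeffAlgebra G.u →ₐ[ℂ] coeffAlgebra G.u ⊗[ℂ] coeffAlgebra G.u :=
  ((AlgEquiv.ofInjective G.coeffTensorRep G.coeffTensorRep_injective).symm :
    G.coeffTensorRep.range →ₐ[ℂ] _).comp
    ((G.δOp.toAlgHom.comp (coeffAlgebra G.u).subtype.toAlgHom).codRestrict
      G.coeffTensorRep.range G.δOp_mem_range)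

theorem coeffTensorRep_comul (a : coeffAlgebra G.u) : G.coeffTensorRep (G.comul a) = G.δOp a := by
  have := (AlgEquiv.ofInjective G.coeffTensorRep G.coeffTensorRep_injective).apply_symm_apply
    ⟨G.δOp a, G.δOp_mem_range a⟩
  exact congrArg Subtype.val this

theorem comul_star (a : coeffAlgebra G.u) : G.comul (star a) = star (G.comul a) := by
  apply G.coeffTensorRep_injective
  rw [coeffTensorRep_comul, coeffTensorRep_star, coeffTensorRep_comul, ← map_star]
  rfl

theorem δ_eq_sum_iff_comul {ι : Type*} (a : coeffAlgebra G.u) (s : Finset ι)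
    (x y : ι → coeffAlgebra G.u) :
    G.δ a = ∑ k ∈ s, G.tmul (x k) (y k) ↔ G.comul a = ∑ k ∈ s, x k ⊗ₜ y k := by
  rw [δ_eq_sum_iff, ← coeffTensorRep_comul, ← G.coeffTensorRep_injective.eq_iff]
  simp only [map_sum, coeffTensorRep_tmul]

variable {G}

theorem IsCorep.comul_apply {ι : Type*} [Fintype ι] [DecidableEq ι]
    {r : Matrix ι ι (coeffAlgebra G.u)} (hr : G.IsCorep r) (i j : ι) :
    G.comul (r i j) = ∑ k, r i k ⊗ₜ r k j :=
  (G.δ_eq_sum_iff_comul _ _ _ _).1 (hr.δ_apply i j)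

theorem isCorep_iff {ι : Type*} [Fintype ι] [DecidableEq ι]
    {r : Matrix ι ι (coeffAlgebra G.u)} :
    G.IsCorep r ↔ IsUnit r ∧ ∀ i j, G.comul (r i j) = ∑ k, r i k ⊗ₜ r k j :=
  ⟨fun h => ⟨h.isUnit, h.comul_apply⟩,
    fun h => ⟨h.1, fun i j => (G.δ_eq_sum_iff_comul _ _ _ _).2 (h.2 i j)⟩⟩

end WoronowiczPair

/-! ### The antipode and the counit -/

namespace WoronowiczPair

variable {A : Type u} [CStarAlgebra A] {n : ℕ} (G : WoronowiczPair A n)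

/-- The inverse `a ↦ κ(a*)*` of the antipode. -/
def κInv : coeffAlgebra G.u →ₗ[ℂ] coeffAlgebra G.u where
  toFun a := star (G.κ (star a))
  map_add' a b := by simp
  map_smul' c a := by simp

theorem κInv_apply (a : coeffAlgebra G.u) : G.κInv a = star (G.κ (star a)) := rfl

theorem κ_κInv (a : coeffAlgebra G.u) : G.κ (G.κInv a) = a := G.κ_star a

theorem κInv_κ (a : coeffAlgebra G.u) : G.κInv (G.κ a) = a := by
  have h := G.κ_star (star a)
  rw [star_star] at h
  rw [κInv_apply, h, star_star]

theorem κ_one : G.κ 1 = 1 := by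
  have h := G.κ_mul (G.κInv 1) 1
  rwa [mul_one, κ_κInv, mul_one, eq_comm] at h

theorem κInv_one : G.κInv 1 = 1 := by
  rw [κInv_apply, star_one, κ_one, star_one]

theorem κInv_mul (a b : coeffAlgebra G.u) : G.κInv (a * b) = G.κInv b * G.κInv a := by
  simp only [κInv_apply, star_mul, G.κ_mul]

section

variable {ι ι' : Type*} [Fintype ι] [DecidableEq ι] [Fintype ι'] [DecidableEq ι']

/-- The antipode inverts the matrix `r`. -/
def AntipodeInverts (r : Matrix ι ι (coeffAlgebra G.u)) : Prop :=
  (∀ i j, ∑ k, G.κ (r i k) * r k j = if i = j then 1 else 0) ∧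
    ∀ i j, ∑ k, r i k * G.κ (r k j) = if i = j then 1 else 0

variable {G} {r : Matrix ι ι (coeffAlgebra G.u)} {s : Matrix ι' ι' (coeffAlgebra G.u)}

theorem antipodeInverts_of_mul_eq_one (hr : IsUnit r)
    (h : ∀ i j, ∑ k, G.κ (r i k) * r k j = if i = j then 1 else 0) : G.AntipodeInverts r := by
  refine ⟨h, ?_⟩
  have h1 : r.map G.κ * r = 1 := by
    refine Matrix.ext fun i j => ?_
    rw [Matrix.mul_apply, Matrix.one_apply]
    exact h i j
  have h2 : r * r.map G.κ = 1 := by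
    obtain ⟨⟨a, b, hab, hba⟩, rfl⟩ := hr
    have : a.map G.κ = b := by
      calc a.map G.κ = a.map G.κ * (a * b) := by rw [hab, mul_one]
        _ = b := by rw [← mul_assoc, h1, one_mul]
    simp [this, hab]
  intro i j
  have := congrFun (congrFun h2 i) j
  rwa [Matrix.mul_apply, Matrix.one_apply] at this

theorem AntipodeInverts.isUnit (h : G.AntipodeInverts r) : IsUnit r := by
  refine ⟨⟨r, r.map G.κ, ?_, ?_⟩, rfl⟩
  · refine Matrix.ext fun i j => ?_
    rw [Matrix.mul_apply, Matrix.one_apply]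
    exact h.2 i j
  · refine Matrix.ext fun i j => ?_
    rw [Matrix.mul_apply, Matrix.one_apply]
    exact h.1 i j

theorem AntipodeInverts.sum_mul_κInv (h : G.AntipodeInverts r) (i j : ι) :
    ∑ k, r k j * G.κInv (r i k) = if i = j then 1 else 0 := by
  have := congrArg G.κInv (h.2 i j)
  simpa [κInv_mul, κInv_κ, apply_ite G.κInv, κInv_one] using this

theorem AntipodeInverts.sum_κInv_mul (h : G.AntipodeInverts r) (i j : ι) :
    ∑ k, G.κInv (r k j) * r i k = if i = j then 1 else 0 := by
  have := congrArg G.κInv (h.1 i j)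
  simpa [κInv_mul, κInv_κ, apply_ite G.κInv, κInv_one] using this

/-- Since `κ(a*) = κ⁻¹(a)*`, the adjoints of the relations for `κ⁻¹` are the relations of `κ` for
the conjugate matrix. This is what makes the conjugate of `u` invertible. -/
theorem AntipodeInverts.conj (h : G.AntipodeInverts r) : G.AntipodeInverts (r.map star) := by
  constructor
  · intro i j
    have := congrArg star (h.sum_mul_κInv i j)
    simpa [κInv_apply, apply_ite (star : coeffAlgebra G.u → coeffAlgebra G.u)] using this
  · intro i j
    have := congrArg star (h.sum_κInv_mul i j)
    simpa [κInv_apply, apply_ite (star : coeffAlgebra G.u → coeffAlgebra G.u)] using this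

/-- Because `κ` reverses products, the sum over the index of `r` is innermost and collapses first,
leaving the relation for `s`. -/
theorem AntipodeInverts.matTensor (hr : G.AntipodeInverts r) (hs : G.AntipodeInverts s) :
    G.AntipodeInverts (_root_.matTensor r s) := by
  refine antipodeInverts_of_mul_eq_one (isUnit_matTensor hr.isUnit hs.isUnit) ?_
  rintro ⟨i, k⟩ ⟨j, l⟩
  simp only [_root_.matTensor, Matrix.of_apply, G.κ_mul, Prod.mk.injEq]
  rw [Fintype.sum_prod_type_right]
  calc ∑ y, ∑ x, G.κ (s k y) * G.κ (r i x) * (r x j * s y l)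
      = ∑ y, G.κ (s k y) * (∑ x, G.κ (r i x) * r x j) * s y l := by
        refine Finset.sum_congr rfl fun y _ => ?_
        rw [Finset.mul_sum, Finset.sum_mul]
        exact Finset.sum_congr rfl fun x _ => by simp only [mul_assoc]
    _ = _ := by
        simp only [hr.1 i j]
        by_cases hij : i = j <;> simp [hij, hs.1]

theorem isCorep_conj_of_isUnit (hr : G.IsCorep r) (h : IsUnit (r.map star)) :
    G.IsCorep (r.map star) := by
  refine isCorep_iff.2 ⟨h, fun i j => ?_⟩
  simp only [Matrix.map_apply, comul_star, hr.comul_apply, star_sum, TensorProduct.star_tmul]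

end

variable {G}

theorem antipodeInverts_fundamental : G.AntipodeInverts (Corep.fundamental G).mat := by
  refine antipodeInverts_of_mul_eq_one (Corep.fundamental G).isCorep.isUnit ?_
  change ∀ i j : Fin n, ∑ k : Fin n, G.κ (coeffEntry G.u i k) * coeffEntry G.u k j = _
  intro i j
  have h : (star G.u * G.u) i j = (1 : Matrix (Fin n) (Fin n) A) i j := by
    rw [Unitary.star_mul_self_of_mem G.u_unitary]
  simp only [Matrix.mul_apply, Matrix.star_apply, Matrix.one_apply] at h
  simp only [G.κ_u]
  apply Subtype.ext
  rw [AddSubmonoidClass.coe_finsetSum, apply_ite Subtype.val]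
  exact h

variable (G) in
/-- The elements of `A_s` which are entries of a corepresentation inverted by the antipode. -/
def niceEntries : Set (coeffAlgebra G.u) :=
  {a | ∃ r : G.Corep, G.AntipodeInverts r.mat ∧ ∃ i j, a = r.mat i j}

theorem AntipodeInverts.submatrix {ι ι' : Type*} [Fintype ι] [DecidableEq ι] [Fintype ι']
    [DecidableEq ι'] {r : Matrix ι ι (coeffAlgebra G.u)} (h : G.AntipodeInverts r) (e : ι' ≃ ι) :
    G.AntipodeInverts (r.submatrix e e) := by
  constructor
  · intro i j
    simp only [Matrix.submatrix_apply]
    rw [e.sum_comp (fun k => G.κ (r (e i) k) * r k (e j)), h.1]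
    simp
  · intro i j
    simp only [Matrix.submatrix_apply]
    rw [e.sum_comp (fun k => r (e i) k * G.κ (r k (e j))), h.2]
    simp

theorem entry_mem_niceEntries {ι : Type*} [Fintype ι] [DecidableEq ι]
    {r : Matrix ι ι (coeffAlgebra G.u)} (hr : G.IsCorep r) (h : G.AntipodeInverts r) (i j : ι) :
    r i j ∈ G.niceEntries :=
  ⟨Corep.ofMatrix (Fintype.equivFin ι).symm hr, h.submatrix _, Fintype.equivFin ι i,
    Fintype.equivFin ι j, by simp [Corep.ofMatrix]⟩

theorem one_mem_niceEntries : 1 ∈ G.niceEntries := by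
  refine ⟨Corep.one G, ?_, (0 : Fin 1), (0 : Fin 1), rfl⟩
  have h : G.AntipodeInverts (1 : Matrix (Fin 1) (Fin 1) (coeffAlgebra G.u)) := by
    refine antipodeInverts_of_mul_eq_one isUnit_one fun i j => ?_
    obtain rfl := Subsingleton.elim i 0
    obtain rfl := Subsingleton.elim j 0
    simp [κ_one]
  exact h

theorem mul_mem_niceEntries {a b : coeffAlgebra G.u} (ha : a ∈ G.niceEntries)
    (hb : b ∈ G.niceEntries) : a * b ∈ G.niceEntries := by
  obtain ⟨r, hr, i, j, rfl⟩ := ha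
  obtain ⟨s, hs, k, l, rfl⟩ := hb
  exact entry_mem_niceEntries (r.isCorep.matTensor s.isCorep) (hr.matTensor hs) (i, k) (j, l)

/-- Tensor products make the set of such entries closed under multiplication, and it contains `1`,
the `u i j` and their adjoints. Linear statements on `A_s` can therefore be checked on matrix
coefficients. -/
theorem span_niceEntries : Submodule.span ℂ G.niceEntries = ⊤ := by
  rw [eq_top_iff]
  rintro ⟨a, ha⟩ -
  have ha' : a ∈ Algebra.adjoin ℂ ({a | ∃ i j, a = G.u i j} ∪ star {a | ∃ i j, a = G.u i j}) := ha
  have key : ∀ h : a ∈ coeffAlgebra G.u,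
      (⟨a, h⟩ : coeffAlgebra G.u) ∈ Submodule.span ℂ G.niceEntries := by
    induction ha' using Algebra.adjoin_induction with
    | mem x hx =>
      intro h
      apply Submodule.subset_span
      rcases hx with ⟨i, j, rfl⟩ | ⟨i, j, hx⟩
      · exact entry_mem_niceEntries (Corep.fundamental G).isCorep
          (antipodeInverts_fundamental (G := G)) i j
      · have hc := (antipodeInverts_fundamental (G := G)).conj
        have := entry_mem_niceEntries (isCorep_conj_of_isUnit (Corep.fundamental G).isCorep
          hc.isUnit) hc i j
        convert this
        rw [← star_star x, hx]
        rfl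
    | algebraMap c =>
      intro h
      have : (⟨algebraMap ℂ A c, h⟩ : coeffAlgebra G.u) = c • 1 := by
        apply Subtype.ext
        change algebraMap ℂ A c = c • 1
        rw [Algebra.algebraMap_eq_smul_one]
      rw [this]
      exact Submodule.smul_mem _ _ (Submodule.subset_span one_mem_niceEntries)
    | add x y hx hy ihx ihy =>
      intro h
      exact add_mem (ihx hx hx) (ihy hy hy)
    | mul x y hx hy ihx ihy =>
      intro h
      have hx' := ihx hx hx
      have hy' := ihy hy hy
      have : (⟨x * y, h⟩ : coeffAlgebra G.u) = ⟨x, hx⟩ * ⟨y, hy⟩ := rfl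
      rw [this]
      have hm := Submodule.mul_mem_mul hx' hy'
      rw [Submodule.span_mul_span] at hm
      refine Submodule.span_mono ?_ hm
      rintro _ ⟨a, ha, b, hb, rfl⟩
      exact mul_mem_niceEntries ha hb
  exact key ha

theorem niceEntries_induction {p : coeffAlgebra G.u → Prop}
    (entry : ∀ (r : G.Corep), G.AntipodeInverts r.mat → ∀ i j, p (r.mat i j))
    (zero : p 0) (add : ∀ a b, p a → p b → p (a + b)) (smul : ∀ (c : ℂ) a, p a → p (c • a))
    (a : coeffAlgebra G.u) : p a := by
  have ha : a ∈ Submodule.span ℂ G.niceEntries := by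
    rw [span_niceEntries]
    exact Submodule.mem_top
  induction ha using Submodule.span_induction with
  | mem x h =>
    obtain ⟨r, hr, i, j, rfl⟩ := h
    exact entry r hr i j
  | zero => exact zero
  | add x y _ _ hx hy => exact add _ _ hx hy
  | smul c x _ hx => exact smul c x hx

variable (G) in
/-- The map `a ↦ κ(a₁) a₂`. -/
def antipodeMul : coeffAlgebra G.u →ₗ[ℂ] coeffAlgebra G.u :=
  LinearMap.mul' ℂ _ ∘ₗ TensorProduct.map G.κ LinearMap.id ∘ₗ G.comul.toLinearMap

theorem antipodeMul_entry {ι : Type*} [Fintype ι] [DecidableEq ι]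
    {r : Matrix ι ι (coeffAlgebra G.u)} (hr : G.IsCorep r) (i j : ι) :
    G.antipodeMul (r i j) = ∑ k, G.κ (r i k) * r k j := by
  simp [antipodeMul, hr.comul_apply]

variable [Nontrivial A]

instance : Nontrivial (coeffAlgebra G.u) :=
  ⟨⟨0, 1, fun h => zero_ne_one (congrArg Subtype.val h : (0 : A) = 1)⟩⟩

variable (G) in
-- On an entry of a matrix inverted by `κ`, the element `κ(a₁) a₂` is `0` or `1`; by linearity it is
-- always a scalar. A left inverse of the embedding of the scalars reads it off.
theorem exists_counit : ∃ ε : coeffAlgebra G.u →ₗ[ℂ] ℂ, ∀ a, algebraMap ℂ _ (ε a) =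
    G.antipodeMul a := by
  obtain ⟨g, hg⟩ := LinearMap.exists_leftInverse_of_injective
    (Algebra.linearMap ℂ (coeffAlgebra G.u))
    (LinearMap.ker_eq_bot.2 (FaithfulSMul.algebraMap_injective ℂ (coeffAlgebra G.u)))
  refine ⟨g ∘ₗ G.antipodeMul, fun a => ?_⟩
  have hg' : ∀ c : ℂ, g (algebraMap ℂ _ c) = c := fun c => LinearMap.congr_fun hg c
  induction a using niceEntries_induction with
  | entry r hr i j =>
    have : G.antipodeMul (r.mat i j) = algebraMap ℂ _ (if i = j then 1 else 0) := by
      rw [antipodeMul_entry r.isCorep, hr.1]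
      simp [apply_ite (algebraMap ℂ (coeffAlgebra G.u))]
    rw [LinearMap.comp_apply, this, hg']
  | zero => simp
  | add a b ha hb => rw [map_add, map_add, map_add, ha, hb]
  | smul c a ha => rw [map_smul, map_smul G.antipodeMul, ← ha, smul_eq_mul, map_mul, Algebra.smul_def]

variable (G) in
/-- The counit, as a linear map. -/
def counitLinear : coeffAlgebra G.u →ₗ[ℂ] ℂ := G.exists_counit.choose

theorem algebraMap_counitLinear (a : coeffAlgebra G.u) :
    algebraMap ℂ _ (G.counitLinear a) = G.antipodeMul a := G.exists_counit.choose_spec a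

theorem AntipodeInverts.counit_apply {ι : Type*} [Fintype ι] [DecidableEq ι]
    {r : Matrix ι ι (coeffAlgebra G.u)} (hr : G.IsCorep r) (h : G.AntipodeInverts r) (i j : ι) :
    G.counitLinear (r i j) = if i = j then 1 else 0 := by
  apply (algebraMap ℂ (coeffAlgebra G.u)).injective
  rw [algebraMap_counitLinear, antipodeMul_entry hr, h.1]
  simp [apply_ite (algebraMap ℂ (coeffAlgebra G.u))]

theorem counit_comul (a : coeffAlgebra G.u) : TensorProduct.lid ℂ _
    (TensorProduct.map G.counitLinear LinearMap.id (G.comul a)) = a := by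
  induction a using niceEntries_induction with
  | entry r hr i j => simp [r.isCorep.comul_apply, hr.counit_apply r.isCorep]
  | zero => simp
  | add a b ha hb => simp only [map_add, ha, hb]
  | smul c a ha => simp only [map_smul, ha]

section

variable {ι ι' : Type*} [Fintype ι] [DecidableEq ι] [Fintype ι'] [DecidableEq ι']
  {r : Matrix ι ι (coeffAlgebra G.u)}

/-- Applying `(ε ⊗ id) Δ = id` to the entries gives `ε(r) r = r`, and `r` is invertible. Unlike
`AntipodeInverts.counit_apply`, this covers every corepresentation, and through it the antipode
inverts every one. -/
theorem IsCorep.counitLinear_apply (hr : G.IsCorep r) (i j : ι) :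
    G.counitLinear (r i j) = if i = j then 1 else 0 := by
  have h1 : (r.map G.counitLinear).map (algebraMap ℂ _) * r = r := by
    refine Matrix.ext fun i j => ?_
    have := counit_comul (r i j)
    rw [hr.comul_apply] at this
    simpa [Matrix.mul_apply, Algebra.smul_def] using this
  have h2 : (r.map G.counitLinear).map (algebraMap ℂ (coeffAlgebra G.u)) = 1 :=
    hr.isUnit.mul_right_cancel (h1.trans (one_mul r).symm)
  apply (algebraMap ℂ (coeffAlgebra G.u)).injective
  have := congrFun (congrFun h2 i) j
  rw [Matrix.one_apply] at this
  simpa [apply_ite (algebraMap ℂ (coeffAlgebra G.u))] using this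

theorem IsCorep.antipodeInverts (hr : G.IsCorep r) : G.AntipodeInverts r := by
  refine antipodeInverts_of_mul_eq_one hr.isUnit fun i j => ?_
  rw [← antipodeMul_entry hr, ← algebraMap_counitLinear, hr.counitLinear_apply]
  simp [apply_ite (algebraMap ℂ (coeffAlgebra G.u))]

theorem IsCorep.conj (hr : G.IsCorep r) : G.IsCorep (r.map star) :=
  isCorep_conj_of_isUnit hr hr.antipodeInverts.conj.isUnit

end

theorem corep_induction {p : coeffAlgebra G.u → Prop}
    (entry : ∀ (r : G.Corep), ∀ i j, p (r.mat i j))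
    (zero : p 0) (add : ∀ a b, p a → p b → p (a + b)) (smul : ∀ (c : ℂ) a, p a → p (c • a))
    (a : coeffAlgebra G.u) : p a :=
  niceEntries_induction (fun r _ => entry r) zero add smul a

theorem counitLinear_one : G.counitLinear 1 = 1 :=
  (Corep.one G).isCorep.counitLinear_apply (0 : Fin 1) (0 : Fin 1)

/-- A product of two entries is an entry of the tensor product corepresentation, where the counit is
again the identity matrix. -/
theorem counitLinear_mul (a b : coeffAlgebra G.u) :
    G.counitLinear (a * b) = G.counitLinear a * G.counitLinear b := by
  induction a using corep_induction with
  | zero => simp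
  | add a a' h h' => simp only [add_mul, map_add, h, h']
  | smul c a h => simp only [smul_mul_assoc, map_smul, h]
  | entry r i j =>
    induction b using corep_induction with
    | zero => simp
    | add a a' h h' => simp only [mul_add, map_add, h, h']
    | smul c a h => simp only [mul_smul_comm, map_smul, h]
    | entry s k l =>
      have := (r.isCorep.matTensor s.isCorep).counitLinear_apply (i, k) (j, l)
      rw [r.isCorep.counitLinear_apply, s.isCorep.counitLinear_apply]
      refine Eq.trans this ?_
      by_cases h1 : i = j <;> by_cases h2 : k = l <;> simp [h1, h2]

theorem counitLinear_star (a : coeffAlgebra G.u) :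
    G.counitLinear (star a) = star (G.counitLinear a) := by
  induction a using corep_induction with
  | zero => simp
  | add a a' h h' => simp only [star_add, map_add, h, h']
  | smul c a h => simp only [star_smul, map_smul, h]
  | entry r i j =>
    have := r.isCorep.conj.counitLinear_apply i j
    rw [r.isCorep.counitLinear_apply]
    refine Eq.trans this ?_
    by_cases h : i = j <;> simp [h]

variable (G) in
/-- The counit of `A_s`. -/
def counit : coeffAlgebra G.u →⋆ₐ[ℂ] ℂ where
  toFun := G.counitLinear
  map_one' := counitLinear_one
  map_mul' := counitLinear_mul
  map_zero' := map_zero _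
  map_add' := map_add _
  commutes' c := by
    rw [Algebra.algebraMap_eq_smul_one, map_smul, counitLinear_one]
    simp
  map_star' := counitLinear_star

theorem IsCorep.counit_apply {ι : Type*} [Fintype ι] [DecidableEq ι]
    {r : Matrix ι ι (coeffAlgebra G.u)} (hr : G.IsCorep r) (i j : ι) :
    G.counit (r i j) = if i = j then 1 else 0 := hr.counitLinear_apply i j

end WoronowiczPair

/-! ### Positive functionals on C*-algebras -/

section PosFunctional

theorem exists_conjTranspose_mul_self {ι : Type*} [Fintype ι] [DecidableEq ι]
    {M : Matrix ι ι ℂ} (hM : M.IsHermitian)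
    (h : ∀ ζ : ι → ℂ, 0 ≤ ∑ i, ∑ j, star (ζ i) * M i j * ζ j) :
    ∃ L : Matrix ι ι ℂ, M = L.conjTranspose * L := by
  have h1 : M.PosSemidef := Matrix.PosSemidef.of_dotProduct_mulVec_nonneg hM fun ζ => by
    convert h ζ
    simp only [dotProduct, Matrix.mulVec, Finset.mul_sum, Pi.star_apply, mul_assoc]
  open scoped MatrixOrder in
  exact CStarAlgebra.nonneg_iff_eq_star_mul_self.1 (Matrix.nonneg_iff_posSemidef.2 h1)

variable {A : Type u} [CStarAlgebra A]

/-- A functional which is nonnegative on the elements `a* a`, as a positive linear map. -/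
def positiveFunctional (h : A →L[ℂ] ℂ) (hpos : ∀ a, 0 ≤ h (star a * a)) :
    letI := CStarAlgebra.spectralOrder A
    A →ₚ[ℂ] ℂ :=
  letI := CStarAlgebra.spectralOrder A
  haveI := CStarAlgebra.spectralOrderedRing A
  PositiveLinearMap.mk₀ h.toLinearMap fun x hx => by
    obtain ⟨b, rfl⟩ := CStarAlgebra.nonneg_iff_eq_star_mul_self.1 hx
    exact hpos b

variable {h : A →L[ℂ] ℂ} (hpos : ∀ a, 0 ≤ h (star a * a))

include hpos in
theorem posFunctional_mono {a b c : A} (hab : b - a = star c * c) : h a ≤ h b := by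
  have := hpos c
  rwa [← hab, map_sub, sub_nonneg] at this

include hpos in
theorem posFunctional_star (a : A) : h (star a) = star (h a) := by
  let _ := CStarAlgebra.spectralOrder A
  have := CStarAlgebra.spectralOrderedRing A
  exact map_star (positiveFunctional h hpos) a

include hpos in
theorem posFunctional_cauchy_schwarz (a b : A) :
    ‖h (star a * b)‖ ^ 2 ≤ (h (star a * a)).re * (h (star b * b)).re := by
  let _ := CStarAlgebra.spectralOrder A
  have := CStarAlgebra.spectralOrderedRing A
  let f := positiveFunctional h hpos
  have h1 := norm_inner_le_norm (𝕜 := ℂ) (f.toPreGNS a) (f.toPreGNS b)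
  have h2 : ∀ a, ‖f.toPreGNS a‖ ^ 2 = (h (star a * a)).re := fun a => by
    have := congrArg Complex.re (f.preGNS_norm_sq (f.toPreGNS a))
    rw [← Complex.ofReal_pow, Complex.ofReal_re] at this
    exact this
  rw [← h2, ← h2, ← mul_pow]
  exact pow_le_pow_left₀ (norm_nonneg _) h1 2

include hpos in
theorem posFunctional_mul_eq_zero {b : A} (hb : h (star b * b) = 0) (a : A) : h (a * b) = 0 := by
  have h1 := posFunctional_cauchy_schwarz hpos (star a) b
  rw [hb, star_star, Complex.zero_re, mul_zero] at h1
  exact norm_eq_zero.1 (pow_eq_zero_iff two_ne_zero |>.1 (le_antisymm h1 (by positivity)))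

include hpos in
theorem posFunctional_real (a : A) : h (star a * a) = ((h (star a * a)).re : ℂ) :=
  (Complex.eq_re_of_ofReal_le (hpos a))

end PosFunctional

/-! ### Slices of operators on the Hilbert space tensor product -/

section Slice

variable {H : Type u} {K : Type v} [NormedAddCommGroup H] [InnerProductSpace ℂ H]
  [NormedAddCommGroup K] [InnerProductSpace ℂ K] [CompleteSpace H]

/-- The operator `ξ ↦ ξ ⊗ η`. -/
def vecTensorRight (η : K) : H →L[ℂ] HilbertTensor H K :=
  LinearMap.mkContinuous
    { toFun := fun ξ => vecTensor ξ η
      map_add' := fun x y => by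
        simp only [vecTensor, TensorProduct.add_tmul]
        exact UniformSpace.Completion.coe_add _ _
      map_smul' := fun c x => by
        simp only [vecTensor, ← TensorProduct.smul_tmul']
        exact UniformSpace.Completion.coe_smul _ _ } ‖η‖
    fun x => by
      rw [mul_comm]
      exact (norm_vecTensor x η).le

theorem norm_vecTensorRight_le (η : K) : ‖vecTensorRight (H := H) η‖ ≤ ‖η‖ :=
  LinearMap.mkContinuous_norm_le _ (norm_nonneg _) _

/-- The slice of an operator on `H ⊗ K` by the vector functional of `η`. -/
def vecSlice (η : K) :
    (HilbertTensor H K →L[ℂ] HilbertTensor H K) →L[ℂ] (H →L[ℂ] H) :=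
  LinearMap.mkContinuous
    { toFun := fun T => (ContinuousLinearMap.adjoint (vecTensorRight η)).comp
        (T.comp (vecTensorRight η))
      map_add' := fun S T => by
        rw [ContinuousLinearMap.add_comp, ContinuousLinearMap.comp_add]
      map_smul' := fun c T => by
        rw [ContinuousLinearMap.smul_comp, ContinuousLinearMap.comp_smul]
        rfl } (‖η‖ * ‖η‖)
    fun T => by
      have h := norm_vecTensorRight_le (H := H) η
      calc _ ≤ ‖ContinuousLinearMap.adjoint (vecTensorRight (H := H) η)‖ *
            (‖T‖ * ‖vecTensorRight (H := H) η‖) :=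
            (ContinuousLinearMap.opNorm_comp_le _ _).trans
              (mul_le_mul_of_nonneg_left (ContinuousLinearMap.opNorm_comp_le _ _) (norm_nonneg _))
        _ = ‖vecTensorRight (H := H) η‖ * (‖T‖ * ‖vecTensorRight (H := H) η‖) := by
            rw [LinearIsometryEquiv.norm_map]
        _ ≤ ‖η‖ * (‖T‖ * ‖η‖) := by gcongr
        _ = _ := by ring

theorem inner_vecSlice (η : K) (T : HilbertTensor H K →L[ℂ] HilbertTensor H K) (ξ ξ' : H) :
    inner ℂ ξ (vecSlice η T ξ') = inner ℂ (vecTensor ξ η) (T (vecTensor ξ' η)) := by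
  change inner ℂ ξ (ContinuousLinearMap.adjoint (vecTensorRight η) (T (vecTensorRight η ξ'))) = _
  rw [ContinuousLinearMap.adjoint_inner_right]
  rfl

theorem norm_vecSlice_le (η : K) : ‖vecSlice (H := H) η‖ ≤ ‖η‖ * ‖η‖ :=
  LinearMap.mkContinuous_norm_le _ (by positivity) _

/-- The weights `2⁻¹, 2⁻², …`. -/
def weight (k : ℕ) : ℝ := (1 / 2) / 2 ^ k

theorem weight_pos (k : ℕ) : 0 < weight k := by
  unfold weight
  positivity

theorem hasSum_weight : HasSum weight 1 := by
  exact hasSum_geometric_two' (1 : ℝ)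

variable {η : ℕ → K} (hη : ∀ k, ‖η k‖ = 1)

include hη in
theorem summable_slice : Summable fun k => (weight k : ℂ) • vecSlice (H := H) (η k) := by
  refine Summable.of_norm_bounded hasSum_weight.summable fun k => ?_
  rw [norm_smul, Complex.norm_real, Real.norm_of_nonneg (weight_pos k).le]
  refine mul_le_of_le_one_right (weight_pos k).le ((norm_vecSlice_le _).trans ?_)
  rw [hη, one_mul]

variable (η) in
/-- The slice by the weighted sum of the vector functionals of the `η k`. -/
def stateSlice : (HilbertTensor H K →L[ℂ] HilbertTensor H K) →L[ℂ] (H →L[ℂ] H) :=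
  ∑' k, (weight k : ℂ) • vecSlice (H := H) (η k)

include hη in
theorem hasSum_inner_stateSlice (T : HilbertTensor H K →L[ℂ] HilbertTensor H K) (ξ ξ' : H) :
    HasSum (fun k => (weight k : ℂ) * inner ℂ (vecTensor ξ (η k)) (T (vecTensor ξ' (η k))))
      (inner ℂ ξ (stateSlice η T ξ')) := by
  have h1 := (summable_slice (H := H) hη).hasSum
  have h2 := h1.mapL (ContinuousLinearMap.apply ℂ (H →L[ℂ] H) T)
  have h3 := h2.mapL (ContinuousLinearMap.apply ℂ H ξ')
  have h4 := h3.mapL (innerSL ℂ ξ)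
  have h5 : ∀ k, (weight k : ℂ) * inner ℂ (vecTensor ξ (η k)) (T (vecTensor ξ' (η k))) =
      innerSL ℂ ξ (((weight k : ℂ) • vecSlice (H := H) (η k)) T ξ') := fun k => by
    rw [← inner_vecSlice]
    simp
  simp only [h5]
  exact h4

include hη in
theorem norm_stateSlice_le : ‖stateSlice (H := H) η‖ ≤ 1 := by
  refine tsum_of_norm_bounded hasSum_weight fun k => ?_
  rw [norm_smul, Complex.norm_real, Real.norm_of_nonneg (weight_pos k).le]
  refine mul_le_of_le_one_right (weight_pos k).le ((norm_vecSlice_le _).trans ?_)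
  rw [hη, one_mul]

include hη in
-- The slice is a positive combination of compressions `V* T V` with `V ξ = ξ ⊗ η k`.
theorem stateSlice_nonneg [CompleteSpace K] (T : HilbertTensor H K →L[ℂ] HilbertTensor H K) :
    0 ≤ stateSlice (H := H) η (star T * T) := by
  rw [ContinuousLinearMap.nonneg_iff_isPositive, ContinuousLinearMap.isPositive_iff_complex]
  intro ξ
  have h1 := hasSum_inner_stateSlice hη (star T * T) ξ ξ
  have h2 : ∀ k, (weight k : ℂ) * inner ℂ (vecTensor ξ (η k)) ((star T * T) (vecTensor ξ (η k))) =
      ((weight k * ‖T (vecTensor ξ (η k))‖ ^ 2 : ℝ) : ℂ) := fun k => by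
    rw [ContinuousLinearMap.star_eq_adjoint]
    change _ * inner ℂ _ (ContinuousLinearMap.adjoint T (T _)) = _
    rw [ContinuousLinearMap.adjoint_inner_right, inner_self_eq_norm_sq_to_K]
    push_cast
    rfl
  have h3 : 0 ≤ inner ℂ ξ (stateSlice η (star T * T) ξ) := by
    refine h1.nonneg fun k => ?_
    rw [h2]
    exact Complex.zero_le_real.2 (mul_nonneg (weight_pos k).le (sq_nonneg _))
  have h5 : inner ℂ (stateSlice η (star T * T) ξ) ξ = inner ℂ ξ (stateSlice η (star T * T) ξ) := by
    rw [← inner_conj_symm (𝕜 := ℂ)]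
    exact Complex.conj_eq_iff_im.2 (Complex.le_def.1 h3).2.symm
  rw [h5]
  refine ⟨?_, (Complex.le_def.1 h3).1⟩
  exact (Complex.eq_re_of_ofReal_le h3).symm

end Slice

/-! ### Normal states in a faithful representation. -/

section NormalState

variable {A : Type u} [CStarAlgebra A] (ρ : FaithfulRep A)

/-- The vector functional of `η`, in a faithful representation. -/
def vecFunctional (η : ρ.H) : A →L[ℂ] ℂ :=
  LinearMap.mkContinuous
    ((innerₛₗ ℂ η) ∘ₗ (ContinuousLinearMap.apply ℂ ρ.H η).toLinearMap ∘ₗ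
      ρ.π.toAlgHom.toLinearMap) (‖η‖ * ‖η‖)
    fun a => by
      change ‖inner ℂ η (ρ.π a η)‖ ≤ _
      calc _ ≤ ‖η‖ * ‖ρ.π a η‖ := norm_inner_le_norm _ _
        _ ≤ ‖η‖ * (‖a‖ * ‖η‖) := by
            gcongr
            exact (ContinuousLinearMap.le_opNorm _ _).trans
              (mul_le_mul_of_nonneg_right (NonUnitalStarAlgHom.norm_apply_le ρ.π a) (norm_nonneg _))
        _ = _ := by ring

variable {η : ℕ → ρ.H} (hη : ∀ k, ‖η k‖ = 1)

variable (η) in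
/-- The weighted sum of the vector functionals of the `η k`. -/
def normalState : A →L[ℂ] ℂ := ∑' k, (weight k : ℂ) • vecFunctional ρ (η k)

include hη in
theorem hasSum_normalState (a : A) :
    HasSum (fun k => (weight k : ℂ) * inner ℂ (η k) (ρ.π a (η k))) (normalState ρ η a) := by
  have h0 : Summable fun k => (weight k : ℂ) • vecFunctional ρ (η k) := by
    refine Summable.of_norm_bounded hasSum_weight.summable fun k => ?_
    rw [norm_smul, Complex.norm_real, Real.norm_of_nonneg (weight_pos k).le]
    refine mul_le_of_le_one_right (weight_pos k).le
      ((LinearMap.mkContinuous_norm_le _ (by positivity) _).trans ?_)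
    rw [hη, one_mul]
  have h1 := h0.hasSum.mapL (ContinuousLinearMap.apply ℂ ℂ a)
  exact h1

include hη in
theorem normalState_one : normalState ρ η 1 = 1 := by
  have h := hasSum_normalState ρ hη 1
  refine h.unique ?_
  have h2 := Complex.hasSum_ofReal.2 hasSum_weight
  rw [Complex.ofReal_one] at h2
  simpa [inner_self_eq_norm_sq_to_K, hη] using h2

theorem inner_star_mul_self (a : A) (ξ : ρ.H) :
    inner ℂ ξ (ρ.π (star a * a) ξ) = ((‖ρ.π a ξ‖ ^ 2 : ℝ) : ℂ) := by
  rw [map_mul, map_star, ContinuousLinearMap.star_eq_adjoint]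
  change inner ℂ _ (ContinuousLinearMap.adjoint (ρ.π a) (ρ.π a _)) = _
  rw [ContinuousLinearMap.adjoint_inner_right, inner_self_eq_norm_sq_to_K]
  push_cast
  rfl

include hη in
theorem normalState_nonneg (a : A) : 0 ≤ normalState ρ η (star a * a) := by
  refine (hasSum_normalState ρ hη _).nonneg fun k => ?_
  rw [inner_star_mul_self, ← Complex.ofReal_mul]
  exact Complex.zero_le_real.2 (mul_nonneg (weight_pos k).le (sq_nonneg _))

include hη in
theorem normalState_eq_zero {a : A} (h : normalState ρ η (star a * a) = 0) (k : ℕ) :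
    ρ.π a (η k) = 0 := by
  have h1 := hasSum_normalState ρ hη (star a * a)
  rw [h] at h1
  have h2 : HasSum (fun k => weight k * ‖ρ.π a (η k)‖ ^ 2) 0 := by
    rw [← Complex.hasSum_ofReal, Complex.ofReal_zero]
    simpa only [inner_star_mul_self, ← Complex.ofReal_mul] using h1
  have h3 := (hasSum_zero_iff_of_nonneg
    fun k => mul_nonneg (weight_pos k).le (sq_nonneg ‖ρ.π a (η k)‖)).1 h2
  have h4 := congrFun h3 k
  simpa [(weight_pos k).ne'] using h4

/-- In a separable C*-algebra there is a faithful state which is normal in a given faithful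
representation. -/
theorem exists_faithful_normalState [Nontrivial A] [TopologicalSpace.SeparableSpace A] :
    ∃ η : ℕ → ρ.H, (∀ k, ‖η k‖ = 1) ∧ ∀ a, normalState ρ η (star a * a) = 0 → a = 0 := by
  have hne : Nontrivial ρ.H := by
    by_contra hs
    rw [not_nontrivial_iff_subsingleton] at hs
    exact zero_ne_one (ρ.injective (Subsingleton.elim (ρ.π 0) (ρ.π 1)))
  -- Every `b` has a unit vector on which it attains at least half of its norm. Such vectors for a
  -- dense sequence of `b` give a faithful state.
  have hunit : ∀ b : A, ∃ ξ : ρ.H, ‖ξ‖ = 1 ∧ ‖b‖ / 2 ≤ ‖ρ.π b ξ‖ := by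
    intro b
    rcases eq_or_ne b 0 with rfl | hb
    · obtain ⟨ξ, hξ⟩ := exists_norm_eq ρ.H zero_le_one
      exact ⟨ξ, hξ, by simp⟩
    · have hb' : 0 < ‖b‖ := norm_pos_iff.2 hb
      have h1 : ‖b‖ / 2 < ‖ρ.π b‖ := by
        rw [NonUnitalStarAlgHom.norm_map ρ.π ρ.injective]
        linarith
      obtain ⟨x, hx1, hx2⟩ := ContinuousLinearMap.exists_lt_apply_of_lt_opNorm _ h1
      have hx0 : x ≠ 0 := by
        rintro rfl
        rw [map_zero, norm_zero] at hx2
        linarith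
      have hx0' : 0 < ‖x‖ := norm_pos_iff.2 hx0
      refine ⟨((‖x‖⁻¹ : ℝ) : ℂ) • x, ?_, ?_⟩
      · rw [norm_smul, Complex.norm_real, norm_inv, norm_norm, inv_mul_cancel₀ hx0'.ne']
      · rw [map_smul, norm_smul, Complex.norm_real, norm_inv, norm_norm]
        have : 1 ≤ ‖x‖⁻¹ := (one_le_inv₀ hx0').2 hx1.le
        nlinarith [norm_nonneg (ρ.π b x)]
  choose ξ hξ1 hξ2 using hunit
  refine ⟨fun k => ξ (TopologicalSpace.denseSeq A k), fun k => hξ1 _, fun a ha => ?_⟩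
  have h0 := normalState_eq_zero ρ (fun k => hξ1 (TopologicalSpace.denseSeq A k)) ha
  by_contra hne
  have hpos : 0 < ‖a‖ := norm_pos_iff.2 hne
  -- For `b` within `‖a‖ / 4` of `a`, killing `ξ b` by `a` gives `‖b‖ / 2 ≤ ‖a - b‖ < ‖a‖ / 4`,
  -- whereas `‖b‖ > 3‖a‖ / 4`.
  obtain ⟨k, hk⟩ := (TopologicalSpace.denseRange_denseSeq A).exists_dist_lt a
    (show 0 < ‖a‖ / 4 by positivity)
  set b := TopologicalSpace.denseSeq A k
  rw [dist_eq_norm] at hk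
  have h1 : ‖ρ.π b (ξ b)‖ ≤ ‖a - b‖ := by
    have : ρ.π b (ξ b) = - (ρ.π (a - b) (ξ b)) := by
      rw [map_sub, sub_apply, h0 k, zero_sub, neg_neg]
    rw [this, norm_neg]
    refine (ContinuousLinearMap.le_opNorm _ _).trans ?_
    rw [hξ1, mul_one]
    exact NonUnitalStarAlgHom.norm_apply_le ρ.π _
  have h2 := hξ2 b
  have h3 : ‖a‖ ≤ ‖a - b‖ + ‖b‖ := by
    simpa using norm_add_le (a - b) b
  linarith

include hη in
theorem stateSlice_algTensorRep (a b : A) :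
    stateSlice η (algTensorRep ρ ρ (a ⊗ₜ b)) = normalState ρ η b • ρ.π a := by
  refine ContinuousLinearMap.ext fun ξ' => ext_inner_left ℂ fun ξ => ?_
  refine (hasSum_inner_stateSlice hη _ ξ ξ').unique ?_
  have h1 := (hasSum_normalState ρ hη b).mul_right (inner ℂ ξ (ρ.π a ξ'))
  rw [smul_apply, inner_smul_right]
  have h2 : ∀ k, (weight k : ℂ) * inner ℂ (vecTensor ξ (η k))
      (algTensorRep ρ ρ (a ⊗ₜ b) (vecTensor ξ' (η k))) =
      (weight k : ℂ) * inner ℂ (η k) (ρ.π b (η k)) * inner ℂ ξ (ρ.π a ξ') := fun k => by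
    rw [algTensorRep_tmul, opTensor_vecTensor, inner_vecTensor]
    ring
  simp only [h2]
  exact h1

end NormalState

/-! ### Existence of the Haar measure -/

namespace WoronowiczPair

variable {A : Type u} [CStarAlgebra A] {n : ℕ} (G : WoronowiczPair A n)

include G in
-- `A_s` is spanned by the countably many words in the finitely many `u i j` and their adjoints.
-- Separability is what provides a faithful state.
theorem separableSpace : TopologicalSpace.SeparableSpace A := by
  rw [← TopologicalSpace.isSeparable_univ_iff, ← G.dense.closure_eq]
  apply TopologicalSpace.IsSeparable.closure
  have h1 : (coeffAlgebra G.u : Set A) =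
      Submodule.span ℂ (Submonoid.closure ({a | ∃ i j, a = G.u i j} ∪ star {a | ∃ i j, a = G.u i j}) :
        Set A) :=
    congrArg (fun S : Submodule ℂ A => (S : Set A)) (StarAlgebra.adjoin_eq_span (R := ℂ) _)
  rw [h1]
  apply TopologicalSpace.IsSeparable.span
  apply Set.Countable.isSeparable
  have h2 : ({a | ∃ i j, a = G.u i j} : Set A).Finite := by
    have : ({a | ∃ i j, a = G.u i j} : Set A) = Set.range fun p : Fin n × Fin n => G.u p.1 p.2 := by
      ext a
      simp [eq_comm]
    rw [this]
    exact Set.finite_range _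
  have h3 : ({a | ∃ i j, a = G.u i j} ∪ star {a | ∃ i j, a = G.u i j} : Set A).Countable :=
    (h2.union h2.star).countable
  have : Countable ({a | ∃ i j, a = G.u i j} ∪ star {a | ∃ i j, a = G.u i j} : Set A) := h3
  rw [Submonoid.closure_eq_mrange]
  have : Countable (FreeMonoid ({a | ∃ i j, a = G.u i j} ∪ star {a | ∃ i j, a = G.u i j} : Set A)) :=
    inferInstanceAs (Countable (List _))
  exact Set.countable_range _

/-- The slice `a ⊗ b ↦ g(b) a`. -/
def sliceRight (g : coeffAlgebra G.u →ₗ[ℂ] ℂ) :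
    coeffAlgebra G.u ⊗[ℂ] coeffAlgebra G.u →ₗ[ℂ] coeffAlgebra G.u :=
  (TensorProduct.rid ℂ _).toLinearMap ∘ₗ TensorProduct.map LinearMap.id g

/-- The slice `a ⊗ b ↦ g(a) b`. -/
def sliceLeft (g : coeffAlgebra G.u →ₗ[ℂ] ℂ) :
    coeffAlgebra G.u ⊗[ℂ] coeffAlgebra G.u →ₗ[ℂ] coeffAlgebra G.u :=
  (TensorProduct.lid ℂ _).toLinearMap ∘ₗ TensorProduct.map g LinearMap.id

@[simp]
theorem sliceRight_tmul (g : coeffAlgebra G.u →ₗ[ℂ] ℂ) (a b : coeffAlgebra G.u) :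
    G.sliceRight g (a ⊗ₜ b) = g b • a := by
  simp [sliceRight]

@[simp]
theorem sliceLeft_tmul (g : coeffAlgebra G.u →ₗ[ℂ] ℂ) (a b : coeffAlgebra G.u) :
    G.sliceLeft g (a ⊗ₜ b) = g a • b := by
  simp [sliceLeft]

/-- The restriction of a functional to `A_s`. -/
def res (h : A →L[ℂ] ℂ) : coeffAlgebra G.u →ₗ[ℂ] ℂ :=
  h.toLinearMap ∘ₗ (coeffAlgebra G.u).subtype.toAlgHom.toLinearMap

theorem res_apply (h : A →L[ℂ] ℂ) (a : coeffAlgebra G.u) : G.res h a = h a := rfl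

section Averaging

variable {η : ℕ → G.rep.H} (hη : ∀ k, ‖η k‖ = 1)

include hη in
theorem stateSlice_coeffTensorRep (t : coeffAlgebra G.u ⊗[ℂ] coeffAlgebra G.u) :
    stateSlice η (G.coeffTensorRep t) =
      G.rep.π (G.sliceRight (G.res (normalState G.rep η)) t : coeffAlgebra G.u) := by
  induction t using TensorProduct.induction_on with
  | zero => simp
  | add x y hx hy => simp only [map_add, hx, hy, AddMemClass.coe_add]
  | tmul a b =>
    rw [coeffTensorRep_tmul, stateSlice_algTensorRep _ hη, sliceRight_tmul, res_apply]
    exact (map_smul G.rep.π _ _).symm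

include hη in
/-- The convolution operator `(id ⊗ φ) δ`. -/
theorem exists_averaging :
    ∃ E : A →ₗ[ℂ] A, ∀ a, G.rep.π (E a) = stateSlice η (G.δOp a) := by
  have hcl : IsClosed (Set.range G.rep.π) :=
    (NonUnitalStarAlgHom.isometry G.rep.π G.rep.injective).isClosedEmbedding.isClosed_range
  have hδ : Continuous G.δOp := by
    refine AddMonoidHomClass.continuous_of_bound G.δOp 1 fun a => ?_
    rw [one_mul]
    exact NonUnitalStarAlgHom.norm_apply_le G.δOp a
  -- On `A_s` the slice is algebraic and visibly in the image of `A`; the image is closed, so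
  -- density gives the general case.
  have hmem : ∀ a, stateSlice η (G.δOp a) ∈ Set.range G.rep.π := by
    have h1 : IsClosed {a | stateSlice η (G.δOp a) ∈ Set.range G.rep.π} :=
      hcl.preimage ((stateSlice η).continuous.comp hδ)
    intro a
    have h2 : (coeffAlgebra G.u : Set A) ⊆ {a | stateSlice η (G.δOp a) ∈ Set.range G.rep.π} := by
      intro b hb
      change stateSlice η (G.δOp ((⟨b, hb⟩ : coeffAlgebra G.u) : A)) ∈ Set.range G.rep.π
      rw [← coeffTensorRep_comul, G.stateSlice_coeffTensorRep hη]
      exact ⟨_, rfl⟩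
    exact (closure_minimal h2 h1) (by rw [G.dense.closure_eq]; trivial)
  choose E hE using hmem
  refine ⟨{ toFun := E, map_add' := fun a b => ?_, map_smul' := fun c a => ?_ }, hE⟩
  · apply G.rep.injective
    rw [hE, map_add, map_add, map_add, hE, hE]
  · apply G.rep.injective
    rw [hE, map_smul, map_smul, RingHom.id_apply, map_smul, hE]

variable {G} {E : A →ₗ[ℂ] A} (hE : ∀ a, G.rep.π (E a) = stateSlice η (G.δOp a))

include hη hE in
theorem averaging_coe (a : coeffAlgebra G.u) :
    E a = (G.sliceRight (G.res (normalState G.rep η)) (G.comul a) : coeffAlgebra G.u) := by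
  apply G.rep.injective
  rw [hE, ← coeffTensorRep_comul, G.stateSlice_coeffTensorRep hη]

include hη hE in
theorem averaging_entry {ι : Type*} [Fintype ι] [DecidableEq ι]
    {r : Matrix ι ι (coeffAlgebra G.u)} (hr : G.IsCorep r) (i j : ι) :
    E (r i j) = ∑ k, normalState G.rep η (r k j) • (r i k : A) := by
  rw [averaging_coe hη hE, hr.comul_apply, map_sum]
  simp only [sliceRight_tmul, res_apply, AddSubmonoidClass.coe_finsetSum]
  rfl

include hη hE in
theorem averaging_one : E 1 = 1 := by
  have h := averaging_coe hη hE 1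
  rw [map_one] at h
  change _ = ((G.sliceRight (G.res (normalState G.rep η)) (1 ⊗ₜ 1) : coeffAlgebra G.u) : A) at h
  rw [sliceRight_tmul, res_apply] at h
  change E 1 = normalState G.rep η 1 • (1 : A) at h
  rwa [normalState_one _ hη, one_smul] at h

include hη hE in
theorem averaging_norm_le (a : A) : ‖E a‖ ≤ ‖a‖ := by
  rw [← NonUnitalStarAlgHom.norm_map G.rep.π G.rep.injective, hE]
  refine (ContinuousLinearMap.le_opNorm _ _).trans ?_
  calc _ ≤ 1 * ‖G.δOp a‖ := mul_le_mul_of_nonneg_right (norm_stateSlice_le hη) (norm_nonneg _)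
    _ ≤ _ := by
      rw [one_mul]
      exact NonUnitalStarAlgHom.norm_apply_le G.δOp a

include hη hE in
-- Positivity is clear for the operator slice and returns to `A` because a faithful representation
-- preserves spectra.
theorem averaging_nonneg (a : A) : ∃ c, E (star a * a) = star c * c := by
  let _ := CStarAlgebra.spectralOrder A
  have := CStarAlgebra.spectralOrderedRing A
  have h1 : 0 ≤ G.rep.π (E (star a * a)) := by
    rw [hE, map_mul, map_star]
    exact stateSlice_nonneg hη _
  have h2 : IsSelfAdjoint (E (star a * a)) := by
    apply G.rep.injective
    rw [map_star]
    exact (IsSelfAdjoint.of_nonneg h1).star_eq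
  rw [← CStarAlgebra.nonneg_iff_eq_star_mul_self,
    StarOrderedRing.nonneg_iff_spectrum_nonneg (R := ℝ) _ h2,
    ← h2.map_spectrum_real G.rep.π G.rep.injective]
  exact (StarOrderedRing.nonneg_iff_spectrum_nonneg (R := ℝ) _ (IsSelfAdjoint.of_nonneg h1)).1 h1

include hη hE in
theorem averaging_iterate_nonneg (k : ℕ) (a : A) :
    0 ≤ normalState G.rep η ((E ^ k) (star a * a)) := by
  induction k generalizing a with
  | zero => exact normalState_nonneg _ hη a
  | succ k ih =>
    obtain ⟨c, hc⟩ := averaging_nonneg hη hE a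
    rw [pow_succ, Module.End.mul_apply, hc]
    exact ih c

include hη hE in
theorem averaging_iterate_norm_le (k : ℕ) (a : A) : ‖(E ^ k) a‖ ≤ ‖a‖ := by
  induction k generalizing a with
  | zero => simp
  | succ k ih =>
    rw [pow_succ, Module.End.mul_apply]
    exact (ih _).trans (averaging_norm_le hη hE a)

include hη hE in
theorem averaging_iterate_one (k : ℕ) : (E ^ k) 1 = 1 := by
  induction k with
  | zero => simp
  | succ k ih => rw [pow_succ, Module.End.mul_apply, averaging_one hη hE, ih]

variable (η E) in
/-- The Cesàro means of the functionals `φ ∘ Eᵏ`. -/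
def cesaro (N : ℕ) (a : A) : ℂ :=
  ((N : ℂ) + 1)⁻¹ * ∑ k ∈ Finset.range (N + 1), normalState G.rep η ((E ^ k) a)

include hη in
theorem norm_normalState_le : ‖normalState G.rep η‖ ≤ 1 := by
  refine tsum_of_norm_bounded hasSum_weight fun k => ?_
  rw [norm_smul, Complex.norm_real, Real.norm_of_nonneg (weight_pos k).le]
  refine mul_le_of_le_one_right (weight_pos k).le
    ((LinearMap.mkContinuous_norm_le _ (by positivity) _).trans ?_)
  rw [hη, one_mul]

include hη hE in
theorem norm_normalState_iterate_le (k : ℕ) (a : A) :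
    ‖normalState G.rep η ((E ^ k) a)‖ ≤ ‖a‖ := by
  refine (ContinuousLinearMap.le_opNorm _ _).trans ?_
  calc _ ≤ 1 * ‖(E ^ k) a‖ :=
        mul_le_mul_of_nonneg_right (norm_normalState_le hη) (norm_nonneg _)
    _ ≤ _ := by rw [one_mul]; exact averaging_iterate_norm_le hη hE k a

include hη hE in
theorem norm_cesaro_le (N : ℕ) (a : A) : ‖cesaro (G := G) η E N a‖ ≤ ‖a‖ := by
  have h1 : ‖((N : ℂ) + 1)⁻¹‖ = ((N : ℝ) + 1)⁻¹ := by
    rw [norm_inv, ← Nat.cast_succ, Complex.norm_natCast, Nat.cast_succ]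
  have h2 : ‖∑ k ∈ Finset.range (N + 1), normalState G.rep η ((E ^ k) a)‖ ≤ (N + 1) * ‖a‖ := by
    refine (norm_sum_le _ _).trans ?_
    refine (Finset.sum_le_card_nsmul _ _ ‖a‖
      fun k _ => norm_normalState_iterate_le hη hE k a).trans ?_
    simp
  rw [cesaro, norm_mul, h1]
  calc _ ≤ ((N : ℝ) + 1)⁻¹ * ((N + 1) * ‖a‖) := by gcongr
    _ = ‖a‖ := by field_simp

include hη hE in
-- The difference telescopes to the terms with exponents `N + 1` and `0`.
theorem cesaro_averaging_sub (N : ℕ) (a : A) :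
    ‖cesaro (G := G) η E N (E a) - cesaro (G := G) η E N a‖ ≤ 2 * ‖a‖ / (N + 1) := by
  have h1 : ‖((N : ℂ) + 1)⁻¹‖ = ((N : ℝ) + 1)⁻¹ := by
    rw [norm_inv, ← Nat.cast_succ, Complex.norm_natCast, Nat.cast_succ]
  have h2 : cesaro (G := G) η E N (E a) - cesaro (G := G) η E N a =
      ((N : ℂ) + 1)⁻¹ *
        (normalState G.rep η ((E ^ (N + 1)) a) - normalState G.rep η ((E ^ 0) a)) := by
    rw [cesaro, cesaro, ← mul_sub, ← Finset.sum_sub_distrib,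
      ← Finset.sum_range_sub fun k => normalState G.rep η ((E ^ k) a)]
    simp only [pow_succ, Module.End.mul_apply]
  rw [h2, norm_mul, h1, div_eq_inv_mul]
  gcongr
  refine (norm_sub_le _ _).trans ?_
  have := norm_normalState_iterate_le hη hE (N + 1) a
  have := norm_normalState_iterate_le hη hE 0 a
  linarith

include hη hE in
-- On coefficients `E` multiplies `r` on the right by the scalar matrix `φ(r)`, where `φ` is the
-- normal state. The final application of `φ` supplies the extra factor in the exponent `k + 1`.
theorem normalState_iterate_entry {ι : Type*} [Fintype ι] [DecidableEq ι]
    {r : Matrix ι ι (coeffAlgebra G.u)} (hr : G.IsCorep r) (k : ℕ) (i j : ι) :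
    normalState G.rep η ((E ^ k) (r i j)) =
      ((r.map fun a => normalState G.rep η (a : A)) ^ (k + 1)) i j := by
  induction k generalizing i j with
  | zero => simp
  | succ k ih =>
    rw [pow_succ, Module.End.mul_apply, averaging_entry hη hE hr, pow_succ, Matrix.mul_apply]
    simp only [map_sum, map_smul, ih, smul_eq_mul, Matrix.map_apply, mul_comm]

include hη hE in
-- Powers of `φ(r)` commute with `φ(r)`, so the factor that `E` produces on the right can be moved
-- to the left.
theorem cesaro_averaging_entry {ι : Type*} [Fintype ι] [DecidableEq ι]
    {r : Matrix ι ι (coeffAlgebra G.u)} (hr : G.IsCorep r) (N : ℕ) (i j : ι) :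
    cesaro (G := G) η E N (E (r i j)) =
      ∑ k, normalState G.rep η (r i k) * cesaro (G := G) η E N (r k j) := by
  simp only [cesaro, ← Module.End.mul_apply, ← pow_succ, normalState_iterate_entry hη hE hr]
  simp only [Finset.mul_sum, mul_left_comm _ ((N : ℂ) + 1)⁻¹]
  rw [Finset.sum_comm]
  refine Finset.sum_congr rfl fun k _ => ?_
  rw [← Finset.mul_sum, pow_succ', Matrix.mul_apply]
  rfl

open Filter Topology in
include hη hE in
-- A limit of the Cesàro means absorbs `φ` on both sides: `h ∘ E = h` says `h(r) φ(r) = h(r)` on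
-- coefficients, and the last clause says `φ(r) h(r) = h(r)`.
theorem exists_averaging_state : ∃ h : A →L[ℂ] ℂ, h 1 = 1 ∧ (∀ a, 0 ≤ h (star a * a)) ∧
    (∀ a, h (E a) = h a) ∧ ∀ (r : G.Corep) (i j : Fin r.dim),
      ∑ k, normalState G.rep η (r.mat i k) * h (r.mat k j) = h (r.mat i j) := by
  -- A limit along an ultrafilter exists for all elements at once, so linearity and positivity pass
  -- to it.
  have hlim : ∀ a, ∃ z, Tendsto (fun N => cesaro (G := G) η E N a)
      (hyperfilter ℕ : Filter ℕ) (𝓝 z) := by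
    intro a
    obtain ⟨z, -, hz⟩ := (isCompact_closedBall (0 : ℂ) ‖a‖).ultrafilter_le_nhds
      ((hyperfilter ℕ).map fun N => cesaro (G := G) η E N a) (by
        rw [le_principal_iff, Ultrafilter.coe_map, mem_map]
        refine univ_mem' fun N => ?_
        simpa using norm_cesaro_le hη hE N a)
    exact ⟨z, hz⟩
  choose h hh using hlim
  have hadd : ∀ a b, h (a + b) = h a + h b := fun a b => by
    refine tendsto_nhds_unique (hh _) (((hh a).add (hh b)).congr fun N => ?_)
    simp only [cesaro, map_add, Finset.sum_add_distrib, mul_add]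
  have hsmul : ∀ (c : ℂ) a, h (c • a) = c • h a := fun c a => by
    refine tendsto_nhds_unique (hh _) (((hh a).const_smul c).congr fun N => ?_)
    simp only [cesaro, map_smul, smul_eq_mul, ← Finset.mul_sum]
    ring
  have hinv : ∀ a, h (E a) = h a := by
    intro a
    refine tendsto_nhds_unique (hh (E a)) ?_
    have h1 : Tendsto (fun N => cesaro (G := G) η E N (E a) - cesaro (G := G) η E N a)
        (hyperfilter ℕ : Filter ℕ) (𝓝 0) := by
      refine Tendsto.mono_left ?_ (hyperfilter_le_cofinite.trans Nat.cofinite_eq_atTop.le)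
      refine squeeze_zero_norm (fun N => cesaro_averaging_sub hη hE N a) ?_
      have := (tendsto_one_div_add_atTop_nhds_zero_nat (𝕜 := ℝ)).const_mul (2 * ‖a‖)
      simpa [div_eq_mul_inv] using this
    simpa using h1.add (hh a)
  refine ⟨LinearMap.mkContinuous { toFun := h, map_add' := hadd, map_smul' := hsmul } 1
    fun a => ?_, ?_, ?_, hinv, ?_⟩
  · rw [one_mul]
    exact le_of_tendsto (hh a).norm (Eventually.of_forall fun N => norm_cesaro_le hη hE N a)
  · refine tendsto_nhds_unique (hh 1) (tendsto_const_nhds.congr fun N => ?_)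
    simp only [cesaro, averaging_iterate_one hη hE, normalState_one _ hη]
    simp only [Finset.sum_const, Finset.card_range, nsmul_eq_mul, mul_one, Nat.cast_add,
      Nat.cast_one]
    rw [inv_mul_cancel₀ (Nat.cast_add_one_ne_zero N)]
  · intro a
    refine ge_of_tendsto (hh (star a * a)) (Eventually.of_forall fun N => ?_)
    refine mul_nonneg ?_ (Finset.sum_nonneg fun k _ => averaging_iterate_nonneg hη hE k a)
    rw [← Nat.cast_succ, ← Complex.ofReal_natCast, ← Complex.ofReal_inv]
    exact Complex.zero_le_real.2 (by positivity)
  · intro r i j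
    change ∑ k, normalState G.rep η (r.mat i k) * h (r.mat k j) = h (r.mat i j)
    rw [← hinv]
    refine tendsto_nhds_unique (tendsto_finsetSum _ fun k _ => (hh _).const_mul _) ?_
    refine (hh (E (r.mat i j))).congr fun N => ?_
    rw [cesaro_averaging_entry hη hE r.isCorep]

end Averaging

end WoronowiczPair

/-! ### From averaging to right invariance. -/

namespace WoronowiczPair

variable {A : Type u} [CStarAlgebra A] {n : ℕ} {G : WoronowiczPair A n}

/-- If the columns of `r` are independent with respect to a positive functional, then its Gram
matrix is `Lᴴ L` with an invertible `L`. -/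
theorem exists_gram {h : A →L[ℂ] ℂ} (h1 : h 1 = 1) (hpos : ∀ a, 0 ≤ h (star a * a))
    {ι : Type*} [Fintype ι] [DecidableEq ι] {r : Matrix ι ι (coeffAlgebra G.u)} (hr : IsUnit r) :
    ∃ L L' : Matrix ι ι ℂ, L' * L = 1 ∧ ∀ k k', ∑ i, h (star (r i k : A) * r i k') =
      ∑ l, star (L l k) * L l k' := by
  let H : Matrix ι ι ℂ := Matrix.of fun k k' => ∑ i, h (star (r i k : A) * r i k')
  have hsum : ∀ ζ : ι → ℂ, ∑ k, ∑ k', star (ζ k) * H k k' * ζ k' =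
      ∑ i, h (star (∑ k, ζ k • (r i k : A)) * ∑ k, ζ k • (r i k : A)) := by
    intro ζ
    have e : ∀ i, h (star (∑ k, ζ k • (r i k : A)) * ∑ k, ζ k • (r i k : A)) =
        ∑ k, ∑ k', star (ζ k) * h (star (r i k : A) * r i k') * ζ k' := fun i => by
      rw [star_sum, Finset.sum_mul_sum]
      simp only [map_sum, star_smul, smul_mul_assoc, mul_smul_comm, map_smul, smul_eq_mul]
      refine Finset.sum_congr rfl fun k _ => Finset.sum_congr rfl fun k' _ => ?_
      ring
    rw [Finset.sum_congr rfl fun i _ => e i]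
    simp only [H, Matrix.of_apply, Finset.mul_sum, Finset.sum_mul]
    conv_rhs => rw [Finset.sum_comm]
    exact Finset.sum_congr rfl fun k _ => Finset.sum_comm
  have hH : H.IsHermitian := by
    ext k k'
    simp only [H, Matrix.conjTranspose_apply, Matrix.of_apply, star_sum]
    refine Finset.sum_congr rfl fun i _ => ?_
    rw [← posFunctional_star hpos, star_mul, star_star]
  obtain ⟨L, hL⟩ := exists_conjTranspose_mul_self hH fun ζ => by
    rw [hsum]
    exact Finset.sum_nonneg fun i _ => hpos _
  -- A kernel vector makes every `∑ k, ζ k • r i k` null for `h`. By Cauchy–Schwarz `h` still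
  -- vanishes after multiplication by the inverse of `r`, which turns these elements into `ζ k • 1`.
  have hinj : ∀ ζ, L.mulVec ζ = 0 → ζ = 0 := by
    intro ζ hζ
    have e1 : ∑ k, ∑ k', star (ζ k) * H k k' * ζ k' = 0 := by
      have e2 : ∀ k, ∑ k', H k k' * ζ k' = 0 := fun k => by
        have : (H.mulVec ζ) k = 0 := by
          rw [hL, ← Matrix.mulVec_mulVec, hζ, Matrix.mulVec_zero]
          rfl
        exact this
      refine Finset.sum_eq_zero fun k _ => ?_
      simp only [mul_assoc, ← Finset.mul_sum, e2, mul_zero]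
    rw [hsum, Finset.sum_eq_zero_iff_of_nonneg fun i _ => hpos _] at e1
    obtain ⟨⟨a, b, hab, hba⟩, rfl⟩ := hr
    ext k
    have e3 : ∑ i, (b k i : A) * ∑ k', ζ k' • (a i k' : A) = ζ k • 1 := by
      calc _ = ∑ k', ζ k' • (((b * a) k k' : coeffAlgebra G.u) : A) := by
            simp only [Matrix.mul_apply, AddSubmonoidClass.coe_finsetSum, MulMemClass.coe_mul,
              Finset.mul_sum, Finset.smul_sum, mul_smul_comm]
            rw [Finset.sum_comm]
        _ = _ := by
            rw [hba, Finset.sum_eq_single k]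
            · simp
            · intro k' _ hk
              simp [Matrix.one_apply_ne hk.symm]
            · simp
    have e4 := congrArg h e3
    rw [map_sum, map_smul, h1, smul_eq_mul, mul_one] at e4
    rw [← e4]
    exact Finset.sum_eq_zero fun i hi => posFunctional_mul_eq_zero hpos (e1 i hi) _
  have hdet : L.det ≠ 0 := fun h0 => by
    obtain ⟨v, hv, hv'⟩ := Matrix.exists_mulVec_eq_zero_iff.2 h0
    exact hv (hinj v hv')
  refine ⟨L, L⁻¹, Matrix.nonsing_inv_mul _ (isUnit_iff_ne_zero.2 hdet), fun k k' => ?_⟩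
  have := congrFun (congrFun hL k) k'
  simpa [H, Matrix.mul_apply] using this

section

variable {η : ℕ → G.rep.H} (hη : ∀ k, ‖η k‖ = 1) {E : A →ₗ[ℂ] A}
  (hE : ∀ a, G.rep.π (E a) = stateSlice η (G.δOp a))

include hη hE in
-- With `P = h(r)` the claim is column `j` of `r P = P`. The defect `y` satisfies a quadratic
-- identity pairing the `h`-Gram matrix of `r` with the `φ`-Gram matrix of `y` to zero. The former
-- is positive definite, so `y` is null for `φ`, and `φ` is faithful.
theorem entry_mul_averaging_state {h : A →L[ℂ] ℂ} (h1 : h 1 = 1)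
    (hpos : ∀ a, 0 ≤ h (star a * a)) (hinv : ∀ a, h (E a) = h a)
    (hfaith : ∀ a, normalState G.rep η (star a * a) = 0 → a = 0) (r : G.Corep)
    (hr : ∀ i j, ∑ k, normalState G.rep η (r.mat i k) * h (r.mat k j) = h (r.mat i j))
    (i j : Fin r.dim) : ∑ k, h (r.mat k j) • r.mat i k = h (r.mat i j) • 1 := by
  set φ := normalState G.rep η with hφ
  have hφ1 : φ 1 = 1 := normalState_one _ hη
  have hφpos : ∀ a, 0 ≤ φ (star a * a) := normalState_nonneg _ hη
  let w : Fin r.dim → coeffAlgebra G.u := fun i => ∑ k, h (r.mat k j) • r.mat i k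
  let y : Fin r.dim → coeffAlgebra G.u := fun i => w i - h (r.mat i j) • 1
  have hw : ∀ i, G.comul (w i) = ∑ k, r.mat i k ⊗ₜ w k := fun i => by
    simp only [w, map_sum, map_smul, r.isCorep.comul_apply, TensorProduct.tmul_sum,
      TensorProduct.tmul_smul, Finset.smul_sum]
    exact Finset.sum_comm
  have hφw : ∀ i, φ (w i) = h (r.mat i j) := fun i => by
    rw [← hr i j]
    simp only [w, AddSubmonoidClass.coe_finsetSum, map_sum]
    refine Finset.sum_congr rfl fun k _ => ?_
    change φ (h (r.mat k j) • (r.mat i k : A)) = _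
    rw [map_smul, smul_eq_mul, mul_comm]
  have hy : ∀ k k', φ (star (y k : A) * y k') =
      φ (star (w k : A) * w k') - star (h (r.mat k j)) * h (r.mat k' j) := fun k k' => by
    have e : star (y k : A) * y k' = star (w k : A) * w k' - h (r.mat k' j) • star (w k : A)
        - star (h (r.mat k j)) • (w k' : A) + (h (r.mat k' j) * star (h (r.mat k j))) • 1 := by
      change star ((w k : A) - h (r.mat k j) • 1) * ((w k' : A) - h (r.mat k' j) • 1) = _
      simp only [star_sub, star_smul, star_one, sub_mul, mul_sub, smul_mul_assoc, mul_smul_comm,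
        one_mul, mul_one, mul_smul, smul_sub]
      abel
    rw [e, map_add, map_sub, map_sub, map_smul, map_smul, map_smul, hφ1,
      posFunctional_star hφpos, hφw, hφw]
    simp only [smul_eq_mul]
    ring
  have key : ∀ i, ∑ k, ∑ k', h (star (r.mat i k : A) * r.mat i k') * φ (star (y k : A) * y k') =
      0 := by
    intro i
    -- Here `h ∘ E = h` is combined with `Δ(w i) = ∑ k, r i k ⊗ w k`; `e4` expands `w i` itself
    -- instead. Since `φ(w k) = h(r k j)`, the difference of the two expressions involves exactly
    -- `φ(star (y k) * y k')`.
    have e1 : h (star (w i : A) * w i) = ∑ k, ∑ k', h (star (r.mat i k : A) * r.mat i k') *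
        φ (star (w k : A) * w k') := by
      rw [← hinv]
      have e0 : G.comul (star (w i) * w i) = ∑ k, ∑ k',
          (star (r.mat i k) * r.mat i k') ⊗ₜ (star (w k) * w k') := by
        rw [map_mul, comul_star, hw, star_sum, Finset.sum_mul_sum]
        simp only [TensorProduct.star_tmul, Algebra.TensorProduct.tmul_mul_tmul]
      have e2 := averaging_coe hη hE (star (w i) * w i)
      rw [e0] at e2
      simp only [map_sum, sliceRight_tmul, AddSubmonoidClass.coe_finsetSum] at e2
      have e3 := congrArg h e2
      simp only [map_sum] at e3
      refine e3.trans (Finset.sum_congr rfl fun k _ => Finset.sum_congr rfl fun k' _ => ?_)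
      refine (map_smul h _ _).trans ?_
      rw [smul_eq_mul, mul_comm]
      rfl
    have e4 : h (star (w i : A) * w i) = ∑ k, ∑ k', h (star (r.mat i k : A) * r.mat i k') *
        (star (h (r.mat k j)) * h (r.mat k' j)) := by
      have e5 : (w i : A) = ∑ k, h (r.mat k j) • (r.mat i k : A) := by
        simp only [w, AddSubmonoidClass.coe_finsetSum]
        rfl
      rw [e5, star_sum, Finset.sum_mul_sum]
      simp only [map_sum, star_smul, smul_mul_assoc, mul_smul_comm, map_smul, smul_eq_mul]
      refine Finset.sum_congr rfl fun k _ => Finset.sum_congr rfl fun k' _ => ?_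
      ring
    simp only [hy, mul_sub, Finset.sum_sub_distrib]
    rw [← e1, ← e4, sub_self]
  obtain ⟨L, L', hL, hG⟩ := exists_gram h1 hpos r.isCorep.isUnit
  -- Summed over `i`, the coefficients form `L* L`, so the vanishing expression is a sum of terms
  -- `φ(z* z)`.
  have hsum : ∑ l, φ (star (∑ k, L l k • (y k : A)) * ∑ k, L l k • (y k : A)) = 0 := by
    have e : ∑ i, ∑ k, ∑ k', h (star (r.mat i k : A) * r.mat i k') * φ (star (y k : A) * y k') =
        0 := Finset.sum_eq_zero fun i _ => key i
    rw [Finset.sum_comm] at e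
    have e' : ∀ k, ∑ i, ∑ k', h (star (r.mat i k : A) * r.mat i k') * φ (star (y k : A) * y k') =
        ∑ k', ∑ l, star (L l k) * L l k' * φ (star (y k : A) * y k') := fun k => by
      rw [Finset.sum_comm]
      exact Finset.sum_congr rfl fun k' _ => by rw [← Finset.sum_mul, hG, Finset.sum_mul]
    simp only [e'] at e
    rw [← e]
    simp only [star_sum, Finset.sum_mul_sum, map_sum, star_smul, smul_mul_assoc, mul_smul_comm,
      map_smul, smul_eq_mul]
    rw [Finset.sum_comm]
    refine Finset.sum_congr rfl fun k _ => ?_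
    rw [Finset.sum_comm]
    refine Finset.sum_congr rfl fun k' _ => Finset.sum_congr rfl fun l _ => ?_
    ring
  rw [Finset.sum_eq_zero_iff_of_nonneg fun l _ => hφpos _] at hsum
  have hzero : ∀ l, ∑ k, L l k • (y k : A) = 0 := fun l => hfaith _ (hsum l (Finset.mem_univ l))
  have hyi : (y i : A) = 0 := by
    have e : ∑ l, L' i l • ∑ k, L l k • (y k : A) = y i := by
      simp only [Finset.smul_sum, smul_smul]
      rw [Finset.sum_comm]
      simp only [← Finset.sum_smul]
      have e2 : ∀ k, ∑ l, L' i l * L l k = if i = k then 1 else 0 := fun k => by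
        rw [← Matrix.mul_apply, hL, Matrix.one_apply]
      simp [e2]
    rw [← e]
    exact Finset.sum_eq_zero fun l _ => by rw [hzero, smul_zero]
  exact sub_eq_zero.1 (Subtype.ext hyi)

end

/-- A state `h` on `A` with `(id ⊗ h) δ = h(·) 1`, expressed on the matrix entries. -/
structure IsRightHaar (G : WoronowiczPair A n) (h : A →L[ℂ] ℂ) : Prop where
  map_one : h 1 = 1
  nonneg : ∀ a, 0 ≤ h (star a * a)
  slice : ∀ a, G.sliceRight (G.res h) (G.comul a) = h (a : A) • 1

theorem exists_isRightHaar [Nontrivial A] (G : WoronowiczPair A n) :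
    ∃ h : A →L[ℂ] ℂ, G.IsRightHaar h := by
  have := G.separableSpace
  obtain ⟨η, hη, hfaith⟩ := exists_faithful_normalState G.rep
  obtain ⟨E, hE⟩ := G.exists_averaging hη
  obtain ⟨h, h1, hpos, hinv, hr⟩ := exists_averaging_state hη hE
  refine ⟨h, h1, hpos, fun a => ?_⟩
  induction a using corep_induction with
  | entry r i j =>
    rw [r.isCorep.comul_apply, map_sum]
    simp only [sliceRight_tmul, res_apply]
    exact entry_mul_averaging_state hη hE h1 hpos hinv hfaith r (hr r) i j
  | zero => simp
  | add a b ha hb => simp only [map_add, ha, hb, AddMemClass.coe_add, add_smul]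
  | smul c a ha =>
    rw [map_smul, map_smul, ha, smul_smul]
    congr 1
    exact (map_smul h c (a : A)).symm

end WoronowiczPair

/-! ### Unitarisation and two-sided invariance -/

section ScalarMatrix

variable {S : Type*} [Ring S] [Algebra ℂ S] {ι κ μ : Type*} [Fintype ι] [Fintype κ] [Fintype μ]

/-- A complex matrix, with entries regarded as scalars of the algebra `S`. -/
def scalarMat (S : Type*) [Ring S] [Algebra ℂ S] {ι κ : Type*} (T : Matrix ι κ ℂ) :
    Matrix ι κ S := T.map (algebraMap ℂ S)

theorem scalarMat_mul (T : Matrix ι κ ℂ) (U : Matrix κ μ ℂ) :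
    scalarMat S (T * U) = scalarMat S T * scalarMat S U := Matrix.map_mul

theorem scalarMat_one [DecidableEq ι] : scalarMat S (1 : Matrix ι ι ℂ) = 1 := by
  simp [scalarMat, Matrix.map_one]

theorem map_scalarMat {S' : Type*} [Ring S'] [Algebra ℂ S'] (f : S →ₐ[ℂ] S') (T : Matrix ι κ ℂ) :
    (scalarMat S T).map f = scalarMat S' T := by
  ext i j
  simp [scalarMat]

theorem map_mul_scalarMat (g : S →ₗ[ℂ] ℂ) (M : Matrix ι κ S) (T : Matrix κ μ ℂ) :
    (M * scalarMat S T).map g = M.map g * T := by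
  ext i j
  simp only [scalarMat, Matrix.map_apply, Matrix.mul_apply, map_sum]
  refine Finset.sum_congr rfl fun k _ => ?_
  rw [← Algebra.commutes, ← Algebra.smul_def, map_smul, smul_eq_mul, mul_comm]

theorem map_scalarMat_mul (g : S →ₗ[ℂ] ℂ) (T : Matrix ι κ ℂ) (M : Matrix κ μ S) :
    (scalarMat S T * M).map g = T * M.map g := by
  ext i j
  simp only [scalarMat, Matrix.map_apply, Matrix.mul_apply, map_sum]
  refine Finset.sum_congr rfl fun k _ => ?_
  rw [← Algebra.smul_def, map_smul, smul_eq_mul]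

theorem scalarMat_conjTranspose [StarRing S] [StarModule ℂ S] (T : Matrix ι κ ℂ) :
    (scalarMat S T).conjTranspose = scalarMat S T.conjTranspose := by
  ext i j
  simp [scalarMat, ← algebraMap_star_comm]

end ScalarMatrix

namespace WoronowiczPair

variable {A : Type u} [CStarAlgebra A] {n : ℕ} {G : WoronowiczPair A n}

section

variable {ι κ : Type*} [Fintype ι] [DecidableEq ι] [Fintype κ] [DecidableEq κ]

theorem isCorep_iff_map {r : Matrix ι ι (coeffAlgebra G.u)} :
    G.IsCorep r ↔ IsUnit r ∧ r.map G.comul =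
      r.map (Algebra.TensorProduct.includeLeft : _ →ₐ[ℂ] _ ⊗[ℂ] coeffAlgebra G.u) *
        r.map (Algebra.TensorProduct.includeRight : _ →ₐ[ℂ] coeffAlgebra G.u ⊗[ℂ] _) := by
  rw [isCorep_iff, ← Matrix.ext_iff]
  simp [Matrix.mul_apply]

/-- The matrix `T r T⁻¹` is a corepresentation if `r` is. -/
theorem IsCorep.conjugate {r : Matrix ι ι (coeffAlgebra G.u)} (hr : G.IsCorep r)
    {T : Matrix κ ι ℂ} {T' : Matrix ι κ ℂ} (h1 : T * T' = 1) (h2 : T' * T = 1) :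
    G.IsCorep (scalarMat (coeffAlgebra G.u) T * r * scalarMat (coeffAlgebra G.u) T') := by
  have k1 : scalarMat (coeffAlgebra G.u) T * scalarMat (coeffAlgebra G.u) T' = 1 := by
    rw [← scalarMat_mul, h1, scalarMat_one]
  have k2 : scalarMat (coeffAlgebra G.u) T' * scalarMat (coeffAlgebra G.u) T = 1 := by
    rw [← scalarMat_mul, h2, scalarMat_one]
  have k2' : scalarMat (coeffAlgebra G.u ⊗[ℂ] coeffAlgebra G.u) T' *
      scalarMat (coeffAlgebra G.u ⊗[ℂ] coeffAlgebra G.u) T = 1 := by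
    rw [← scalarMat_mul, h2, scalarMat_one]
  obtain ⟨hu, hm⟩ := isCorep_iff_map.1 hr
  refine isCorep_iff_map.2 ⟨?_, ?_⟩
  · obtain ⟨⟨a, b, hab, hba⟩, rfl⟩ := hu
    refine ⟨⟨scalarMat (coeffAlgebra G.u) T * a * scalarMat (coeffAlgebra G.u) T', scalarMat (coeffAlgebra G.u) T * b * scalarMat (coeffAlgebra G.u) T', ?_, ?_⟩, rfl⟩
    · calc _ = scalarMat (coeffAlgebra G.u) T * (a * (scalarMat (coeffAlgebra G.u) T' * scalarMat (coeffAlgebra G.u) T) * b) * scalarMat (coeffAlgebra G.u) T' := by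
            simp only [Matrix.mul_assoc]
        _ = 1 := by rw [k2, Matrix.mul_one, hab, Matrix.mul_one, k1]
    · calc _ = scalarMat (coeffAlgebra G.u) T * (b * (scalarMat (coeffAlgebra G.u) T' * scalarMat (coeffAlgebra G.u) T) * a) * scalarMat (coeffAlgebra G.u) T' := by
            simp only [Matrix.mul_assoc]
        _ = 1 := by rw [k2, Matrix.mul_one, hba, Matrix.mul_one, k1]
  · rw [Matrix.map_mul, Matrix.map_mul, Matrix.map_mul, Matrix.map_mul, Matrix.map_mul,
      Matrix.map_mul, hm]
    simp only [map_scalarMat]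
    rw [← Matrix.mul_assoc, ← Matrix.mul_assoc, ← Matrix.mul_assoc,
      Matrix.mul_assoc _ (scalarMat _ T') (scalarMat _ T), k2', Matrix.mul_one]

theorem matEquiv_conjugate {r : Matrix ι ι (coeffAlgebra G.u)}
    {T : Matrix κ ι ℂ} {T' : Matrix ι κ ℂ} (h1 : T * T' = 1) (h2 : T' * T = 1) :
    MatEquiv r (scalarMat (coeffAlgebra G.u) T * r * scalarMat (coeffAlgebra G.u) T') := by
  refine ⟨T, T', h1, h2, ?_⟩
  change scalarMat (coeffAlgebra G.u) T * r = scalarMat (coeffAlgebra G.u) T * r * scalarMat (coeffAlgebra G.u) T' * scalarMat (coeffAlgebra G.u) T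
  rw [Matrix.mul_assoc (scalarMat (coeffAlgebra G.u) T * r), ← scalarMat_mul, h2, scalarMat_one, Matrix.mul_one]

variable {h : A →L[ℂ] ℂ} (hh : G.IsRightHaar h)

include hh

theorem IsRightHaar.res_one : G.res h 1 = 1 := hh.map_one

theorem IsRightHaar.mul_haar {r : Matrix ι ι (coeffAlgebra G.u)} (hr : G.IsCorep r) :
    r * scalarMat (coeffAlgebra G.u) (r.map (G.res h)) = scalarMat (coeffAlgebra G.u) (r.map (G.res h)) := by
  refine Matrix.ext fun i j => ?_
  have := hh.slice (r i j)
  rw [hr.comul_apply, map_sum] at this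
  simp only [sliceRight_tmul] at this
  simp only [Matrix.mul_apply, scalarMat, Matrix.map_apply, ← Algebra.commutes, ← Algebra.smul_def]
  rw [this, Algebra.algebraMap_eq_smul_one]
  rfl

/-- The matrix `Q = h(r r*)` is positive and invertible, and right invariance gives `r Q r* = Q`.
Factoring `Q = L* L`, conjugation of `r` by the inverse of `L*` is unitary. -/
theorem IsRightHaar.exists_unitary {r : Matrix ι ι (coeffAlgebra G.u)} (hr : G.IsCorep r) :
    ∃ s : Matrix ι ι (coeffAlgebra G.u), G.IsCorep s ∧ s ∈ unitary (Matrix ι ι _) ∧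
      MatEquiv r s := by
  -- Applied to `r*`, so that the Gram matrix of its columns is `h(r r*)`.
  obtain ⟨L, L', h1, h2⟩ := exists_gram hh.map_one hh.nonneg (r := r.conjTranspose) hr.isUnit.star
  have h1' : L * L' = 1 := mul_eq_one_comm.1 h1
  have c1 : L.conjTranspose * L'.conjTranspose = 1 := by
    rw [← Matrix.conjTranspose_mul, h1, Matrix.conjTranspose_one]
  have c2 : L'.conjTranspose * L.conjTranspose = 1 := by
    rw [← Matrix.conjTranspose_mul, h1', Matrix.conjTranspose_one]
  have hQ : (r * r.conjTranspose).map (G.res h) = L.conjTranspose * L := by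
    ext k k'
    have := h2 k k'
    simp only [Matrix.conjTranspose_apply] at this
    rw [Matrix.mul_apply, Matrix.map_apply, Matrix.mul_apply, map_sum]
    refine Eq.trans ?_ this
    refine Finset.sum_congr rfl fun i _ => ?_
    change h _ = h _
    congr 1
    change (r k i : A) * star (r k' i : A) = star (star (r k i : A)) * star (r k' i : A)
    rw [star_star]
  have hrQ : r * scalarMat (coeffAlgebra G.u) (L.conjTranspose * L) * r.conjTranspose =
      scalarMat (coeffAlgebra G.u) (L.conjTranspose * L) := by
    rw [← hQ]
    refine Matrix.ext fun i j => ?_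
    have h3 := hh.slice ((r * r.conjTranspose) i j)
    have h4 : (scalarMat (coeffAlgebra G.u) ((r * r.conjTranspose).map (G.res h))) i j =
        h ((r * r.conjTranspose) i j : coeffAlgebra G.u) • 1 := by
      rw [← Algebra.algebraMap_eq_smul_one]
      rfl
    have e0 : (r * r.conjTranspose) i j = ∑ k, r i k * star (r j k) := by
      simp only [Matrix.mul_apply, Matrix.conjTranspose_apply]
    have e1 : G.comul ((r * r.conjTranspose) i j) =
        ∑ k, ∑ l, ∑ l', (r i l * star (r j l')) ⊗ₜ (r l k * star (r l' k)) := by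
      rw [e0]
      simp only [map_sum, map_mul, comul_star, hr.comul_apply, star_sum,
        TensorProduct.star_tmul, Finset.sum_mul_sum, Algebra.TensorProduct.tmul_mul_tmul]
    rw [h4, ← h3, e1]
    simp only [map_sum, sliceRight_tmul]
    rw [Finset.sum_comm]
    conv_rhs => enter [2, l]; rw [Finset.sum_comm]
    rw [Matrix.mul_assoc]
    simp only [Matrix.mul_apply, scalarMat, Matrix.map_apply, Matrix.conjTranspose_apply,
      ← Finset.sum_smul, Finset.mul_sum]
    refine Finset.sum_congr rfl fun x _ => Finset.sum_congr rfl fun y _ => ?_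
    rw [map_sum, ← Algebra.smul_def, mul_smul_comm]
  refine ⟨scalarMat (coeffAlgebra G.u) L'.conjTranspose * r * scalarMat (coeffAlgebra G.u) L.conjTranspose, hr.conjugate c2 c1, ?_,
    matEquiv_conjugate c2 c1⟩
  set s := scalarMat (coeffAlgebra G.u) L'.conjTranspose * r * scalarMat (coeffAlgebra G.u) L.conjTranspose with hs
  have hss : s * star s = 1 := by
    change s * s.conjTranspose = 1
    rw [hs]
    simp only [Matrix.conjTranspose_mul, scalarMat_conjTranspose, Matrix.conjTranspose_conjTranspose]
    calc _ = scalarMat (coeffAlgebra G.u) L'.conjTranspose * (r * (scalarMat (coeffAlgebra G.u) L.conjTranspose * scalarMat (coeffAlgebra G.u) L) *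
          r.conjTranspose) * scalarMat (coeffAlgebra G.u) L' := by simp only [Matrix.mul_assoc]
      _ = 1 := by
          rw [← scalarMat_mul, hrQ, ← scalarMat_mul, ← scalarMat_mul, ← Matrix.mul_assoc, c2,
            Matrix.one_mul, h1', scalarMat_one]
  have hsu : IsUnit s := (hr.conjugate c2 c1).isUnit
  refine ⟨?_, hss⟩
  obtain ⟨⟨a, b, hab, hba⟩, hs'⟩ := hsu
  have : b = star s := by
    calc b = b * (s * star s) := by rw [hss, mul_one]
      _ = star s := by
        rw [← mul_assoc, ← hs']
        change b * a * _ = _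
        rw [hba, one_mul]
  rw [← this, ← hs']
  exact hba

theorem IsRightHaar.res_star (a : coeffAlgebra G.u) : G.res h (star a) = star (G.res h a) :=
  posFunctional_star hh.nonneg a

/-- For unitary `r`, the relation `r P = P` also gives `r* P = P`. Applying `h` yields `P* P = P`,
and the left side is hermitian. -/
theorem IsRightHaar.isHermitian_haar {r : Matrix ι ι (coeffAlgebra G.u)} (hr : G.IsCorep r)
    (hu : r ∈ unitary (Matrix ι ι (coeffAlgebra G.u))) : (r.map (G.res h)).IsHermitian := by
  set P := r.map (G.res h) with hP
  have h1 := hh.mul_haar hr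
  have h2 : r.conjTranspose * scalarMat (coeffAlgebra G.u) P = scalarMat (coeffAlgebra G.u) P := by
    calc _ = r.conjTranspose * (r * scalarMat (coeffAlgebra G.u) P) := by rw [h1]
      _ = _ := by
        rw [← Matrix.mul_assoc]
        change star r * r * _ = _
        rw [Unitary.star_mul_self_of_mem hu, Matrix.one_mul]
  have h3 := congrArg (fun M => M.map (G.res h)) h2
  simp only [map_mul_scalarMat] at h3
  have h4 : (r.conjTranspose).map (G.res h) = P.conjTranspose := by
    ext i j
    exact hh.res_star _
  have h5 : (scalarMat (coeffAlgebra G.u) P).map (G.res h) = P := by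
    have := map_mul_scalarMat (G.res h) (1 : Matrix ι ι (coeffAlgebra G.u)) P
    rw [Matrix.one_mul] at this
    rw [this]
    have : (1 : Matrix ι ι (coeffAlgebra G.u)).map (G.res h) = 1 := by
      ext i j
      rw [Matrix.map_apply, Matrix.one_apply, Matrix.one_apply]
      split_ifs
      · exact hh.res_one
      · exact map_zero _
    rw [this, Matrix.one_mul]
  rw [h4, h5] at h3
  rw [Matrix.IsHermitian]
  conv_lhs => rw [← h3]
  rw [Matrix.conjTranspose_mul, Matrix.conjTranspose_conjTranspose, h3]

/-- The adjoint of `r P = P` is `P r* = P`; multiply by `r` on the right. Together with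
unitarisation this turns right invariance into left invariance. -/
theorem IsRightHaar.haar_mul_of_unitary {r : Matrix ι ι (coeffAlgebra G.u)} (hr : G.IsCorep r)
    (hu : r ∈ unitary (Matrix ι ι (coeffAlgebra G.u))) :
    scalarMat (coeffAlgebra G.u) (r.map (G.res h)) * r = scalarMat (coeffAlgebra G.u) (r.map (G.res h)) := by
  have h1 := hh.mul_haar hr
  have h2 := congrArg Matrix.conjTranspose h1
  rw [Matrix.conjTranspose_mul, scalarMat_conjTranspose, (hh.isHermitian_haar hr hu).eq] at h2
  calc _ = scalarMat (coeffAlgebra G.u) (r.map (G.res h)) * r.conjTranspose * r := by rw [h2]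
    _ = _ := by
      rw [Matrix.mul_assoc]
      change _ * (star r * r) = _
      rw [Unitary.star_mul_self_of_mem hu, Matrix.mul_one]

theorem IsRightHaar.haar_mul {r : Matrix ι ι (coeffAlgebra G.u)} (hr : G.IsCorep r) :
    scalarMat (coeffAlgebra G.u) (r.map (G.res h)) * r = scalarMat (coeffAlgebra G.u) (r.map (G.res h)) := by
  obtain ⟨s, hs, hsu, hrs⟩ := hh.exists_unitary hr
  obtain ⟨T, T', h1, h2, h3⟩ := hrs.symm
  change scalarMat (coeffAlgebra G.u) T * s = r * scalarMat (coeffAlgebra G.u) T at h3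
  have k1 : scalarMat (coeffAlgebra G.u) T * scalarMat (coeffAlgebra G.u) T' = 1 := by
    rw [← scalarMat_mul, h1, scalarMat_one]
  have k2 : scalarMat (coeffAlgebra G.u) T' * scalarMat (coeffAlgebra G.u) T = 1 := by
    rw [← scalarMat_mul, h2, scalarMat_one]
  have e : r = scalarMat (coeffAlgebra G.u) T * s * scalarMat (coeffAlgebra G.u) T' := by
    rw [h3, Matrix.mul_assoc, k1, Matrix.mul_one]
  have e2 : r.map (G.res h) = T * s.map (G.res h) * T' := by
    rw [e, map_mul_scalarMat, map_scalarMat_mul]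
  rw [e2, e]
  simp only [scalarMat_mul]
  calc _ = scalarMat (coeffAlgebra G.u) T * (scalarMat (coeffAlgebra G.u) (s.map (G.res h)) * (scalarMat (coeffAlgebra G.u) T' * scalarMat (coeffAlgebra G.u) T) * s) *
        scalarMat (coeffAlgebra G.u) T' := by simp only [Matrix.mul_assoc]
    _ = _ := by rw [k2, Matrix.mul_one, hh.haar_mul_of_unitary hs hsu]

theorem IsRightHaar.map_scalarMat_res {μ : Type*} [Fintype μ] (T : Matrix ι μ ℂ) :
    (scalarMat (coeffAlgebra G.u) T).map (G.res h) = T := by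
  ext i j
  rw [Matrix.map_apply, scalarMat, Matrix.map_apply, Algebra.algebraMap_eq_smul_one, map_smul,
    hh.res_one, smul_eq_mul, mul_one]

theorem IsRightHaar.haar_idem {r : Matrix ι ι (coeffAlgebra G.u)} (hr : G.IsCorep r) :
    r.map (G.res h) * r.map (G.res h) = r.map (G.res h) := by
  have := congrArg (fun M => M.map (G.res h)) (hh.mul_haar hr)
  simpa only [map_mul_scalarMat, hh.map_scalarMat_res] using this

variable [Nontrivial A]

theorem IsRightHaar.slice_left (a : coeffAlgebra G.u) :
    G.sliceLeft (G.res h) (G.comul a) = h (a : A) • 1 := by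
  induction a using corep_induction with
  | entry r i j =>
    have := congrFun (congrFun (hh.haar_mul r.isCorep) i) j
    simp only [Matrix.mul_apply, scalarMat, Matrix.map_apply, ← Algebra.smul_def] at this
    rw [r.isCorep.comul_apply, map_sum]
    simp only [sliceLeft_tmul]
    rw [this, Algebra.algebraMap_eq_smul_one]
    rfl
  | zero => simp
  | add a b ha hb => simp only [map_add, ha, hb, AddMemClass.coe_add, add_smul]
  | smul c a ha =>
    rw [map_smul, map_smul, ha, smul_smul]
    congr 1
    exact (map_smul h c (a : A)).symm

omit [Nontrivial A] hh in
-- `IsHaarMeasure` ranges over all ways of writing `δ(a)` with elementary tensors over `A`.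
-- Injectivity of the tensor representation identifies each of them with the algebraic
-- comultiplication.
theorem map_comul_eq_sum {m : ℕ} {a : coeffAlgebra G.u} {x y : Fin m → A}
    (hxy : G.δ a = ∑ k, G.tmul (x k) (y k)) :
    TensorProduct.map (coeffAlgebra G.u).subtype.toAlgHom.toLinearMap
      (coeffAlgebra G.u).subtype.toAlgHom.toLinearMap (G.comul a) = ∑ k, x k ⊗ₜ y k := by
  apply algTensorRep_injective G.rep G.rep
  rw [← (G.δ_eq_sum_iff _ _ _ _).1 hxy, ← coeffTensorRep_comul]
  rfl

theorem IsRightHaar.isHaarMeasure : G.IsHaarMeasure h where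
  map_one := hh.map_one
  nonneg := hh.nonneg
  left_invariant a ha m x y hxy := by
    have h1 := map_comul_eq_sum (a := ⟨a, ha⟩) hxy
    have h2 := congrArg (fun t => TensorProduct.lid ℂ A
      (TensorProduct.map h.toLinearMap LinearMap.id t)) h1
    simp only [map_sum, TensorProduct.map_tmul, TensorProduct.lid_tmul] at h2
    refine h2.symm.trans ?_
    have h3 := congrArg Subtype.val (hh.slice_left ⟨a, ha⟩)
    refine Eq.trans ?_ h3
    generalize G.comul ⟨a, ha⟩ = t
    induction t using TensorProduct.induction_on with
    | zero => simp
    | add x y hx hy => simp only [map_add, hx, hy, AddMemClass.coe_add]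
    | tmul b c => simp [res_apply]
  right_invariant a ha m x y hxy := by
    have h1 := map_comul_eq_sum (a := ⟨a, ha⟩) hxy
    have h2 := congrArg (fun t => TensorProduct.rid ℂ A
      (TensorProduct.map LinearMap.id h.toLinearMap t)) h1
    simp only [map_sum, TensorProduct.map_tmul, TensorProduct.rid_tmul] at h2
    refine h2.symm.trans ?_
    have h3 := congrArg Subtype.val (hh.slice ⟨a, ha⟩)
    refine Eq.trans ?_ h3
    generalize G.comul ⟨a, ha⟩ = t
    induction t using TensorProduct.induction_on with
    | zero => simp
    | add x y hx hy => simp only [map_add, hx, hy, AddMemClass.coe_add]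
    | tmul b c => simp [res_apply]

omit hh in
theorem IsHaarMeasure.isRightHaar (hm : G.IsHaarMeasure h) : G.IsRightHaar h where
  map_one := hm.map_one
  nonneg := hm.nonneg
  slice a := by
    induction a using corep_induction with
    | entry r i j =>
      rw [r.isCorep.comul_apply, map_sum]
      simp only [sliceRight_tmul]
      have := hm.right_invariant _ (r.mat i j).2 r.dim (fun k => r.mat i k) (fun k => r.mat k j)
        (r.isCorep.δ_apply i j)
      apply Subtype.ext
      rw [AddSubmonoidClass.coe_finsetSum]
      exact this
    | zero => simp
    | add a b ha hb => simp only [map_add, ha, hb, AddMemClass.coe_add, add_smul]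
    | smul c a ha =>
      rw [map_smul, map_smul, ha, smul_smul]
      congr 1
      exact (map_smul h c (a : A)).symm

end

end WoronowiczPair

/-! ### Idempotent and nilpotent matrices. -/

section IdempotentMatrix

/-- `T` is the change to a basis adapted to the decomposition into range and kernel of `E`. -/
theorem exists_idempotent_normal_form {ι : Type*} [Fintype ι] [DecidableEq ι] {E : Matrix ι ι ℂ}
    (hE : E * E = E) :
    ∃ (k l : ℕ) (T : Matrix (Fin k ⊕ Fin l) ι ℂ) (T' : Matrix ι (Fin k ⊕ Fin l) ℂ),
      T * T' = 1 ∧ T' * T = 1 ∧ T * E * T' = Matrix.fromBlocks 1 0 0 0 := by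
  set f : (ι → ℂ) →ₗ[ℂ] (ι → ℂ) := Matrix.toLin' E with hf
  have hff : IsIdempotentElem f := by
    change f ∘ₗ f = f
    rw [hf, ← Matrix.toLin'_mul, hE]
  have hc : IsCompl (LinearMap.range f) (LinearMap.ker f) :=
    LinearMap.IsIdempotentElem.isCompl hff
  let b : Module.Basis (Fin (Module.finrank ℂ (LinearMap.range f)) ⊕
      Fin (Module.finrank ℂ (LinearMap.ker f))) ℂ (ι → ℂ) :=
    ((Module.finBasis ℂ (LinearMap.range f)).prod (Module.finBasis ℂ (LinearMap.ker f))).map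
      (Submodule.prodEquivOfIsCompl _ _ hc)
  let e := Pi.basisFun ℂ ι
  have hl : ∀ i, f (b (Sum.inl i)) = b (Sum.inl i) := by
    intro i
    have h1 : b (Sum.inl i) = (Module.finBasis ℂ (LinearMap.range f) i : ι → ℂ) := by
      simp [b]
    rw [h1]
    obtain ⟨y, hy⟩ := (Module.finBasis ℂ (LinearMap.range f) i).2
    rw [← hy]
    exact LinearMap.congr_fun hff y
  have hr : ∀ i, f (b (Sum.inr i)) = 0 := by
    intro i
    have h1 : b (Sum.inr i) = (Module.finBasis ℂ (LinearMap.ker f) i : ι → ℂ) := by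
      simp [b]
    rw [h1]
    exact (Module.finBasis ℂ (LinearMap.ker f) i).2
  refine ⟨_, _, LinearMap.toMatrix e b LinearMap.id, LinearMap.toMatrix b e LinearMap.id,
    ?_, ?_, ?_⟩
  · rw [← LinearMap.toMatrix_comp, LinearMap.comp_id, LinearMap.toMatrix_id]
  · rw [← LinearMap.toMatrix_comp, LinearMap.comp_id, LinearMap.toMatrix_id]
  · have : E = LinearMap.toMatrix e e f := by
      rw [hf]
      exact (LinearMap.toMatrix'_toLin' E).symm
    rw [this, ← LinearMap.toMatrix_comp, ← LinearMap.toMatrix_comp, LinearMap.comp_id,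
      LinearMap.id_comp]
    ext i j
    rw [LinearMap.toMatrix_apply]
    rcases j with j | j
    · rw [hl, b.repr_self]
      rcases i with i | i
      · simp [Finsupp.single_apply, Matrix.one_apply, eq_comm]
      · simp
    · rw [hr]
      rcases i with i | i <;> simp

/-- Fitting's lemma. Write the characteristic polynomial as `X ^ k * q` with `q` prime to `X`; a
Bézout relation evaluated at `M` gives two complementary idempotents, one of which must vanish. -/
theorem isUnit_or_isNilpotent_of_trivial_idempotents {ι : Type*} [Fintype ι] [DecidableEq ι]
    (C : Subalgebra ℂ (Matrix ι ι ℂ)) (hC : ∀ E ∈ C, E * E = E → E = 0 ∨ E = 1)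
    {M : Matrix ι ι ℂ} (hM : M ∈ C) : IsUnit M ∨ ∃ k, M ^ k = 0 := by
  obtain ⟨q, hq, hnd⟩ := Polynomial.exists_eq_pow_rootMultiplicity_mul_and_not_dvd
    M.charpoly M.charpoly_monic.ne_zero 0
  rw [Polynomial.C_0, sub_zero] at hq hnd
  set k := M.charpoly.rootMultiplicity 0
  have hcop : IsCoprime (Polynomial.X ^ k : Polynomial ℂ) q :=
    (Polynomial.irreducible_X.coprime_iff_not_dvd.2 hnd).pow_left
  obtain ⟨a, b, hab⟩ := hcop
  have hch : M ^ k * Polynomial.aeval M q = 0 := by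
    have := M.aeval_self_charpoly
    rwa [hq, map_mul, map_pow, Polynomial.aeval_X] at this
  have hsum : Polynomial.aeval M a * M ^ k + Polynomial.aeval M b * Polynomial.aeval M q = 1 := by
    have := congrArg (Polynomial.aeval M) hab
    simpa using this
  have hcm : ∀ p p' : Polynomial ℂ, Commute (Polynomial.aeval M p) (Polynomial.aeval M p') :=
    fun p p' => by
      change _ * _ = _ * _
      rw [← map_mul, mul_comm, map_mul]
  have hcm' : ∀ p : Polynomial ℂ, Commute (Polynomial.aeval M p) (M ^ k) := fun p => by
    simpa using hcm p (Polynomial.X ^ k)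
  have hzero : Polynomial.aeval M a * M ^ k *
      (Polynomial.aeval M b * Polynomial.aeval M q) = 0 := by
    rw [(hcm b q).eq, mul_assoc, ← mul_assoc (M ^ k), hch, zero_mul, mul_zero]
  have hE : Polynomial.aeval M a * M ^ k ∈ C :=
    C.mul_mem (Polynomial.aeval_mem_adjoin_singleton ℂ M |> fun h =>
      (Algebra.adjoin_le (Set.singleton_subset_iff.2 hM)) h) (C.pow_mem hM k)
  have hidem : Polynomial.aeval M a * M ^ k * (Polynomial.aeval M a * M ^ k) =
      Polynomial.aeval M a * M ^ k := by
    have := congrArg (fun x => Polynomial.aeval M a * M ^ k * x) hsum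
    simpa only [mul_add, hzero, add_zero, mul_one] using this
  rcases hC _ hE hidem with h0 | h1
  · right
    refine ⟨k, ?_⟩
    rw [h0, zero_add] at hsum
    calc M ^ k = M ^ k * (Polynomial.aeval M b * Polynomial.aeval M q) := by rw [hsum, mul_one]
      _ = 0 := by rw [(hcm b q).eq, ← mul_assoc, hch, zero_mul]
  · have hu : IsUnit (M ^ k) := IsUnit.of_mul_eq_one_right _ h1
    -- When `k = 0` invertibility of `M ^ k` says nothing, but then `0` is not an eigenvalue and the
    -- determinant is nonzero.
    rcases Nat.eq_zero_or_pos k with hk | hk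
    · left
      have h0 : ¬ M.charpoly.IsRoot 0 := by
        rw [← Polynomial.rootMultiplicity_pos M.charpoly_monic.ne_zero]
        exact hk.not_gt
      rw [Matrix.isUnit_iff_isUnit_det, isUnit_iff_ne_zero, Matrix.det_eq_sign_charpoly_coeff]
      refine mul_ne_zero (pow_ne_zero _ (by norm_num)) ?_
      rwa [Polynomial.IsRoot, ← Polynomial.coeff_zero_eq_eval_zero] at h0
    · exact Or.inl ((isUnit_pow_iff hk.ne').1 hu)

/-- For hermitian `N` one has `N ^ 2 = N* N`, so `N ^ 2 = 0` forces `N = 0` and an exponent `2 ^ m`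
can be halved repeatedly. The exponent `k` is first enlarged to `2 ^ k`. -/
theorem Matrix.IsHermitian.eq_zero_of_pow_eq_zero {ι : Type*} [Fintype ι] [DecidableEq ι]
    {M : Matrix ι ι ℂ} (hM : M.IsHermitian) {k : ℕ} (h : M ^ k = 0) : M = 0 := by
  have h1 : ∀ m : ℕ, M ^ 2 ^ m = 0 → M = 0 := by
    intro m
    induction m with
    | zero => simp
    | succ m ih =>
      intro hm
      refine ih ?_
      rw [← Matrix.conjTranspose_mul_self_eq_zero, Matrix.conjTranspose_pow, hM.eq, ← pow_add,
        ← two_mul, ← pow_succ', hm]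
  refine h1 k ?_
  rw [← Nat.sub_add_cancel (Nat.lt_two_pow_self (n := k)).le, pow_add, h, mul_zero]

end IdempotentMatrix

/-! ### The fusion semiring -/

namespace WoronowiczPair

variable {A : Type u} [CStarAlgebra A] {n : ℕ} {G : WoronowiczPair A n}

section

variable {ι κ : Type*} [Fintype ι] [DecidableEq ι] [Fintype κ] [DecidableEq κ]

theorem IsCorep.of_fromBlocks {r : Matrix ι ι (coeffAlgebra G.u)}
    {s : Matrix κ κ (coeffAlgebra G.u)} (h : G.IsCorep (Matrix.fromBlocks r 0 0 s)) :
    G.IsCorep r ∧ G.IsCorep s := by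
  rw [isCorep_iff] at h
  rw [isCorep_iff, isCorep_iff]
  obtain ⟨⟨⟨a, b, hab, hba⟩, h1⟩, h2⟩ := h
  change a = Matrix.fromBlocks r 0 0 s at h1
  subst h1
  rw [← Matrix.fromBlocks_toBlocks b, Matrix.fromBlocks_multiply, ← Matrix.fromBlocks_one,
    Matrix.fromBlocks_inj] at hab hba
  simp only [Matrix.zero_mul, Matrix.mul_zero, add_zero, zero_add] at hab hba
  refine ⟨⟨⟨⟨r, b.toBlocks₁₁, hab.1, hba.1⟩, rfl⟩, fun i j => ?_⟩,
    ⟨⟨s, b.toBlocks₂₂, hab.2.2.2, hba.2.2.2⟩, rfl⟩, fun i j => ?_⟩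
  · simpa using h2 (Sum.inl i) (Sum.inl j)
  · simpa using h2 (Sum.inr i) (Sum.inr j)

/-- In a basis adapted to `E`, commuting with `diag(1, 0)` forces the off-diagonal blocks of `r` to
vanish: an intertwining idempotent splits the corepresentation. -/
theorem IsCorep.exists_fromBlocks {r : Matrix ι ι (coeffAlgebra G.u)} (hr : G.IsCorep r)
    {E : Matrix ι ι ℂ} (hE : E * E = E)
    (hc : r * scalarMat (coeffAlgebra G.u) E = scalarMat (coeffAlgebra G.u) E * r) :
    ∃ (k l : ℕ) (a : Matrix (Fin k) (Fin k) (coeffAlgebra G.u))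
      (b : Matrix (Fin l) (Fin l) (coeffAlgebra G.u)) (T : Matrix (Fin k ⊕ Fin l) ι ℂ)
      (T' : Matrix ι (Fin k ⊕ Fin l) ℂ),
      G.IsCorep a ∧ G.IsCorep b ∧ T * T' = 1 ∧ T' * T = 1 ∧
      scalarMat (coeffAlgebra G.u) T * r * scalarMat (coeffAlgebra G.u) T' =
        Matrix.fromBlocks a 0 0 b ∧ T * E * T' = Matrix.fromBlocks 1 0 0 0 := by
  obtain ⟨k, l, T, T', h1, h2, h3⟩ := exists_idempotent_normal_form hE
  have hcor := hr.conjugate h1 h2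
  set M := scalarMat (coeffAlgebra G.u) T * r * scalarMat (coeffAlgebra G.u) T' with hM
  have k2 : scalarMat (coeffAlgebra G.u) T' * scalarMat (coeffAlgebra G.u) T = 1 := by
    rw [← scalarMat_mul, h2, scalarMat_one]
  have hcom : M * scalarMat (coeffAlgebra G.u) (T * E * T') =
      scalarMat (coeffAlgebra G.u) (T * E * T') * M := by
    rw [hM]
    simp only [scalarMat_mul]
    calc _ = scalarMat (coeffAlgebra G.u) T * (r * (scalarMat (coeffAlgebra G.u) T' *
          scalarMat (coeffAlgebra G.u) T) * scalarMat (coeffAlgebra G.u) E) *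
          scalarMat (coeffAlgebra G.u) T' := by simp only [Matrix.mul_assoc]
      _ = scalarMat (coeffAlgebra G.u) T * (scalarMat (coeffAlgebra G.u) E *
          (scalarMat (coeffAlgebra G.u) T' * scalarMat (coeffAlgebra G.u) T) * r) *
          scalarMat (coeffAlgebra G.u) T' := by rw [k2, Matrix.mul_one, Matrix.mul_one, hc]
      _ = _ := by simp only [Matrix.mul_assoc]
  have hF : scalarMat (coeffAlgebra G.u) (T * E * T') = Matrix.fromBlocks 1 0 0 0 := by
    rw [h3, scalarMat, Matrix.fromBlocks_map]
    simp [Matrix.map_one, Matrix.map_zero]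
  rw [hF, ← Matrix.fromBlocks_toBlocks M, Matrix.fromBlocks_multiply,
    Matrix.fromBlocks_multiply, Matrix.fromBlocks_inj] at hcom
  simp only [Matrix.zero_mul, Matrix.mul_zero, add_zero, Matrix.one_mul,
    Matrix.mul_one] at hcom
  have hMb : M = Matrix.fromBlocks M.toBlocks₁₁ 0 0 M.toBlocks₂₂ := by
    conv_lhs => rw [← Matrix.fromBlocks_toBlocks M, ← hcom.2.1, hcom.2.2.1]
  rw [hMb] at hcor
  exact ⟨k, l, M.toBlocks₁₁, M.toBlocks₂₂, T, T', hcor.of_fromBlocks.1, hcor.of_fromBlocks.2,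
    h1, h2, hMb, h3⟩

/-- The class of a corepresentation with an arbitrary index set. -/
def IsCorep.toClass {r : Matrix ι ι (coeffAlgebra G.u)} (hr : G.IsCorep r) : G.FusionSemiring :=
  FusionSemiring.mk (Corep.ofMatrix (Fintype.equivFin ι).symm hr)

theorem IsCorep.toClass_eq {r : Matrix ι ι (coeffAlgebra G.u)} {s : Matrix κ κ (coeffAlgebra G.u)}
    (hr : G.IsCorep r) (hs : G.IsCorep s) (h : MatEquiv r s) : hr.toClass = hs.toClass :=
  FusionSemiring.mk_eq (((Corep.ofMatrix_equiv _ hr).trans h).trans (Corep.ofMatrix_equiv _ hs).symm)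

theorem IsCorep.toClass_fromBlocks {r : Matrix ι ι (coeffAlgebra G.u)}
    {s : Matrix κ κ (coeffAlgebra G.u)} (hr : G.IsCorep r) (hs : G.IsCorep s) :
    (hr.fromBlocks hs).toClass = hr.toClass + hs.toClass := by
  refine FusionSemiring.mk_eq ((Corep.ofMatrix_equiv _ _).trans
    (MatEquiv.trans ?_ (FusionSemiring.add_equiv _ _).symm))
  exact (Corep.ofMatrix_equiv _ hr).symm.fromBlocks (Corep.ofMatrix_equiv _ hs).symm

theorem FusionSemiring.mk_eq_toClass (r : G.Corep) : FusionSemiring.mk r = r.isCorep.toClass :=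
  FusionSemiring.mk_eq (Corep.ofMatrix_equiv _ _).symm

end

theorem MatEquiv.map_star {ι κ : Type*} [Fintype ι] [DecidableEq ι] [Fintype κ] [DecidableEq κ]
    {r : Matrix ι ι (coeffAlgebra G.u)} {s : Matrix κ κ (coeffAlgebra G.u)} (h : MatEquiv r s) :
    MatEquiv (r.map star) (s.map star) := by
  obtain ⟨T, T', h1, h2, h3⟩ := h
  refine ⟨T.map star, T'.map star, ?_, ?_, ?_⟩
  · have := congrArg (fun M : Matrix κ κ ℂ => M.map (starRingEnd ℂ)) h1
    simpa [Matrix.map_mul, Matrix.map_one] using this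
  · have := congrArg (fun M : Matrix ι ι ℂ => M.map (starRingEnd ℂ)) h2
    simpa [Matrix.map_mul, Matrix.map_one] using this
  · refine Matrix.ext fun i j => ?_
    have := congrArg star (congrFun (congrFun h3 i) j)
    have hc : ∀ (c : ℂ) (x : coeffAlgebra G.u), star (algebraMap ℂ (coeffAlgebra G.u) c) * x =
        x * star (algebraMap ℂ (coeffAlgebra G.u) c) := fun c x => by
      rw [← algebraMap_star_comm]
      exact Algebra.commutes _ _
    simp only [Matrix.mul_apply, Matrix.map_apply, star_sum, star_mul] at this ⊢
    refine Eq.trans (Finset.sum_congr rfl fun k _ => ?_)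
      (this.trans (Finset.sum_congr rfl fun k _ => ?_))
    · rw [algebraMap_star_comm]
      exact hc _ _
    · rw [algebraMap_star_comm]
      exact hc _ _

variable [Nontrivial A]

/-! ### Conjugates, characters, coefficient spaces and indecomposable classes. -/

namespace FusionSemiring

theorem dim_mk (r : G.Corep) : (mk r).dim = r.dim := rfl

theorem dim_add (x y : G.FusionSemiring) : (x + y).dim = x.dim + y.dim := by
  induction x using ind with | _ r
  induction y using ind with | _ s
  rfl

theorem dim_zero : (0 : G.FusionSemiring).dim = 0 := rfl

theorem eq_zero_of_dim {x : G.FusionSemiring} (h : x.dim = 0) : x = 0 := by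
  induction x using ind with | _ r
  obtain ⟨d, m, hm⟩ := r
  obtain rfl : d = 0 := h
  rw [zero_def]
  exact mk_eq (MatEquiv.of_equiv (Equiv.refl _) fun i => i.elim0)

/-- The class of the conjugate corepresentation. -/
def conj : G.FusionSemiring → G.FusionSemiring :=
  Quotient.map (fun r => ⟨r.dim, r.mat.map star, r.isCorep.conj⟩) fun _ _ h => MatEquiv.map_star h

theorem conj_mk (r : G.Corep) : conj (mk r) = mk ⟨r.dim, r.mat.map star, r.isCorep.conj⟩ := rfl

theorem conj_conj (x : G.FusionSemiring) : conj (conj x) = x := by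
  induction x using ind with | _ r
  exact mk_eq (MatEquiv.of_equiv (Equiv.refl _) fun i j => star_star _)

theorem conj_add (x y : G.FusionSemiring) : conj (x + y) = conj x + conj y := by
  induction x using ind with | _ r
  induction y using ind with | _ s
  refine mk_eq (MatEquiv.trans ?_ (add_equiv _ _).symm)
  refine (MatEquiv.map_star (add_equiv r s)).trans ?_
  refine MatEquiv.of_equiv (Equiv.refl _) ?_
  rintro (i | i) (j | j)
  · rfl
  · exact star_zero _
  · exact star_zero _
  · rfl

theorem conj_zero : conj (0 : G.FusionSemiring) = 0 := eq_zero_of_dim rfl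

/-- The character of a class of corepresentations. -/
def character : G.FusionSemiring →+* coeffAlgebra G.u where
  toFun := Quotient.lift (fun r : G.Corep => r.mat.trace) fun r s h => by
    obtain ⟨T, T', h1, h2, h3⟩ := h
    have h3' : s.mat = scalarMat (coeffAlgebra G.u) T * r.mat * scalarMat (coeffAlgebra G.u) T' := by
      change _ = T.map _ * r.mat * _
      rw [h3, Matrix.mul_assoc]
      change _ = s.mat * (scalarMat (coeffAlgebra G.u) T * scalarMat (coeffAlgebra G.u) T')
      rw [← scalarMat_mul, h1, scalarMat_one, Matrix.mul_one]
    have h4 : ∀ (i : Fin r.dim) (j : Fin r.dim), ∑ k, T' j k * T k i = if j = i then 1 else 0 := by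
      intro i j
      rw [← Matrix.mul_apply, h2, Matrix.one_apply]
    rw [h3']
    simp only [Matrix.trace, Matrix.diag, Matrix.mul_apply, scalarMat, Matrix.map_apply,
      ← Algebra.smul_def, ← Algebra.commutes, Finset.smul_sum, smul_smul]
    rw [Finset.sum_comm]
    conv_rhs => enter [2, j]; rw [Finset.sum_comm]
    simp only [← Finset.sum_smul, h4]
    simp
  map_one' := by
    change (Matrix.trace (1 : Matrix (Fin 1) (Fin 1) (coeffAlgebra G.u))) = 1
    simp
  map_zero' := rfl
  map_mul' x y := by
    induction x using ind with | _ r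
    induction y using ind with | _ s
    change ∑ i, matTensor r.mat s.mat (finProdFinEquiv.symm i) (finProdFinEquiv.symm i) =
      (∑ i, r.mat i i) * ∑ i, s.mat i i
    rw [finProdFinEquiv.symm.sum_comp (fun i => matTensor r.mat s.mat i i), Finset.sum_mul_sum,
      Fintype.sum_prod_type]
    rfl
  map_add' x y := by
    induction x using ind with | _ r
    induction y using ind with | _ s
    change ∑ i, Matrix.fromBlocks r.mat 0 0 s.mat (finSumFinEquiv.symm i) (finSumFinEquiv.symm i) =
      (∑ i, r.mat i i) + ∑ i, s.mat i i
    rw [finSumFinEquiv.symm.sum_comp (fun i => Matrix.fromBlocks r.mat 0 0 s.mat i i),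
      Fintype.sum_sum_type]
    rfl

theorem character_mk (r : G.Corep) : character (mk r) = r.mat.trace := rfl

theorem character_conj (x : G.FusionSemiring) : character (conj x) = star (character x) := by
  induction x using ind with | _ r
  rw [conj_mk, character_mk, character_mk, Matrix.trace, Matrix.trace, star_sum]
  rfl

theorem counit_character (x : G.FusionSemiring) : G.counit (character x) = x.dim := by
  induction x using ind with | _ r
  rw [character_mk, Matrix.trace, map_sum]
  simp [r.isCorep.counit_apply, dim_mk]

theorem dim_mul (x y : G.FusionSemiring) : (x * y).dim = x.dim * y.dim := by
  induction x using ind with | _ r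
  induction y using ind with | _ s
  rfl

theorem dim_conj (x : G.FusionSemiring) : (conj x).dim = x.dim := by
  induction x using ind with | _ r
  rfl

/-- The span of the entries of a corepresentation of the given class. -/
def coeffSpace : G.FusionSemiring → Submodule ℂ (coeffAlgebra G.u) :=
  Quotient.lift (fun r : G.Corep => Submodule.span ℂ {a | ∃ i j, a = r.mat i j}) <| by
    have key : ∀ r s : G.Corep, MatEquiv r.mat s.mat →
        Submodule.span ℂ {a | ∃ i j, a = s.mat i j} ≤
          Submodule.span ℂ {a | ∃ i j, a = r.mat i j} := by
      intro r s h
      obtain ⟨T, T', h1, h2, h3⟩ := h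
      have h3' : s.mat =
          scalarMat (coeffAlgebra G.u) T * r.mat * scalarMat (coeffAlgebra G.u) T' := by
        change _ = T.map _ * r.mat * _
        rw [h3, Matrix.mul_assoc]
        change _ = s.mat * (scalarMat (coeffAlgebra G.u) T * scalarMat (coeffAlgebra G.u) T')
        rw [← scalarMat_mul, h1, scalarMat_one, Matrix.mul_one]
      rw [Submodule.span_le]
      rintro _ ⟨i, j, rfl⟩
      rw [h3']
      simp only [Matrix.mul_apply, scalarMat, Matrix.map_apply, ← Algebra.smul_def,
        ← Algebra.commutes]
      exact Submodule.sum_mem _ fun k _ => Submodule.smul_mem _ _ <|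
        Submodule.sum_mem _ fun l _ => Submodule.smul_mem _ _ <| Submodule.subset_span ⟨l, k, rfl⟩
    intro r s h
    exact le_antisymm (key s r (MatEquiv.symm h)) (key r s h)

theorem coeffSpace_mk (r : G.Corep) :
    coeffSpace (mk r) = Submodule.span ℂ {a | ∃ i j, a = r.mat i j} := rfl

theorem mem_coeffSpace (r : G.Corep) (i j : Fin r.dim) : r.mat i j ∈ coeffSpace (mk r) :=
  Submodule.subset_span ⟨i, j, rfl⟩

theorem coeffSpace_add_le (x y : G.FusionSemiring) :
    coeffSpace (x + y) ≤ coeffSpace x ⊔ coeffSpace y := by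
  induction x using ind with | _ r
  induction y using ind with | _ s
  rw [add_def, coeffSpace_mk, Submodule.span_le]
  rintro _ ⟨i, j, rfl⟩
  change Matrix.fromBlocks r.mat 0 0 s.mat (finSumFinEquiv.symm i) (finSumFinEquiv.symm j) ∈ _
  rcases finSumFinEquiv.symm i with i | i <;> rcases finSumFinEquiv.symm j with j | j
  · exact (le_sup_left (a := coeffSpace (mk r)) : _ ≤ _ ⊔ coeffSpace (mk s)) (mem_coeffSpace r i j)
  · exact zero_mem _
  · exact zero_mem _
  · exact (le_sup_right (b := coeffSpace (mk s)) : _ ≤ coeffSpace (mk r) ⊔ _) (mem_coeffSpace s i j)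

theorem coeffSpace_zero : coeffSpace (0 : G.FusionSemiring) = ⊥ := by
  rw [zero_def, coeffSpace_mk, Submodule.span_eq_bot]
  rintro _ ⟨i, -⟩
  exact i.elim0

theorem star_mem_coeffSpace {x : G.FusionSemiring} {a : coeffAlgebra G.u}
    (ha : a ∈ coeffSpace x) : star a ∈ coeffSpace (conj x) := by
  induction x using ind with | _ r
  rw [coeffSpace_mk] at ha
  induction ha using Submodule.span_induction with
  | mem a ha =>
    obtain ⟨i, j, rfl⟩ := ha
    rw [conj_mk]
    exact Submodule.subset_span ⟨i, j, rfl⟩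
  | zero => rw [star_zero]; exact zero_mem _
  | add a b _ _ ha hb => rw [star_add]; exact add_mem ha hb
  | smul c a _ ha => rw [star_smul]; exact Submodule.smul_mem _ _ ha

instance finiteDimensional_coeffSpace (x : G.FusionSemiring) :
    FiniteDimensional ℂ (coeffSpace x) := by
  induction x using ind with | _ r
  rw [coeffSpace_mk]
  apply FiniteDimensional.span_of_finite
  refine (Set.finite_range fun p : Fin r.dim × Fin r.dim => r.mat p.1 p.2).subset ?_
  rintro _ ⟨i, j, rfl⟩
  exact ⟨(i, j), rfl⟩

/-- A nonzero class which is not the sum of two nonzero classes. -/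
def Indecomposable (x : G.FusionSemiring) : Prop :=
  x ≠ 0 ∧ ∀ a b, x = a + b → a = 0 ∨ b = 0

theorem indecomposable_induction {p : G.FusionSemiring → Prop} (zero : p 0)
    (indecomposable : ∀ x, Indecomposable x → p x) (add : ∀ x y, p x → p y → p (x + y))
    (x : G.FusionSemiring) : p x := by
  induction h : x.dim using Nat.strong_induction_on generalizing x with
  | _ d ih =>
    by_cases hx : Indecomposable x
    · exact indecomposable x hx
    by_cases h0 : x = 0
    · exact h0 ▸ zero
    simp only [Indecomposable, not_and, not_forall, not_or] at hx
    obtain ⟨a, b, rfl, ha, hb⟩ := hx h0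
    have ha' : a.dim ≠ 0 := fun h => ha (eq_zero_of_dim h)
    have hb' : b.dim ≠ 0 := fun h => hb (eq_zero_of_dim h)
    rw [dim_add] at h
    exact add a b (ih a.dim (by omega) a rfl) (ih b.dim (by omega) b rfl)

theorem Indecomposable.conj {x : G.FusionSemiring} (hx : Indecomposable x) :
    Indecomposable x.conj := by
  refine ⟨fun h => hx.1 ?_, fun a b h => ?_⟩
  · rw [← conj_conj x, h, conj_zero]
  · have h1 : x = a.conj + b.conj := by rw [← conj_add, ← h, conj_conj]
    rcases hx.2 _ _ h1 with h | h
    · left; rw [← conj_conj a, h, conj_zero]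
    · right; rw [← conj_conj b, h, conj_zero]

/-- Indecomposability is phrased with the addition alone so that semiring isomorphisms preserve it.
-/
theorem Indecomposable.map {B : Type v} [CStarAlgebra B] {m : ℕ} {K : WoronowiczPair B m}
    (f : G.FusionSemiring ≃+* K.FusionSemiring) {x : G.FusionSemiring} (hx : Indecomposable x) :
    Indecomposable (f x) := by
  refine ⟨fun h => hx.1 ((map_eq_zero_iff f f.injective).1 h), fun a b h => ?_⟩
  have h1 : x = f.symm a + f.symm b := by rw [← map_add, ← h, f.symm_apply_apply]
  rcases hx.2 _ _ h1 with h | h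
  · exact Or.inl ((map_eq_zero_iff f.symm f.symm.injective).1 h)
  · exact Or.inr ((map_eq_zero_iff f.symm f.symm.injective).1 h)

/-- `A_s` is spanned by the coefficients of the indecomposable corepresentations. -/
theorem indecomposable_coeff_induction {p : coeffAlgebra G.u → Prop}
    (coeff : ∀ x, Indecomposable x → ∀ a ∈ coeffSpace x, p a) (zero : p 0)
    (add : ∀ a b, p a → p b → p (a + b)) (smul : ∀ (c : ℂ) a, p a → p (c • a))
    (a : coeffAlgebra G.u) : p a := by
  have key : ∀ x : G.FusionSemiring, ∀ a ∈ coeffSpace x, p a := by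
    intro x
    induction x using indecomposable_induction with
    | zero =>
      intro a ha
      rw [coeffSpace_zero, Submodule.mem_bot] at ha
      exact ha ▸ zero
    | indecomposable x hx => exact coeff x hx
    | add x y hx hy =>
      intro a ha
      obtain ⟨b, hb, c, hc, rfl⟩ := Submodule.mem_sup.1 (coeffSpace_add_le x y ha)
      exact add _ _ (hx b hb) (hy c hc)
  induction a using corep_induction with
  | entry r i j => exact key (mk r) _ (mem_coeffSpace r i j)
  | zero => exact zero
  | add a b ha hb => exact add a b ha hb
  | smul c a ha => exact smul c a ha

end FusionSemiring

end WoronowiczPair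

/-! ### The Haar measure and the fusion semiring -/

namespace WoronowiczPair

variable {A : Type u} [CStarAlgebra A] {n : ℕ} {G : WoronowiczPair A n}

section

variable {ι κ : Type*} [Fintype ι] [DecidableEq ι] [Fintype κ] [DecidableEq κ]

theorem isCorep_one_matrix : G.IsCorep (1 : Matrix ι ι (coeffAlgebra G.u)) := by
  refine isCorep_iff.2 ⟨isUnit_one, fun i j => ?_⟩
  simp only [Matrix.one_apply]
  rw [Finset.sum_eq_single i]
  · by_cases hij : i = j
    · simp [hij, Algebra.TensorProduct.one_def]
    · simp [hij]
  · intro k _ hk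
    simp [hk.symm]
  · simp

variable [Nontrivial A]

theorem toClass_one (k : ℕ) :
    (isCorep_one_matrix : G.IsCorep (1 : Matrix (Fin k) (Fin k) (coeffAlgebra G.u))).toClass =
      (k : G.FusionSemiring) := by
  induction k with
  | zero =>
    rw [Nat.cast_zero]
    exact FusionSemiring.eq_zero_of_dim rfl
  | succ k ih =>
    have h1 : (isCorep_one_matrix : G.IsCorep (1 : Matrix (Fin (k + 1)) (Fin (k + 1))
        (coeffAlgebra G.u))).toClass = (IsCorep.fromBlocks (isCorep_one_matrix : G.IsCorep
          (1 : Matrix (Fin k) (Fin k) (coeffAlgebra G.u))) (isCorep_one_matrix : G.IsCorep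
          (1 : Matrix (Fin 1) (Fin 1) (coeffAlgebra G.u)))).toClass := by
      refine IsCorep.toClass_eq _ _ (MatEquiv.of_equiv (finSumFinEquiv (m := k) (n := 1)).symm ?_)
      intro i j
      rw [Matrix.fromBlocks_one, Matrix.one_apply, Matrix.one_apply]
      simp only [EmbeddingLike.apply_eq_iff_eq]
    rw [h1, IsCorep.toClass_fromBlocks isCorep_one_matrix isCorep_one_matrix, ih, Nat.cast_succ]
    congr 1
    exact FusionSemiring.mk_eq (s := Corep.one G)
      (Corep.ofMatrix_equiv (Fintype.equivFin (Fin 1)).symm isCorep_one_matrix)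

theorem character_toClass {r : Matrix ι ι (coeffAlgebra G.u)} (hr : G.IsCorep r) :
    FusionSemiring.character hr.toClass = r.trace := by
  rw [IsCorep.toClass, FusionSemiring.character_mk]
  exact (Fintype.equivFin ι).symm.sum_comp fun i => r i i

theorem dim_toClass {r : Matrix ι ι (coeffAlgebra G.u)} (hr : G.IsCorep r) :
    hr.toClass.dim = Fintype.card ι := rfl

end

variable [Nontrivial A]

/-! ### Schur's lemma. -/

namespace FusionSemiring

/-- A commuting idempotent splits the class into two summands whose dimensions are the ranks of `E`
and `1 - E`; one summand is zero. -/
theorem Indecomposable.eq_zero_or_one {ι : Type*} [Fintype ι] [DecidableEq ι]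
    {r : Matrix ι ι (coeffAlgebra G.u)} {hr : G.IsCorep r} (hx : Indecomposable hr.toClass)
    {E : Matrix ι ι ℂ} (hE : E * E = E)
    (hc : r * scalarMat (coeffAlgebra G.u) E = scalarMat (coeffAlgebra G.u) E * r) :
    E = 0 ∨ E = 1 := by
  obtain ⟨k, l, a, b, T, T', ha, hb, h1, h2, h3, h4⟩ := hr.exists_fromBlocks hE hc
  have h5 : E = T' * (Matrix.fromBlocks 1 0 0 0 :
      Matrix (Fin k ⊕ Fin l) (Fin k ⊕ Fin l) ℂ) * T := by
    rw [← h4]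
    calc E = (T' * T) * E * (T' * T) := by rw [h2, Matrix.mul_one, Matrix.one_mul]
      _ = _ := by simp only [Matrix.mul_assoc]
  have h6 : hr.toClass = ha.toClass + hb.toClass := by
    rw [← IsCorep.toClass_fromBlocks]
    refine IsCorep.toClass_eq _ _ ?_
    rw [← h3]
    exact matEquiv_conjugate h1 h2
  rcases hx.2 _ _ h6 with h | h
  · left
    have hk := dim_toClass ha
    rw [h, dim_zero, Fintype.card_fin] at hk
    subst hk
    rw [h5]
    have : (Matrix.fromBlocks 1 0 0 0 : Matrix (Fin 0 ⊕ Fin l) (Fin 0 ⊕ Fin l) ℂ) = 0 := by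
      ext (i | i) (j | j)
      · exact i.elim0
      · exact i.elim0
      · exact j.elim0
      · rfl
    rw [this, Matrix.mul_zero, Matrix.zero_mul]
  · right
    have hl := dim_toClass hb
    rw [h, dim_zero, Fintype.card_fin] at hl
    subst hl
    rw [h5]
    have : (Matrix.fromBlocks 1 0 0 0 : Matrix (Fin k ⊕ Fin 0) (Fin k ⊕ Fin 0) ℂ) = 1 := by
      ext (i | i) (j | j)
      · simp [Matrix.one_apply]
      · exact j.elim0
      · exact i.elim0
      · exact i.elim0
    rw [this, Matrix.mul_one, h2]

/-- The commutant of `r` has only trivial idempotents, so Fitting's lemma applies, and a hermitian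
nilpotent matrix is zero. -/
theorem Indecomposable.isUnit_of_isHermitian {ι : Type*} [Fintype ι] [DecidableEq ι]
    {r : Matrix ι ι (coeffAlgebra G.u)} {hr : G.IsCorep r} (hx : Indecomposable hr.toClass)
    {M : Matrix ι ι ℂ} (hM : M.IsHermitian) (h0 : M ≠ 0)
    (hc : r * scalarMat (coeffAlgebra G.u) M = scalarMat (coeffAlgebra G.u) M * r) :
    IsUnit M := by
  let C : Subalgebra ℂ (Matrix ι ι ℂ) :=
    (Subalgebra.centralizer ℂ {r}).comap (Algebra.ofId ℂ (coeffAlgebra G.u)).mapMatrix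
  have hC : ∀ N, N ∈ C ↔
      r * scalarMat (coeffAlgebra G.u) N = scalarMat (coeffAlgebra G.u) N * r := by
    intro N
    rw [Subalgebra.mem_comap, Subalgebra.mem_centralizer_iff]
    simp only [Set.mem_singleton_iff, forall_eq]
    rfl
  rcases isUnit_or_isNilpotent_of_trivial_idempotents C
    (fun E hE hEE => hx.eq_zero_or_one hEE ((hC E).1 hE)) ((hC M).2 hc) with h | ⟨k, hk⟩
  · exact h
  · exact absurd (hM.eq_zero_of_pow_eq_zero hk) h0

/-- Schur's lemma for unitary corepresentations. -/
theorem Indecomposable.matEquiv_of_intertwiner {ι κ : Type*} [Fintype ι] [DecidableEq ι]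
    [Fintype κ] [DecidableEq κ]
    {r : Matrix ι ι (coeffAlgebra G.u)} {hr : G.IsCorep r} (hx : Indecomposable hr.toClass)
    {s : Matrix κ κ (coeffAlgebra G.u)} {hs : G.IsCorep s} (hy : Indecomposable hs.toClass)
    (hru : r * r.conjTranspose = 1 ∧ r.conjTranspose * r = 1)
    (hsu : s * s.conjTranspose = 1 ∧ s.conjTranspose * s = 1) {T : Matrix ι κ ℂ} (hT : T ≠ 0)
    (h : scalarMat (coeffAlgebra G.u) T * s = r * scalarMat (coeffAlgebra G.u) T) :
    MatEquiv s r := by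
  -- By unitarity `T*` intertwines in the other direction, so `T* T` and `T T*` are nonzero
  -- hermitian elements of the two commutants, hence invertible.
  have h' : scalarMat (coeffAlgebra G.u) T.conjTranspose * r =
      s * scalarMat (coeffAlgebra G.u) T.conjTranspose := by
    have h1 := congrArg Matrix.conjTranspose h
    rw [Matrix.conjTranspose_mul, Matrix.conjTranspose_mul, scalarMat_conjTranspose] at h1
    calc _ = (s * s.conjTranspose) * scalarMat (coeffAlgebra G.u) T.conjTranspose * r := by
          rw [hsu.1, Matrix.one_mul]
      _ = s * (s.conjTranspose * scalarMat (coeffAlgebra G.u) T.conjTranspose) * r := by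
          simp only [Matrix.mul_assoc]
      _ = s * scalarMat (coeffAlgebra G.u) T.conjTranspose * (r.conjTranspose * r) := by
          rw [h1]
          simp only [Matrix.mul_assoc]
      _ = _ := by rw [hru.2, Matrix.mul_one]
  have u1 : IsUnit (T.conjTranspose * T) := by
    refine hy.isUnit_of_isHermitian (Matrix.isHermitian_conjTranspose_mul_self T)
      (fun h0 => hT (Matrix.conjTranspose_mul_self_eq_zero.1 h0)) ?_
    rw [scalarMat_mul, Matrix.mul_assoc, h, ← Matrix.mul_assoc, ← h', Matrix.mul_assoc]
  have u2 : IsUnit (T * T.conjTranspose) := by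
    refine hx.isUnit_of_isHermitian (Matrix.isHermitian_mul_conjTranspose_self T)
      (fun h0 => hT (Matrix.self_mul_conjTranspose_eq_zero.1 h0)) ?_
    rw [scalarMat_mul, Matrix.mul_assoc, h', ← Matrix.mul_assoc, ← h, Matrix.mul_assoc]
  obtain ⟨M, hM⟩ := u1
  obtain ⟨N, hN⟩ := u2
  have e1 : (M⁻¹ : Units _).val * T.conjTranspose * T = 1 := by
    rw [Matrix.mul_assoc, ← hM, Units.inv_mul]
  have e2 : T * (T.conjTranspose * (N⁻¹ : Units _).val) = 1 := by
    rw [← Matrix.mul_assoc, ← hN, Units.mul_inv]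
  have e3 : (M⁻¹ : Units _).val * T.conjTranspose = T.conjTranspose * (N⁻¹ : Units _).val := by
    calc _ = (M⁻¹ : Units _).val * T.conjTranspose * (T * (T.conjTranspose * (N⁻¹ : Units _).val)) := by
          rw [e2, Matrix.mul_one]
      _ = _ := by rw [← Matrix.mul_assoc, e1, Matrix.one_mul]
  refine ⟨T, _, e2, ?_, h⟩
  rw [← e3, e1]

end FusionSemiring

variable {h : A →L[ℂ] ℂ} (hh : G.IsRightHaar h)

include hh

/-! ### Multiplicity of the trivial corepresentation and orthogonality. -/

namespace FusionSemiring

/-- The matrix `P = h(r)` is idempotent and commutes with `r`, because `r P = P = P r`. On its range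
`r` is trivial, and `h` vanishes on the coefficients of the complement. -/
theorem exists_eq_natCast_add (x : G.FusionSemiring) :
    ∃ (k : ℕ) (y : G.FusionSemiring), x = k + y ∧ G.res h (character y) = 0 := by
  induction x using ind with | _ r
  obtain ⟨k, l, a, b, T, T', ha, hb, h1, h2, h3, h4⟩ :=
    r.isCorep.exists_fromBlocks (hh.haar_idem r.isCorep)
      ((hh.mul_haar r.isCorep).trans (hh.haar_mul r.isCorep).symm)
  have h5 : (Matrix.fromBlocks a 0 0 b).map (G.res h) = Matrix.fromBlocks 1 0 0 0 := by
    rw [← h4, ← h3, map_mul_scalarMat, map_scalarMat_mul]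
  rw [Matrix.fromBlocks_map, Matrix.fromBlocks_inj] at h5
  -- The block `a` satisfies `h(a) = 1`, so invariance `a h(a) = h(a)` reads `a = 1`.
  have ha1 : a = 1 := by
    have := hh.mul_haar ha
    rwa [h5.1, scalarMat_one, Matrix.mul_one] at this
  subst ha1
  refine ⟨k, hb.toClass, ?_, ?_⟩
  · rw [← toClass_one, ← IsCorep.toClass_fromBlocks, mk_eq_toClass]
    refine IsCorep.toClass_eq _ _ ?_
    rw [← h3]
    exact matEquiv_conjugate h1 h2
  · rw [character_toClass, Matrix.trace, map_sum]
    exact Finset.sum_eq_zero fun i _ => congrFun (congrFun h5.2.2.2 i) i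

theorem res_natCast_add (k : ℕ) (y : G.FusionSemiring) :
    G.res h (character (k + y)) = k + G.res h (character y) := by
  rw [map_add, map_natCast, map_add, ← nsmul_one, map_nsmul, hh.res_one, nsmul_one]

/-- The trivial summands of `x` go to trivial summands; the remaining part may a priori acquire `d`
further ones. -/
theorem exists_res_map_eq_add {B : Type v} [CStarAlgebra B] [Nontrivial B] {m : ℕ}
    {K : WoronowiczPair B m} {k : B →L[ℂ] ℂ} (hk : K.IsRightHaar k)
    (f : G.FusionSemiring ≃+* K.FusionSemiring) (x : G.FusionSemiring) :
    ∃ d : ℕ, K.res k (character (f x)) = G.res h (character x) + d := by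
  obtain ⟨N, y, rfl, hy⟩ := exists_eq_natCast_add hh x
  obtain ⟨d, z, hz, hz0⟩ := exists_eq_natCast_add hk (f y)
  refine ⟨d, ?_⟩
  rw [res_natCast_add hh, hy, map_add, map_natCast, res_natCast_add hk, hz, res_natCast_add hk, hz0,
    add_zero, add_zero]

/-- Isomorphisms of fusion semirings preserve the multiplicity of the trivial corepresentation. -/
theorem res_character_map {B : Type v} [CStarAlgebra B] [Nontrivial B] {m : ℕ}
    {K : WoronowiczPair B m} {k : B →L[ℂ] ℂ} (hk : K.IsRightHaar k)
    (f : G.FusionSemiring ≃+* K.FusionSemiring) (x : G.FusionSemiring) :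
    K.res k (character (f x)) = G.res h (character x) := by
  obtain ⟨d, hd⟩ := exists_res_map_eq_add hh hk f x
  obtain ⟨e, he⟩ := exists_res_map_eq_add hk hh f.symm (f x)
  rw [f.symm_apply_apply, hd, add_assoc] at he
  -- Applying `f` and then its inverse adds `d + e` to the multiplicity and yet returns `x`.
  have h0 : ((d + e : ℕ) : ℂ) = 0 := by
    push_cast
    exact left_eq_add.1 he
  rw [Nat.cast_eq_zero, Nat.add_eq_zero_iff] at h0
  rw [hd, h0.1, Nat.cast_zero, add_zero]

theorem exists_unitary_mk (x : G.FusionSemiring) :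
    ∃ r : G.Corep, r.mat ∈ unitary (Matrix (Fin r.dim) (Fin r.dim) (coeffAlgebra G.u)) ∧
      mk r = x := by
  induction x using ind with | _ r
  obtain ⟨s, hs, hsu, hrs⟩ := hh.exists_unitary r.isCorep
  exact ⟨⟨r.dim, s, hs⟩, hsu, mk_eq hrs.symm⟩

/-- For unitary representatives `r`, `s` and fixed `p`, `q`, the scalar matrix `T k l = h(star (r p
k) * s q l)` is an intertwiner by left invariance. Schur's lemma makes it zero when the classes
differ. -/
theorem Indecomposable.res_star_mul_eq_zero {x y : G.FusionSemiring} (hx : Indecomposable x)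
    (hy : Indecomposable y) (hxy : x ≠ y) {a b : coeffAlgebra G.u} (ha : a ∈ coeffSpace x)
    (hb : b ∈ coeffSpace y) : G.res h (star a * b) = 0 := by
  obtain ⟨r, hr, rfl⟩ := exists_unitary_mk hh x
  obtain ⟨s, hs, rfl⟩ := exists_unitary_mk hh y
  have key : ∀ p k q l, G.res h (star (r.mat p k) * s.mat q l) = 0 := by
    intro p k q l
    by_contra hne
    let T : Matrix (Fin r.dim) (Fin s.dim) ℂ :=
      Matrix.of fun k l => G.res h (star (r.mat p k) * s.mat q l)
    have hT : T ≠ 0 := fun h0 => hne (congrFun (congrFun h0 k) l)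
    have h1 : r.mat.conjTranspose * scalarMat (coeffAlgebra G.u) T * s.mat =
        scalarMat (coeffAlgebra G.u) T := by
      refine Matrix.ext fun k l => ?_
      have h2 := hh.slice_left (star (r.mat p k) * s.mat q l)
      rw [map_mul, comul_star, r.isCorep.comul_apply, s.isCorep.comul_apply, star_sum,
        Finset.sum_mul_sum] at h2
      simp only [TensorProduct.star_tmul, Algebra.TensorProduct.tmul_mul_tmul, map_sum,
        sliceLeft_tmul] at h2
      rw [Finset.sum_comm] at h2
      have h3 : scalarMat (coeffAlgebra G.u) T k l =
          h ((star (r.mat p k) * s.mat q l : coeffAlgebra G.u) : A) • 1 := by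
        rw [← Algebra.algebraMap_eq_smul_one]
        rfl
      rw [h3, ← h2, Matrix.mul_apply]
      refine Finset.sum_congr rfl fun j _ => ?_
      rw [Matrix.mul_apply, Finset.sum_mul]
      refine Finset.sum_congr rfl fun i _ => ?_
      rw [Matrix.conjTranspose_apply, scalarMat, Matrix.map_apply, ← Algebra.commutes,
        ← Algebra.smul_def, smul_mul_assoc]
      rfl
    have hr1 : r.mat * r.mat.conjTranspose = 1 := Unitary.mul_star_self_of_mem hr
    have hr2 : r.mat.conjTranspose * r.mat = 1 := Unitary.star_mul_self_of_mem hr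
    have h2 : scalarMat (coeffAlgebra G.u) T * s.mat = r.mat * scalarMat (coeffAlgebra G.u) T := by
      conv_rhs => rw [← h1, ← Matrix.mul_assoc, ← Matrix.mul_assoc, hr1, Matrix.one_mul]
    rw [mk_eq_toClass] at hx hy
    exact hxy (mk_eq (hx.matEquiv_of_intertwiner hy ⟨hr1, hr2⟩
      ⟨Unitary.mul_star_self_of_mem hs, Unitary.star_mul_self_of_mem hs⟩ hT h2).symm)
  rw [coeffSpace_mk] at ha hb
  induction ha using Submodule.span_induction with
  | mem a ha =>
    obtain ⟨p, k, rfl⟩ := ha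
    induction hb using Submodule.span_induction with
    | mem b hb =>
      obtain ⟨q, l, rfl⟩ := hb
      exact key p k q l
    | zero => simp
    | add a b _ _ ha hb => rw [mul_add, map_add, ha, hb, add_zero]
    | smul c a _ ha => rw [mul_smul_comm, map_smul, ha, smul_zero]
  | zero => simp
  | add a b _ _ ha hb => rw [star_add, add_mul, map_add, ha, hb, add_zero]
  | smul c a _ ha => rw [star_smul, smul_mul_assoc, map_smul, ha, smul_zero]

end FusionSemiring

/-- Strong invariance of the Haar measure: for `a = r p q` the slice `(id ⊗ h)((1 ⊗ a) Δ(y))` is `∑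
k, κ(r p k) h(r k q * y)`. Hence it vanishes as soon as `h` vanishes on `A_s y`. -/
theorem IsRightHaar.slice_mul_comul (a y : coeffAlgebra G.u) :
    ∃ (m : ℕ) (b c : Fin m → coeffAlgebra G.u),
      G.sliceRight (G.res h ∘ₗ LinearMap.mulLeft ℂ a) (G.comul y) =
        ∑ k, b k * algebraMap ℂ _ (G.res h (c k * y)) := by
  induction a using corep_induction with
  | entry r p q =>
    refine ⟨r.dim, fun k => G.κ (r.mat p k), fun k => r.mat k q, ?_⟩
    -- Invariance applied to `r k q * y` places an entry of `r` on the left, which the antipode then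
    -- cancels.
    have h1 : ∀ k, algebraMap ℂ (coeffAlgebra G.u) (G.res h (r.mat k q * y)) =
        ∑ l, r.mat k l * G.sliceRight (G.res h ∘ₗ LinearMap.mulLeft ℂ (r.mat l q)) (G.comul y) := by
      intro k
      have h2 := hh.slice (r.mat k q * y)
      rw [Algebra.algebraMap_eq_smul_one]
      refine h2.symm.trans ?_
      rw [map_mul, r.isCorep.comul_apply]
      generalize G.comul y = t
      induction t using TensorProduct.induction_on with
      | zero => simp
      | add x y hx hy => simp only [mul_add, map_add, hx, hy, Finset.sum_add_distrib]
      | tmul b c =>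
        rw [Finset.sum_mul, map_sum]
        refine Finset.sum_congr rfl fun l _ => ?_
        rw [Algebra.TensorProduct.tmul_mul_tmul, sliceRight_tmul, sliceRight_tmul, mul_smul_comm]
        rfl
    simp only [h1, Finset.mul_sum, ← mul_assoc]
    rw [Finset.sum_comm]
    simp only [← Finset.sum_mul, r.isCorep.antipodeInverts.1]
    simp
  | zero => exact ⟨0, 0, 0, by simp [TensorProduct.map_zero_right, sliceRight]⟩
  | add a a' ha ha' =>
    obtain ⟨m, b, c, h1⟩ := ha
    obtain ⟨m', b', c', h2⟩ := ha'
    refine ⟨m + m', Fin.append b b', Fin.append c c', ?_⟩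
    simp only [Fin.sum_univ_add, Fin.append_left, Fin.append_right]
    rw [← h1, ← h2]
    generalize G.comul y = t
    induction t using TensorProduct.induction_on with
    | zero => simp
    | add x y hx hy => simp only [map_add, hx, hy]; abel
    | tmul b c => simp [add_mul, add_smul]
  | smul c a ha =>
    obtain ⟨m, b, d, h1⟩ := ha
    refine ⟨m, c • b, d, ?_⟩
    simp only [Pi.smul_apply, smul_mul_assoc, ← Finset.smul_sum]
    rw [← h1]
    generalize G.comul y = t
    induction t using TensorProduct.induction_on with
    | zero => simp
    | add x y hx hy => simp only [map_add, hx, hy, smul_add]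
    | tmul b c => simp [mul_smul]

omit hh in
theorem sliceRight_counitLinear_comul (y : coeffAlgebra G.u) :
    G.sliceRight G.counitLinear (G.comul y) = y := by
  induction y using corep_induction with
  | entry r i j =>
    rw [r.isCorep.comul_apply, map_sum]
    simp only [sliceRight_tmul, r.isCorep.counitLinear_apply]
    simp
  | zero => simp
  | add a b ha hb => rw [map_add, map_add, ha, hb]
  | smul c a ha => rw [map_smul, map_smul, ha]

/-- The Haar measure is faithful on `A_s`. -/
theorem IsRightHaar.faithful {y : coeffAlgebra G.u} (hy : G.res h (star y * y) = 0) : y = 0 := by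
  -- The null space of `h` is a left ideal. The proof shows `Δ(N) ⊆ A_s ⊗ N` and `ε(N) = 0`, so that
  -- `z = z₁ ε(z₂) = 0` for `z ∈ N`.
  let N : Submodule ℂ (coeffAlgebra G.u) :=
    { carrier := {z | ∀ a, G.res h (a * z) = 0}
      add_mem' := fun hx hy a => by rw [mul_add, map_add, hx a, hy a, add_zero]
      zero_mem' := fun a => by rw [mul_zero, map_zero]
      smul_mem' := fun c x hx a => by rw [mul_smul_comm, map_smul, hx a, smul_zero] }
  have hN : ∀ a z, z ∈ N → a * z ∈ N := fun a z hz b => by rw [← mul_assoc]; exact hz _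
  have hyN : y ∈ N := fun a => posFunctional_mul_eq_zero hh.nonneg hy a
  have hone : (1 : coeffAlgebra G.u) ∉ N := fun h1 => by
    have := h1 1
    rw [mul_one, hh.res_one] at this
    exact one_ne_zero this
  have hslice : ∀ z ∈ N, ∀ g : coeffAlgebra G.u →ₗ[ℂ] ℂ, G.sliceLeft g (G.comul z) ∈ N := by
    intro z hz g a
    obtain ⟨m, b, c, h1⟩ := hh.slice_mul_comul a z
    have h2 : G.sliceRight (G.res h ∘ₗ LinearMap.mulLeft ℂ a) (G.comul z) = 0 := by
      rw [h1]
      exact Finset.sum_eq_zero fun k _ => by rw [hz, map_zero, mul_zero]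
    rw [← map_zero g, ← h2]
    generalize G.comul z = t
    induction t using TensorProduct.induction_on with
    | zero => simp
    | add x y hx hy => simp only [map_add, mul_add, hx, hy]
    | tmul b c => simp [mul_comm]
  -- Along a basis of the first leg, the coefficients of `Δ(z)` are slices by coordinate
  -- functionals, hence lie in `N`.
  have hrep : ∀ z ∈ N, ∃ (c : _ →₀ coeffAlgebra G.u),
      (∀ i, c i ∈ N) ∧
        (c.sum fun i w => Module.Basis.ofVectorSpace ℂ (coeffAlgebra G.u) i ⊗ₜ w) = G.comul z := by
    intro z hz
    obtain ⟨c, hc⟩ := TensorProduct.eq_repr_basis_left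
      (Module.Basis.ofVectorSpace ℂ (coeffAlgebra G.u)) (G.comul z)
    refine ⟨c, fun i => ?_, hc⟩
    have := hslice z hz ((Module.Basis.ofVectorSpace ℂ (coeffAlgebra G.u)).coord i)
    rw [← hc, Finsupp.sum, map_sum] at this
    simp only [sliceLeft_tmul, Module.Basis.coord_apply, Module.Basis.repr_self] at this
    rwa [Finset.sum_eq_single i, Finsupp.single_eq_same, one_smul] at this
    · intro j _ hj
      rw [Finsupp.single_eq_of_ne hj.symm, zero_smul]
    · intro hi
      rw [Finsupp.notMem_support_iff.1 hi, smul_zero]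
  -- The scalar `ε(z) 1 = κ(z₁) z₂` lies in the left ideal `N`, which does not contain `1`.
  have hcounit : ∀ z ∈ N, G.counit z = 0 := by
    intro z hz
    obtain ⟨c, hc, h1⟩ := hrep z hz
    have h2 : algebraMap ℂ (coeffAlgebra G.u) (G.counit z) ∈ N := by
      have h3 : algebraMap ℂ (coeffAlgebra G.u) (G.counit z) =
          LinearMap.mul' ℂ _ (TensorProduct.map G.κ LinearMap.id (G.comul z)) := by
        clear h1 hc hz c
        induction z using corep_induction with
        | entry r i j =>
          rw [r.isCorep.comul_apply, map_sum, map_sum, r.isCorep.counit_apply]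
          simp only [TensorProduct.map_tmul, LinearMap.mul'_apply, LinearMap.id_apply]
          rw [r.isCorep.antipodeInverts.1]
          split_ifs <;> simp
        | zero => simp
        | add a b ha hb => simp only [map_add, ha, hb]
        | smul c a ha => simp only [map_smul, smul_eq_mul, map_mul, ← Algebra.smul_def, ha]
      rw [h3, ← h1, Finsupp.sum, map_sum, map_sum]
      refine N.sum_mem fun i _ => ?_
      rw [TensorProduct.map_tmul, LinearMap.mul'_apply]
      exact hN _ _ (hc i)
    by_contra h0
    refine hone ?_
    rw [Algebra.algebraMap_eq_smul_one] at h2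
    have := N.smul_mem (G.counit z)⁻¹ h2
    rwa [smul_smul, inv_mul_cancel₀ h0, one_smul] at this
  obtain ⟨c, hc, h1⟩ := hrep y hyN
  rw [← sliceRight_counitLinear_comul y, ← h1, Finsupp.sum, map_sum]
  refine Finset.sum_eq_zero fun i _ => ?_
  rw [sliceRight_tmul]
  have : G.counitLinear (c i) = 0 := hcounit _ (hc i)
  rw [this, zero_smul]

namespace FusionSemiring

/-- Otherwise the character vanishes by faithfulness, and the counit reads off dimension zero. -/
theorem res_star_character_ne_zero {x : G.FusionSemiring} (hx : x ≠ 0) :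
    G.res h (character (conj x * x)) ≠ 0 := by
  intro h0
  rw [map_mul, character_conj] at h0
  have h1 := hh.faithful h0
  have h2 := counit_character x
  rw [h1, map_zero] at h2
  exact hx (eq_zero_of_dim (by exact_mod_cast h2.symm))

omit hh in
theorem character_mem_coeffSpace (x : G.FusionSemiring) : character x ∈ coeffSpace x := by
  induction x using ind with | _ r
  rw [character_mk, Matrix.trace]
  exact Submodule.sum_mem _ fun i _ => mem_coeffSpace r i i

/-- Isomorphisms of fusion semirings commute with conjugation. -/
theorem map_conj {B : Type v} [CStarAlgebra B] [Nontrivial B] {m : ℕ}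
    {K : WoronowiczPair B m} {k : B →L[ℂ] ℂ} (hk : K.IsRightHaar k)
    (f : G.FusionSemiring ≃+* K.FusionSemiring) (x : G.FusionSemiring) :
    f (conj x) = conj (f x) := by
  induction x using indecomposable_induction with
  | zero => rw [conj_zero, map_zero, conj_zero]
  | add x y hx hy => rw [conj_add, map_add, hx, hy, map_add, conj_add]
  | indecomposable x hx =>
    have h1 := res_star_character_ne_zero hh hx.1
    rw [← res_character_map hh hk f, map_mul, map_mul] at h1
    -- If `f(x̄)` were not the conjugate of `f x`, orthogonality of coefficients would make the
    -- multiplicity of `1` in `f(x̄) f(x)` zero, against `h1`.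
    by_contra hne
    refine h1 ?_
    have h2 : character (f (conj x)) = star (character (conj (f (conj x)))) := by
      rw [character_conj, star_star]
    rw [h2]
    refine (hx.conj.map f).conj.res_star_mul_eq_zero hk (hx.map f) (fun h3 => hne ?_)
      (character_mem_coeffSpace _) (character_mem_coeffSpace _)
    rw [← h3, conj_conj]

end FusionSemiring

end WoronowiczPair

/-! ### Morphisms of C*-algebras -/

section CStar

variable {A : Type u} [CStarAlgebra A] {R : Type v} [CStarAlgebra R]

theorem continuous_starAlgHom (q : A →⋆ₐ[ℂ] R) : Continuous q :=
  AddMonoidHomClass.continuous_of_bound q 1 fun a => by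
    rw [one_mul]
    exact NonUnitalStarAlgHom.norm_apply_le q a

/-- The norm of the image of a self-adjoint element in the support of a state is controlled by the
growth of the moments. -/
theorem norm_le_of_moments [Nontrivial A] {h : A →L[ℂ] ℂ} (hpos : ∀ a, 0 ≤ h (star a * a)) (h1 : h 1 = 1)
    {q : A →⋆ₐ[ℂ] R} (hq : ∀ x, h (star x * x) = 0 → q x = 0) {X : A} (hX : IsSelfAdjoint X)
    {C D : ℝ} (hC : 0 ≤ C) (hm : ∀ k, (h (X ^ (2 * k))).re ≤ D * C ^ (2 * k)) : ‖q X‖ ≤ C := by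
  let _ := CStarAlgebra.spectralOrder A
  have := CStarAlgebra.spectralOrderedRing A
  -- This function vanishes exactly on `[-C, C]`. Once `g(X)` is null for `h`, one has `g(q X) = 0`,
  -- and the spectrum of `q X` lies in that interval.
  set g : ℝ → ℝ := fun t => max 0 (|t| - C) with hg
  have hgc : Continuous g := by fun_prop
  have hmono : ∀ a b : A, a ≤ b → (h a).re ≤ (h b).re := by
    intro a b hab
    obtain ⟨c, hc⟩ := CStarAlgebra.nonneg_iff_eq_star_mul_self.1 (sub_nonneg.2 hab)
    exact (posFunctional_mono hpos hc).1
  have hbound : ∀ δ : ℝ, 0 < δ → (h (cfc (fun t => g t * g t) X)).re ≤ δ * δ := by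
    intro δ hδ
    have hk : ∀ k : ℕ, (h (cfc (fun t => g t * g t) X)).re ≤
        δ * δ + ‖X‖ ^ 2 * D * ((C / (C + δ)) ^ 2) ^ k := by
      intro k
      -- Pointwise on the spectrum: `g ≤ δ` for `|t| ≤ C + δ`, while beyond it `g² ≤ ‖X‖²` and `(t /
      -- (C + δ)) ^ (2 * k) ≥ 1`. The second term tends to zero in `k` after applying `h`.
      have hle : cfc (fun t => g t * g t) X ≤
          cfc (fun t : ℝ => δ * δ + (‖X‖ ^ 2 / (C + δ) ^ (2 * k)) * t ^ (2 * k)) X := by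
        refine cfc_mono (fun t ht => ?_) (by fun_prop) (by fun_prop)
        have htX : |t| ≤ ‖X‖ := by
          have := spectrum.norm_le_norm_of_mem ((IsSelfAdjoint.coe_mem_spectrum_complex hX).2 ht)
          simpa using this
        have he : t ^ (2 * k) = (|t|) ^ (2 * k) := by rw [pow_mul, pow_mul, sq_abs]
        rcases le_or_gt |t| (C + δ) with hlt | hlt
        · have h2 : g t ≤ δ := max_le hδ.le (by linarith)
          have h3 : 0 ≤ g t := le_max_left _ _
          have h4 : 0 ≤ (‖X‖ ^ 2 / (C + δ) ^ (2 * k)) * t ^ (2 * k) := by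
            rw [he]
            positivity
          nlinarith
        · have h2 : g t ≤ ‖X‖ := max_le (norm_nonneg _) (by linarith)
          have h3 : 0 ≤ g t := le_max_left _ _
          have h4 : ‖X‖ ^ 2 ≤ (‖X‖ ^ 2 / (C + δ) ^ (2 * k)) * t ^ (2 * k) := by
            rw [he, div_mul_eq_mul_div, le_div_iff₀ (by positivity)]
            exact mul_le_mul_of_nonneg_left (pow_le_pow_left₀ (by positivity) hlt.le _)
              (by positivity)
          nlinarith
      refine (hmono _ _ hle).trans ?_
      have e1 : cfc (fun t : ℝ => δ * δ + (‖X‖ ^ 2 / (C + δ) ^ (2 * k)) * t ^ (2 * k)) X =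
          ((δ * δ : ℝ) : ℂ) • (1 : A) +
            ((‖X‖ ^ 2 / (C + δ) ^ (2 * k) : ℝ) : ℂ) • X ^ (2 * k) := by
        rw [cfc_add .., cfc_const .., cfc_const_mul .., cfc_pow .., cfc_id' .., Complex.coe_smul,
          Complex.coe_smul, Algebra.algebraMap_eq_smul_one]
      rw [e1, map_add, map_smul, map_smul, h1, smul_eq_mul, smul_eq_mul, mul_one, Complex.add_re,
        Complex.re_ofReal_mul, Complex.ofReal_re]
      refine add_le_add_right ?_ _
      calc ‖X‖ ^ 2 / (C + δ) ^ (2 * k) * (h (X ^ (2 * k))).re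
          ≤ ‖X‖ ^ 2 / (C + δ) ^ (2 * k) * (D * C ^ (2 * k)) :=
            mul_le_mul_of_nonneg_left (hm k) (by positivity)
        _ = _ := by rw [← pow_mul, div_pow]; ring
    have hlim : Filter.Tendsto (fun k : ℕ => δ * δ + ‖X‖ ^ 2 * D * ((C / (C + δ)) ^ 2) ^ k)
        Filter.atTop (nhds (δ * δ + ‖X‖ ^ 2 * D * 0)) := by
      refine tendsto_const_nhds.add (Filter.Tendsto.const_mul _ ?_)
      refine tendsto_pow_atTop_nhds_zero_of_lt_one (by positivity) ?_
      refine pow_lt_one₀ (by positivity) ?_ two_ne_zero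
      rw [div_lt_one (by positivity)]
      linarith
    rw [mul_zero, add_zero] at hlim
    exact ge_of_tendsto' hlim hk
  have hY : star (cfc g X) * cfc g X = cfc (fun t => g t * g t) X := by
    rw [(cfc_predicate g X).star_eq, cfc_mul ..]
  have hzero : h (star (cfc g X) * cfc g X) = 0 := by
    have h2 := hpos (cfc g X)
    have h3 : (h (star (cfc g X) * cfc g X)).re = 0 := by
      refine le_antisymm ?_ (Complex.le_def.1 h2).1
      rw [hY]
      by_contra! hx
      -- With `δ²` equal to half of a positive value, the bound would say that the value is at most
      -- its half.
      have h4 := hbound √((h (cfc (fun t => g t * g t) X)).re / 2) (by positivity)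
      rw [Real.mul_self_sqrt (by positivity)] at h4
      linarith
    exact Complex.ext h3 (Complex.le_def.1 h2).2.symm
  have hqX : IsSelfAdjoint (q X) := hX.map q
  have hq0 : cfc g (q X) = 0 := by
    rw [← StarAlgHomClass.map_cfc q g X (by fun_prop) 
      (continuous_starAlgHom q) hX hqX]
    exact hq _ hzero
  have hsp : ∀ t ∈ spectrum ℝ (q X), ‖t‖ ≤ C := by
    intro t ht
    have h5 := (norm_cfc_le_iff g (q X) le_rfl (by fun_prop) hqX).1 (by rw [hq0, norm_zero]) t ht
    have h6 : g t = 0 := norm_le_zero_iff.1 h5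
    have h7 : |t| - C ≤ g t := le_max_right _ _
    rw [Real.norm_eq_abs]
    linarith
  rw [← cfc_id ℝ (q X) hqX]
  exact norm_cfc_le hC hsp

/-- Multiply `b` by `g(b* b)`, where `g(t) = c / max c √t`. This cuts the modulus of `b` off at `c =
‖π b‖`, and `g` is `1` on the spectrum of `π(b* b)`, so the image does not change. -/
theorem exists_lift_norm_le (π : A →⋆ₐ[ℂ] R) (b : A) : ∃ b', π b' = π b ∧ ‖b'‖ ≤ ‖π b‖ := by
  rcases eq_or_ne (π b) 0 with h0 | h0
  · exact ⟨0, by rw [h0, map_zero], by rw [h0, norm_zero, norm_zero]⟩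
  have hc : 0 < ‖π b‖ := norm_pos_iff.2 h0
  set c := ‖π b‖
  set g : ℝ → ℝ := fun t => c / max c √t with hg
  have hgc : Continuous g :=
    continuous_const.div (continuous_const.max Real.continuous_sqrt)
      fun t => (lt_max_of_lt_left hc).ne'
  have hX : IsSelfAdjoint (star b * b) := IsSelfAdjoint.star_mul_self b
  refine ⟨b * cfc g (star b * b), ?_, ?_⟩
  · rw [map_mul, StarAlgHomClass.map_cfc π g (star b * b) (by fun_prop) (continuous_starAlgHom π) hX
      (hX.map π)]
    have h1 : cfc g (π (star b * b)) = cfc (fun _ => (1 : ℝ)) (π (star b * b)) := by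
      refine cfc_congr fun t ht => ?_
      have h2 : |t| ≤ c * c := by
        have : Nontrivial R := ⟨_, _, h0⟩
        have := spectrum.norm_le_norm_of_mem
          ((IsSelfAdjoint.coe_mem_spectrum_complex (hX.map π)).2 ht)
        rw [map_mul, map_star, CStarRing.norm_star_mul_self] at this
        simpa using this
      have h3 : √t ≤ c := Real.sqrt_le_iff.2 ⟨hc.le, by rw [sq]; exact (le_abs_self t).trans h2⟩
      simp only [hg]
      rw [max_eq_left h3, div_self hc.ne']
    rw [h1, cfc_const_one ℝ _ (hX.map π), mul_one]
  · rw [mul_self_le_mul_self_iff (norm_nonneg _) hc.le, ← CStarRing.norm_star_mul_self]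
    have h1 : star (b * cfc g (star b * b)) * (b * cfc g (star b * b)) =
        cfc (fun t => g t * (t * g t)) (star b * b) := by
      have e1 : cfc (fun t => g t * (t * g t)) (star b * b) =
          cfc g (star b * b) * cfc (fun t => t * g t) (star b * b) :=
        cfc_mul g (fun t => t * g t) (star b * b) hgc.continuousOn
          (continuous_id.mul hgc).continuousOn
      have e2 : cfc (fun t => t * g t) (star b * b) = star b * b * cfc g (star b * b) := by
        rw [cfc_mul (fun t : ℝ => t) g (star b * b) continuous_id.continuousOn hgc.continuousOn,
          cfc_id' ℝ (star b * b) hX]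
      rw [e1, e2, star_mul, (cfc_predicate g (star b * b)).star_eq]
      simp only [mul_assoc]
    rw [h1]
    refine norm_cfc_le (by positivity) fun t ht => ?_
    have h2 : 0 ≤ t := spectrum_star_mul_self_nonneg _ ht
    have h3 : 0 < max c √t := lt_max_of_lt_left hc
    have h4 : t ≤ max c √t * max c √t := by
      calc t = √t * √t := (Real.mul_self_sqrt h2).symm
        _ ≤ _ := mul_self_le_mul_self (Real.sqrt_nonneg _) (le_max_right _ _)
    have h5 : g t * (t * g t) = c * c * (t / (max c √t * max c √t)) := by
      simp only [hg]
      field_simp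
    rw [h5, Real.norm_of_nonneg (by positivity)]
    exact mul_le_of_le_one_right (by positivity) ((div_le_one (by positivity)).2 h4)

/-- Lifts without increase of norm allow a limit of images to be lifted as a convergent series. -/
theorem isClosed_range_starAlgHom (π : A →⋆ₐ[ℂ] R) : IsClosed (Set.range π) := by
  let f : NormedAddGroupHom A R := AddMonoidHom.mkNormedAddGroupHom (π : A →+ R) 1 fun a => by
    rw [one_mul]
    exact NonUnitalStarAlgHom.norm_apply_le π a
  have h1 : f.SurjectiveOnWith f.range 1 := by
    rintro _ ⟨b, rfl⟩
    obtain ⟨b', h2, h3⟩ := exists_lift_norm_le π b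
    exact ⟨b', h2, by rw [one_mul]; exact h3⟩
  have h2 := controlled_closure_of_complete one_pos one_pos h1
  refine isClosed_of_closure_subset fun x hx => ?_
  obtain ⟨b, hb, -⟩ := h2 x hx
  exact ⟨b, hb⟩

theorem norm_unitary_entry_le {ι : Type*} [Fintype ι] [DecidableEq ι] {r : Matrix ι ι A}
    (hr : ∀ i j, ∑ k, star (r k i) * r k j = if i = j then 1 else 0) (i j : ι) : ‖r i j‖ ≤ 1 := by
  let _ := CStarAlgebra.spectralOrder A
  have := CStarAlgebra.spectralOrderedRing A
  have h1 : star (r i j) * r i j ≤ 1 := by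
    have h2 := hr j j
    rw [if_pos rfl] at h2
    rw [← h2]
    exact Finset.single_le_sum (f := fun k => star (r k j) * r k j)
      (fun k _ => star_mul_self_nonneg _) (Finset.mem_univ i)
  have h2 := CStarAlgebra.norm_le_norm_of_nonneg_of_le (star_mul_self_nonneg _) h1
  rw [CStarRing.norm_star_mul_self] at h2
  rcases subsingleton_or_nontrivial A with hs | hn
  · rw [Subsingleton.elim (r i j) 0, norm_zero]
    exact zero_le_one
  · rw [norm_one] at h2
    nlinarith [norm_nonneg (r i j)]

end CStar

/-! ### The reduced version and the dimension inequality -/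

namespace WoronowiczPair

variable {A : Type u} [CStarAlgebra A] [Nontrivial A] {n : ℕ} {G : WoronowiczPair A n}
  {h : A →L[ℂ] ℂ} (hh : G.IsRightHaar h)

include hh

namespace FusionSemiring

/-- The pairing of the coefficient spaces of a class and of its conjugate by the Haar measure. -/
theorem haarPairing_injective (x : G.FusionSemiring) :
    Function.Injective (((LinearMap.mul ℂ (coeffAlgebra G.u)).compr₂ (G.res h)).domRestrict₁₂
      (coeffSpace x) (coeffSpace (conj x))) := by
  rw [injective_iff_map_eq_zero]
  intro v hv
  have h1 : G.res h ((v : coeffAlgebra G.u) * star (v : coeffAlgebra G.u)) = 0 :=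
    LinearMap.congr_fun hv ⟨star (v : coeffAlgebra G.u), star_mem_coeffSpace v.2⟩
  have h2 : star (v : coeffAlgebra G.u) = 0 := hh.faithful (by rwa [star_star])
  exact Subtype.ext (star_eq_zero.1 h2)

/-- Injectivity for `x` and for its conjugate bounds each dimension by the other, so injective maps
to the dual are surjective. -/
theorem haarPairing_surjective (x : G.FusionSemiring) :
    Function.Surjective (((LinearMap.mul ℂ (coeffAlgebra G.u)).compr₂ (G.res h)).domRestrict₁₂
      (coeffSpace x) (coeffSpace (conj x))) := by
  have key : ∀ y : G.FusionSemiring, Module.finrank ℂ (coeffSpace y) ≤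
      Module.finrank ℂ (coeffSpace (conj y)) := fun y =>
    (LinearMap.finrank_le_finrank_of_injective (haarPairing_injective hh y)).trans
      Subspace.dual_finrank_eq.le
  have h1 := key (conj x)
  rw [conj_conj] at h1
  refine (LinearMap.injective_iff_surjective_of_finrank_eq_finrank ?_).1 (haarPairing_injective hh x)
  exact (le_antisymm (key x) h1).trans Subspace.dual_finrank_eq.symm

/-- The functional `z ↦ h(z y)` on the coefficients of the conjugate class is represented by some
`y'`, by perfectness of the pairing. On the coefficients of any other indecomposable class both
sides vanish by orthogonality. -/
theorem Indecomposable.exists_twist {x : G.FusionSemiring} (hx : Indecomposable x)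
    {y : coeffAlgebra G.u} (hy : y ∈ coeffSpace x) :
    ∃ y' : coeffAlgebra G.u, ∀ z, G.res h (z * y) = G.res h (y' * z) := by
  obtain ⟨y', hy'⟩ := haarPairing_surjective hh x
    ((G.res h ∘ₗ LinearMap.mulRight ℂ y).domRestrict (coeffSpace (FusionSemiring.conj x)))
  refine ⟨y', fun z => ?_⟩
  induction z using indecomposable_coeff_induction with
  | coeff t ht z hz =>
    by_cases hxt : t = FusionSemiring.conj x
    · subst hxt
      exact (LinearMap.congr_fun hy' ⟨z, hz⟩).symm
    · have h1 := ht.conj.res_star_mul_eq_zero hh hx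
        (fun h => hxt (by rw [← h, FusionSemiring.conj_conj])) (star_mem_coeffSpace hz) hy
      have h2 := hx.conj.res_star_mul_eq_zero hh ht (fun h => hxt h.symm)
        (star_mem_coeffSpace y'.2) hz
      rw [star_star] at h1 h2
      rw [h1, h2]
  | zero => simp
  | add a b ha hb => rw [add_mul, mul_add, map_add, map_add, ha, hb]
  | smul c a ha => rw [smul_mul_assoc, mul_smul_comm, map_smul, map_smul, ha]

end FusionSemiring

theorem IsRightHaar.exists_twist_coeff (y : coeffAlgebra G.u) :
    ∃ y' : coeffAlgebra G.u, ∀ z, G.res h (z * y) = G.res h (y' * z) := by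
  induction y using FusionSemiring.indecomposable_coeff_induction with
  | coeff x hx y hy => exact hx.exists_twist hh hy
  | zero => exact ⟨0, by simp⟩
  | add a b ha hb =>
    obtain ⟨a', ha'⟩ := ha
    obtain ⟨b', hb'⟩ := hb
    exact ⟨a' + b', fun z => by rw [mul_add, add_mul, map_add, map_add, ha', hb']⟩
  | smul c a ha =>
    obtain ⟨a', ha'⟩ := ha
    exact ⟨c • a', fun z => by rw [mul_smul_comm, smul_mul_assoc, map_smul, map_smul, ha']⟩

/-- The modular property of the Haar measure. -/
theorem IsRightHaar.exists_twist (y : coeffAlgebra G.u) :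
    ∃ y' : coeffAlgebra G.u, ∀ z : A, h (z * y) = h (y' * z) := by
  obtain ⟨y', hy'⟩ := hh.exists_twist_coeff y
  refine ⟨y', fun z => ?_⟩
  refine G.dense.induction (P := fun z => h (z * y) = h (y' * z)) ?_ ?_ z
  · intro z hz
    exact hy' ⟨z, hz⟩
  · exact isClosed_eq (by fun_prop) (by fun_prop)

/-- The null space of `h` is also a right ideal: for `c` in `A_s`, the twist moves the last factor
`c` to the front, leaving a product that ends in the null element `b`. Continuity gives all `c`. -/
theorem IsRightHaar.null_mul {b : A} (hb : h (star b * b) = 0) (c : A) :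
    h (star (b * c) * (b * c)) = 0 := by
  refine G.dense.induction (P := fun c => h (star (b * c) * (b * c)) = 0) ?_ ?_ c
  · intro y hy
    obtain ⟨y', hy'⟩ := hh.exists_twist ⟨y, hy⟩
    have h1 : star (b * y) * (b * y) = star (b * y) * b * y := by simp only [mul_assoc]
    have h2 := hy' (star (b * y) * b)
    rw [h1]
    refine h2.trans ?_
    rw [← mul_assoc]
    exact posFunctional_mul_eq_zero hh.nonneg hb _
  · exact isClosed_eq (by fun_prop) continuous_const

/-- The algebra is the image of the GNS representation of `h`, closed by
`isClosed_range_starAlgHom`. By `null_mul` a null element kills every GNS vector, and not only the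
cyclic one. -/
theorem IsRightHaar.exists_reduced :
    ∃ (R : Type u) (_ : CStarAlgebra R) (q : A →⋆ₐ[ℂ] R), Function.Surjective q ∧
      ∀ x, q x = 0 ↔ h (star x * x) = 0 := by
  let _ := CStarAlgebra.spectralOrder A
  have := CStarAlgebra.spectralOrderedRing A
  let f := positiveFunctional h hh.nonneg
  let π : A →⋆ₐ[ℂ] (f.GNS →L[ℂ] f.GNS) := f.gnsStarAlgHom
  have hnorm : ∀ a : A, ‖f.toPreGNS a‖ = 0 ↔ h (star a * a) = 0 := by
    intro a
    rw [PositiveLinearMap.preGNS_norm_def]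
    change √(h (star a * a)).re = 0 ↔ _
    rw [Real.sqrt_eq_zero (hh.nonneg a).1]
    refine ⟨fun h1 => ?_, fun h1 => ?_⟩
    · rw [posFunctional_real hh.nonneg a]
      exact congrArg _ h1
    · exact congrArg Complex.re h1
  have hker : ∀ x, π x = 0 ↔ h (star x * x) = 0 := by
    intro x
    refine ⟨fun h1 => ?_, fun h1 => ?_⟩
    · have h2 : π x (f.toPreGNS 1 : f.PreGNS) = 0 := by rw [h1]; rfl
      have h3 : π x (f.toPreGNS 1 : f.PreGNS) = (f.toPreGNS (x * 1) : f.PreGNS) :=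
        PositiveLinearMap.gnsNonUnitalStarAlgHom_apply_coe f
      rw [h3, ← norm_eq_zero, UniformSpace.Completion.norm_coe, hnorm, mul_one] at h2
      exact h2
    · refine ContinuousLinearMap.ext fun v => ?_
      induction v using UniformSpace.Completion.induction_on with
      | hp => exact isClosed_eq (π x).continuous (ContinuousLinearMap.continuous _)
      | ih b =>
        have h3 : π x (b : f.GNS) = (f.toPreGNS (x * f.ofPreGNS b) : f.PreGNS) :=
          PositiveLinearMap.gnsNonUnitalStarAlgHom_apply_coe f
        rw [h3]
        refine norm_eq_zero.1 ?_
        rw [UniformSpace.Completion.norm_coe, hnorm]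
        exact hh.null_mul h1 _
  have hcl : IsClosed (π.range : Set (f.GNS →L[ℂ] f.GNS)) := by
    exact isClosed_range_starAlgHom π
  let inst : CStarAlgebra π.range := StarSubalgebra.cstarAlgebra (h_closed := hcl) π.range
  refine ⟨π.range, inst, π.rangeRestrict, ?_, fun x => ?_⟩
  · rintro ⟨_, a, rfl⟩
    exact ⟨a, rfl⟩
  · rw [← hker]
    exact Subtype.ext_iff

theorem FusionSemiring.norm_character_le (x : G.FusionSemiring) :
    ‖(character x : A)‖ ≤ x.dim := by
  obtain ⟨r, hr, rfl⟩ := exists_unitary_mk hh x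
  rw [character_mk, Matrix.trace, AddSubmonoidClass.coe_finsetSum, dim_mk]
  refine (norm_sum_le _ _).trans ?_
  refine (Finset.sum_le_card_nsmul _ _ 1 fun i _ => ?_).trans (by simp)
  refine norm_unitary_entry_le (r := r.mat.map Subtype.val) (fun i j => ?_) i i
  have h1 : (star r.mat * r.mat) i j = (1 : Matrix _ _ (coeffAlgebra G.u)) i j := by
    rw [Unitary.star_mul_self_of_mem hr]
  rw [Matrix.mul_apply, Matrix.one_apply] at h1
  have h2 := congrArg Subtype.val h1
  rw [AddSubmonoidClass.coe_finsetSum, apply_ite Subtype.val] at h2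
  exact h2

omit hh in
/-- If `A` is amenable then its counit is bounded for the norm of the reduced version. -/
theorem IsAmenable.exists_norm_counit_le (hA : G.IsAmenable) :
    ∃ (h : A →L[ℂ] ℂ) (_ : G.IsRightHaar h) (R : Type u) (_ : CStarAlgebra R) (q : A →⋆ₐ[ℂ] R),
      (∀ x, h (star x * x) = 0 → q x = 0) ∧ ∀ a : coeffAlgebra G.u, ‖G.counit a‖ ≤ ‖q a‖ := by
  obtain ⟨P, _, ι, R, _, q, θ, hι, ⟨-, h, hh, hq⟩, hθ, hbij⟩ := hA
  refine ⟨h, hh.isRightHaar, R, inferInstance, q, fun x hx => (hq x).2 hx, fun a => ?_⟩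
  -- The universal property tests algebras in the universe of `A`, so the counit is regarded as a
  -- morphism into the scalars of `A`, which keeps its norm.
  obtain ⟨ψ, hψ⟩ := hι.exists_lift A ((StarAlgHom.ofId ℂ A).comp G.counit)
  have h1 : ‖ψ (ι a)‖ = ‖G.counit a‖ := by
    rw [hψ]
    exact norm_algebraMap' A (G.counit a)
  rw [← h1, ← hθ, NonUnitalStarAlgHom.norm_map θ hbij.1]
  exact NonUnitalStarAlgHom.norm_apply_le ψ _

omit hh in
/-- For `A` amenable, the moments of the character of the image of `x̄ x` under an isomorphism of
fusion semirings see the dimension of `x`. -/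
theorem dim_sq_le_of_moments_map {B : Type v} [CStarAlgebra B] [Nontrivial B] {m : ℕ}
    {K : WoronowiczPair B m} (f : G.FusionSemiring ≃+* K.FusionSemiring) (hA : G.IsAmenable)
    {k : B →L[ℂ] ℂ} (hk : K.IsRightHaar k) (x : G.FusionSemiring) {C D : ℝ} (hC : 0 ≤ C)
    (hm : ∀ j, (k (((FusionSemiring.character (FusionSemiring.conj (f x) * f x) :
      coeffAlgebra K.u) : B) ^ (2 * j))).re ≤ D * C ^ (2 * j)) : (x.dim : ℝ) ^ 2 ≤ C := by
  obtain ⟨h, hh, R, _, q, hq, hε⟩ := hA.exists_norm_counit_le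
  set y := FusionSemiring.conj x * x with hy
  have hfy : f y = FusionSemiring.conj (f x) * f x := by
    rw [hy, map_mul, FusionSemiring.map_conj hh hk]
  have hsa : IsSelfAdjoint ((FusionSemiring.character y : coeffAlgebra G.u) : A) := by
    rw [hy, map_mul, FusionSemiring.character_conj]
    exact IsSelfAdjoint.star_mul_self ((FusionSemiring.character x : coeffAlgebra G.u) : A)
  have hmom : ∀ j : ℕ, h (((FusionSemiring.character y : coeffAlgebra G.u) : A) ^ (2 * j)) =
      k (((FusionSemiring.character (f y) : coeffAlgebra K.u) : B) ^ (2 * j)) := by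
    intro j
    have h1 := FusionSemiring.res_character_map hh hk f (y ^ (2 * j))
    rw [map_pow f, map_pow FusionSemiring.character, map_pow FusionSemiring.character] at h1
    exact h1.symm
  have hle := norm_le_of_moments hh.nonneg hh.map_one hq hsa hC fun j => by
    rw [hmom, hfy]
    exact hm j
  -- The counit takes the value `(dim x)²` on this character, so the reduced norm is caught between
  -- `(dim x)²` and `C`.
  have h2 := (hε (FusionSemiring.character y)).trans hle
  rwa [FusionSemiring.counit_character, Complex.norm_natCast, hy, FusionSemiring.dim_mul,
    FusionSemiring.dim_conj, Nat.cast_mul, ← sq] at h2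

omit hh in
-- The norm bound for characters of `B` bounds the moments with `C = (dim f(x))²`; the constant `D =
-- ‖k‖` does not affect their growth rate.
theorem dim_le_dim_map {B : Type v} [CStarAlgebra B] [Nontrivial B] {m : ℕ}
    {K : WoronowiczPair B m} (f : G.FusionSemiring ≃+* K.FusionSemiring) (hA : G.IsAmenable)
    (x : G.FusionSemiring) : x.dim ≤ (f x).dim := by
  obtain ⟨k, hk⟩ := K.exists_isRightHaar
  have h1 := dim_sq_le_of_moments_map f hA hk x (C := ((f x).dim : ℝ) ^ 2) (D := ‖k‖)
    (by positivity) fun j => by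
      refine (Complex.re_le_norm _).trans ((k.le_opNorm _).trans ?_)
      refine mul_le_mul_of_nonneg_left ((norm_pow_le _ _).trans ?_) (norm_nonneg _)
      refine pow_le_pow_left₀ (norm_nonneg _)
        ((FusionSemiring.norm_character_le hk _).trans_eq ?_) _
      rw [FusionSemiring.dim_mul, FusionSemiring.dim_conj, Nat.cast_mul, sq]
  have h2 : x.dim ^ 2 ≤ (f x).dim ^ 2 := by exact_mod_cast h1
  exact (Nat.pow_le_pow_iff_left two_ne_zero).1 h2

end WoronowiczPair

/-! ### Amenability from almost invariant vectors -/

section Gram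

variable {A : Type u} [CStarAlgebra A] {D : Type v} [CStarAlgebra D] {ι : Type*} [Fintype ι]
  {h : A →L[ℂ] ℂ}

/-- The Gram matrix of the `b i` factors as `L* L`, and `L` is absorbed into the `d j`. This is the
complete positivity behind `gramMap`. -/
theorem gram_eq_sum_star_mul_self [DecidableEq ι] (hpos : ∀ a, 0 ≤ h (star a * a)) (d : ι → D)
    (b : ι → A) :
    ∃ e : ι → D, ∑ i, ∑ j, h (star (b i) * b j) • (star (d i) * d j) = ∑ l, star (e l) * e l := by
  obtain ⟨L, hL⟩ := exists_conjTranspose_mul_self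
    (M := Matrix.of fun i j => h (star (b i) * b j))
    (by
      ext i j
      rw [Matrix.conjTranspose_apply, Matrix.of_apply, Matrix.of_apply, ← posFunctional_star hpos,
        star_mul, star_star])
    (fun ζ => by
      have h1 := hpos (∑ i, ζ i • b i)
      have h2 : h (star (∑ i, ζ i • b i) * ∑ i, ζ i • b i) =
          ∑ i, ∑ j, star (ζ i) * h (star (b i) * b j) * ζ j := by
        simp only [star_sum, star_smul, Finset.sum_mul_sum, map_sum, smul_mul_smul_comm, map_smul,
          smul_eq_mul]
        exact Finset.sum_congr rfl fun i _ => Finset.sum_congr rfl fun j _ => by ring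
      rw [h2] at h1
      exact h1)
  have hL' : ∀ i j, h (star (b i) * b j) = ∑ l, star (L l i) * L l j := fun i j => by
    have := congrFun (congrFun hL i) j
    rwa [Matrix.mul_apply] at this
  refine ⟨fun l => ∑ j, L l j • d j, ?_⟩
  simp only [hL', star_sum, star_smul, Finset.sum_mul_sum, smul_mul_smul_comm, Finset.sum_smul]
  rw [Finset.sum_comm_cycle, Finset.sum_comm_cycle]

/-- The completely positive map `a ↦ ∑ h(b_i* a b_j) d_i* d_j`. -/
def gramMap (h : A →L[ℂ] ℂ) (d : ι → D) (b : ι → A) : A →ₗ[ℂ] D where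
  toFun a := ∑ i, ∑ j, h (star (b i) * a * b j) • (star (d i) * d j)
  map_add' x y := by
    simp only [mul_add, add_mul, map_add, add_smul, Finset.sum_add_distrib]
  map_smul' c x := by
    simp only [mul_smul_comm, smul_mul_assoc, map_smul, smul_assoc, Finset.smul_sum,
      RingHom.id_apply]

theorem gramMap_apply (d : ι → D) (b : ι → A) (a : A) :
    gramMap h d b a = ∑ i, ∑ j, h (star (b i) * a * b j) • (star (d i) * d j) := rfl

theorem gramMap_star (hpos : ∀ a, 0 ≤ h (star a * a)) (d : ι → D) (b : ι → A) (a : A) :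
    gramMap h d b (star a) = star (gramMap h d b a) := by
  rw [gramMap_apply, gramMap_apply, star_sum, Finset.sum_comm]
  refine Finset.sum_congr rfl fun i _ => ?_
  rw [star_sum]
  refine Finset.sum_congr rfl fun j _ => ?_
  rw [star_smul, ← posFunctional_star hpos]
  simp only [star_mul, star_star, mul_assoc]

/-- The Schwarz inequality for a unital completely positive map. -/
theorem gramMap_schwarz [DecidableEq ι] (hpos : ∀ a, 0 ≤ h (star a * a)) (d : ι → D) (b : ι → A)
    (h1 : gramMap h d b 1 = 1) (a : A) :
    ∃ e : ι ⊕ ι → D, gramMap h d b (star a * a) - star (gramMap h d b a) * gramMap h d b a =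
      ∑ l, star (e l) * e l := by
  set y := gramMap h d b a with hy
  -- For the doubled families the four blocks of the Gram sum are `F(a* a)`, `-y* y`, `-y* y` and
  -- `y* y`, with `F` the map `gramMap h d b`; the last block uses `F(1) = 1`.
  obtain ⟨e, he⟩ := gram_eq_sum_star_mul_self hpos
    (Sum.elim d (fun i => -(d i * y))) (Sum.elim (fun i => a * b i) b)
  refine ⟨e, he ▸ ?_⟩
  have e1 : gramMap h d b (star a) = star y := gramMap_star hpos d b a
  rw [Fintype.sum_sum_type]
  simp only [Fintype.sum_sum_type, Sum.elim_inl, Sum.elim_inr, Finset.sum_add_distrib]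
  have t1 : ∑ i, ∑ j, h (star (a * b i) * (a * b j)) • (star (d i) * d j) =
      gramMap h d b (star a * a) := by
    simp only [gramMap_apply, star_mul, mul_assoc]
  have t2 : ∑ i, ∑ j, h (star (a * b i) * b j) • (star (d i) * -(d j * y)) = -(star y * y) := by
    rw [← e1, gramMap_apply, Finset.sum_mul, ← Finset.sum_neg_distrib]
    refine Finset.sum_congr rfl fun i _ => ?_
    rw [Finset.sum_mul, ← Finset.sum_neg_distrib]
    refine Finset.sum_congr rfl fun j _ => ?_
    rw [star_mul, smul_mul_assoc, mul_neg, smul_neg]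
    simp only [mul_assoc]
  have t3 : ∑ i, ∑ j, h (star (b i) * (a * b j)) • (star (-(d i * y)) * d j) = -(star y * y) := by
    have : -(star y * y) = -star y * gramMap h d b a := by rw [neg_mul]
    rw [this, gramMap_apply, Finset.mul_sum]
    refine Finset.sum_congr rfl fun i _ => ?_
    rw [Finset.mul_sum]
    refine Finset.sum_congr rfl fun j _ => ?_
    rw [star_neg, star_mul, mul_smul_comm, neg_mul, neg_mul]
    simp only [mul_assoc]
  have t4 : ∑ i, ∑ j, h (star (b i) * b j) • (star (-(d i * y)) * -(d j * y)) = star y * y := by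
    have : star y * y = star y * gramMap h d b 1 * y := by rw [h1, mul_one]
    rw [this, gramMap_apply, Finset.mul_sum, Finset.sum_mul]
    refine Finset.sum_congr rfl fun i _ => ?_
    rw [Finset.mul_sum, Finset.sum_mul]
    refine Finset.sum_congr rfl fun j _ => ?_
    rw [star_neg, star_mul, neg_mul_neg, mul_smul_comm, smul_mul_assoc, mul_one]
    simp only [mul_assoc]
  rw [t1, t2, t3, t4]
  abel

/-- The map vanishes on the kernel of `q` and is positive, so it descends to a unital positive map
on `R`; the Schwarz inequality then makes it contractive for the norm of `R`. -/
theorem norm_gramMap_le [DecidableEq ι] (hpos : ∀ a, 0 ≤ h (star a * a)) {R : Type*}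
    [CStarAlgebra R] {q : A →⋆ₐ[ℂ] R} (hsurj : Function.Surjective q)
    (hq : ∀ x, q x = 0 → h (star x * x) = 0) (d : ι → D) (b : ι → A)
    (h1 : gramMap h d b 1 = 1) (a : A) : ‖gramMap h d b a‖ ≤ ‖q a‖ := by
  let _ := CStarAlgebra.spectralOrder D
  have := CStarAlgebra.spectralOrderedRing D
  let _ := CStarAlgebra.spectralOrder R
  have := CStarAlgebra.spectralOrderedRing R
  obtain ⟨e, he⟩ := gramMap_schwarz hpos d b h1 a
  -- A square root of `‖q a‖² - q(a)* q(a)` is lifted to `c` in `A`, so that `‖q a‖² - a* a - c* c`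
  -- lies in the kernel of `q`.
  obtain ⟨c, hc⟩ := CStarAlgebra.nonneg_iff_eq_star_mul_self.1
    (sub_nonneg.2 (CStarAlgebra.star_mul_le_algebraMap_norm_sq (a := q a)))
  obtain ⟨c, rfl⟩ := hsurj c
  have hz : q (((‖q a‖ ^ 2 : ℝ) : ℂ) • 1 - star a * a - star c * c) = 0 := by
    rw [map_sub, map_sub, map_smul, map_one, map_mul, map_mul, map_star, map_star, ← hc,
      Complex.coe_smul, ← Algebra.algebraMap_eq_smul_one, sub_self]
  have hF : gramMap h d b (((‖q a‖ ^ 2 : ℝ) : ℂ) • 1 - star a * a - star c * c) = 0 := by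
    rw [gramMap_apply]
    refine Finset.sum_eq_zero fun i _ => Finset.sum_eq_zero fun j _ => ?_
    rw [mul_assoc, posFunctional_mul_eq_zero hpos (hq _ ?_), zero_smul]
    rw [map_mul, hz, zero_mul]
  obtain ⟨e', he'⟩ := gram_eq_sum_star_mul_self hpos d (fun i => c * b i)
  have hFc : gramMap h d b (star c * c) = ∑ l, star (e' l) * e' l := by
    rw [← he', gramMap_apply]
    simp only [star_mul, mul_assoc]
  rw [map_sub, map_sub, map_smul, h1, hFc, Complex.coe_smul, ← Algebra.algebraMap_eq_smul_one,
    sub_eq_zero] at hF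
  have hle : star (gramMap h d b a) * gramMap h d b a ≤ algebraMap ℝ D (‖q a‖ ^ 2) := by
    have h2 : star (gramMap h d b a) * gramMap h d b a ≤ gramMap h d b (star a * a) := by
      rw [← sub_nonneg, he]
      exact Finset.sum_nonneg fun l _ => star_mul_self_nonneg _
    refine h2.trans ?_
    rw [← sub_nonneg, hF]
    exact Finset.sum_nonneg fun l _ => star_mul_self_nonneg _
  have h3 := CStarAlgebra.norm_le_norm_of_nonneg_of_le (star_mul_self_nonneg _) hle
  rw [CStarRing.norm_star_mul_self] at h3
  have h4 : ‖algebraMap ℝ D (‖q a‖ ^ 2)‖ ≤ ‖q a‖ * ‖q a‖ := by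
    rcases subsingleton_or_nontrivial D with hs | hn
    · rw [Subsingleton.elim (algebraMap ℝ D (‖q a‖ ^ 2)) 0, norm_zero]
      positivity
    · rw [norm_algebraMap', Real.norm_of_nonneg (by positivity), sq]
  exact (mul_self_le_mul_self_iff (norm_nonneg _) (norm_nonneg _)).2 (h3.trans h4)

end Gram

/-! ### Slices of the comultiplication by vector states. -/

namespace WoronowiczPair

variable {A : Type u} [CStarAlgebra A] [Nontrivial A] {n : ℕ} {G : WoronowiczPair A n}
  {h : A →L[ℂ] ℂ} (hh : G.IsRightHaar h)

variable (G) in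
/-- The twisted coproduct `(κ⁻¹ ⊗ id) Δ`. -/
def twistedComul : coeffAlgebra G.u →ₗ[ℂ] coeffAlgebra G.u ⊗[ℂ] coeffAlgebra G.u :=
  TensorProduct.map G.κInv LinearMap.id ∘ₗ G.comul.toLinearMap

theorem twistedComul_entry (r : G.Corep) (p q : Fin r.dim) :
    G.twistedComul (r.mat p q) = ∑ k, G.κInv (r.mat p k) ⊗ₜ r.mat k q := by
  change TensorProduct.map G.κInv LinearMap.id (G.comul (r.mat p q)) = _
  rw [r.isCorep.comul_apply, map_sum]
  rfl

include hh in
-- An algebraic form of the absorption property of the regular representation. It expresses the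
-- slice of `Δ(a)` by the functional `h(x* · y)` through `1 ⊗ a`, where `a` occurs only under `h`;
-- hence the reduced norm controls it.
theorem IsRightHaar.slice_twistedComul_entry (r s : G.Corep) (p q : Fin r.dim)
    (p' q' : Fin s.dim) (a : coeffAlgebra G.u) :
    G.sliceRight (G.res h) (star (G.twistedComul (r.mat p q)) * (1 ⊗ₜ a) *
      G.twistedComul (s.mat p' q')) =
      G.sliceRight (G.res h ∘ₗ LinearMap.mulLeft ℂ (star (r.mat p q)) ∘ₗ
        LinearMap.mulRight ℂ (s.mat p' q')) (G.comul a) := by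
  -- Invariance of `h` replaces the scalar by a slice of a product of comultiplications; the `κ⁻¹`
  -- factors then cancel the outer first legs in `h4` and `h5`.
  have h1 : ∀ k l, algebraMap ℂ (coeffAlgebra G.u)
      (G.res h (star (r.mat k q) * a * s.mat l q')) =
      G.sliceRight (G.res h) (star (G.comul (r.mat k q)) * G.comul a * G.comul (s.mat l q')) := by
    intro k l
    rw [← comul_star, ← map_mul, ← map_mul, hh.slice, Algebra.algebraMap_eq_smul_one]
    rfl
  have h2 : G.sliceRight (G.res h) (star (G.twistedComul (r.mat p q)) * (1 ⊗ₜ a) *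
      G.twistedComul (s.mat p' q')) = ∑ k, ∑ l, star (G.κInv (r.mat p k)) *
        algebraMap ℂ (coeffAlgebra G.u) (G.res h (star (r.mat k q) * a * s.mat l q')) *
          G.κInv (s.mat p' l) := by
    rw [twistedComul_entry, twistedComul_entry, star_sum, Finset.sum_mul, Finset.sum_mul_sum,
      map_sum]
    refine Finset.sum_congr rfl fun k _ => ?_
    rw [map_sum]
    refine Finset.sum_congr rfl fun l _ => ?_
    rw [TensorProduct.star_tmul, Algebra.TensorProduct.tmul_mul_tmul,
      Algebra.TensorProduct.tmul_mul_tmul, sliceRight_tmul, mul_one, ← Algebra.commutes,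
      ← Algebra.smul_def, smul_mul_assoc]
  rw [h2]
  simp only [h1]
  generalize G.comul a = t
  induction t using TensorProduct.induction_on with
  | zero => simp
  | add x y hx hy => simp only [mul_add, add_mul, map_add, Finset.sum_add_distrib, hx, hy]
  | tmul b c =>
    have h3 : ∀ k l, G.sliceRight (G.res h)
        (star (G.comul (r.mat k q)) * (b ⊗ₜ c) * G.comul (s.mat l q')) =
        ∑ k', ∑ l', G.res h (star (r.mat k' q) * c * s.mat l' q') •
          (star (r.mat k k') * b * s.mat l l') := by
      intro k l
      rw [r.isCorep.comul_apply, s.isCorep.comul_apply, star_sum, Finset.sum_mul,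
        Finset.sum_mul_sum, map_sum]
      refine Finset.sum_congr rfl fun k' _ => ?_
      rw [map_sum]
      refine Finset.sum_congr rfl fun l' _ => ?_
      rw [TensorProduct.star_tmul, Algebra.TensorProduct.tmul_mul_tmul,
        Algebra.TensorProduct.tmul_mul_tmul, sliceRight_tmul]
    have h4 : ∀ k', ∑ k, star (G.κInv (r.mat p k)) * star (r.mat k k') =
        if p = k' then 1 else 0 := by
      intro k'
      have := congrArg star (r.isCorep.antipodeInverts.sum_mul_κInv p k')
      rw [star_sum] at this
      simp only [star_mul] at this
      rw [this]
      split_ifs <;> simp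
    have h5 := s.isCorep.antipodeInverts.sum_mul_κInv p'
    calc _ = ∑ k, ∑ l, ∑ k', ∑ l', G.res h (star (r.mat k' q) * c * s.mat l' q') •
          ((star (G.κInv (r.mat p k)) * star (r.mat k k')) * b *
            (s.mat l l' * G.κInv (s.mat p' l))) := by
          refine Finset.sum_congr rfl fun k _ => Finset.sum_congr rfl fun l _ => ?_
          rw [h3, Finset.mul_sum, Finset.sum_mul]
          refine Finset.sum_congr rfl fun k' _ => ?_
          rw [Finset.mul_sum, Finset.sum_mul]
          refine Finset.sum_congr rfl fun l' _ => ?_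
          rw [mul_smul_comm, smul_mul_assoc]
          simp only [mul_assoc]
      _ = ∑ k', ∑ l', G.res h (star (r.mat k' q) * c * s.mat l' q') •
          ((∑ k, star (G.κInv (r.mat p k)) * star (r.mat k k')) * b *
            (∑ l, s.mat l l' * G.κInv (s.mat p' l))) := by
          simp only [Finset.sum_mul, Finset.mul_sum, Finset.smul_sum]
          rw [Finset.sum_comm_cycle]
          refine Finset.sum_congr rfl fun k' _ => ?_
          rw [Finset.sum_comm_cycle]
          refine Finset.sum_congr rfl fun l' _ => ?_
          rw [Finset.sum_comm]
      _ = _ := by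
          simp only [h4, h5]
          simp [mul_assoc]

include hh in
theorem IsRightHaar.slice_twistedComul (x y a : coeffAlgebra G.u) :
    G.sliceRight (G.res h) (star (G.twistedComul x) * (1 ⊗ₜ a) * G.twistedComul y) =
      G.sliceRight (G.res h ∘ₗ LinearMap.mulLeft ℂ (star x) ∘ₗ LinearMap.mulRight ℂ y)
        (G.comul a) := by
  induction x using corep_induction with
  | entry r p q =>
    induction y using corep_induction with
    | entry s p' q' => exact hh.slice_twistedComul_entry r s p q p' q' a
    | zero => simp [sliceRight, LinearMap.mulRight_zero_eq_zero]
    | add y y' hy hy' =>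
      rw [map_add, mul_add, map_add, hy, hy']
      generalize G.comul a = t
      induction t using TensorProduct.induction_on with
      | zero => simp
      | add t t' ht ht' => simp only [map_add, ← ht, ← ht']; abel
      | tmul b c => simp [mul_add, add_smul]
    | smul c y hy =>
      rw [map_smul, mul_smul_comm, map_smul, hy]
      generalize G.comul a = t
      induction t using TensorProduct.induction_on with
      | zero => simp
      | add t t' ht ht' => simp only [map_add, smul_add, ← ht, ← ht']
      | tmul b c => simp [mul_smul]
  | zero => simp [sliceRight, LinearMap.mulLeft_zero_eq_zero]
  | add x x' hx hx' =>
    rw [map_add, star_add, add_mul, add_mul, map_add, hx, hx']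
    generalize G.comul a = t
    induction t using TensorProduct.induction_on with
    | zero => simp
    | add t t' ht ht' => simp only [map_add, ← ht, ← ht']; abel
    | tmul b c => simp [add_mul, add_smul]
  | smul c x hx =>
    rw [map_smul, star_smul, smul_mul_assoc, smul_mul_assoc, map_smul, hx]
    generalize G.comul a = t
    induction t using TensorProduct.induction_on with
    | zero => simp
    | add t t' ht ht' => simp only [map_add, smul_add, ← ht, ← ht']
    | tmul b c => simp [mul_smul]

end WoronowiczPair

/-! ### Almost invariant vectors -/

section

variable {A : Type u} [CStarAlgebra A]

theorem exists_gns_vectors {h : A →L[ℂ] ℂ} (hpos : ∀ a, 0 ≤ h (star a * a)) :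
    ∃ (V : Type u) (_ : NormedAddCommGroup V) (_ : InnerProductSpace ℂ V) (ω : A →ₗ[ℂ] V),
      (∀ a b, inner ℂ (ω a) (ω b) = h (star a * b)) ∧ ∀ a b, ‖ω (a * b)‖ ≤ ‖a‖ * ‖ω b‖ := by
  let _ := CStarAlgebra.spectralOrder A
  have := CStarAlgebra.spectralOrderedRing A
  let f := positiveFunctional h hpos
  refine ⟨f.GNS, inferInstance, inferInstance,
    (UniformSpace.Completion.toComplL (𝕜 := ℂ) (E := f.PreGNS)).toLinearMap ∘ₗ
      f.toPreGNS.toLinearMap, fun a b => ?_, fun a b => ?_⟩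
  · exact UniformSpace.Completion.inner_coe _ _
  · change ‖((f.toPreGNS (a * b) : f.PreGNS) : f.GNS)‖ ≤
      ‖a‖ * ‖((f.toPreGNS b : f.PreGNS) : f.GNS)‖
    rw [UniformSpace.Completion.norm_coe, UniformSpace.Completion.norm_coe]
    exact (f.leftMulMapPreGNS a).le_of_opNorm_le
      (LinearMap.mkContinuous_norm_le _ (norm_nonneg _) _) (f.toPreGNS b)

/-- Extension of a bounded morphism from a dense `*`-algebra. -/
theorem exists_starAlgHom_extension {S : Type*} [Ring S] [StarRing S] [Algebra ℂ S]
    {D : Type v} [CStarAlgebra D] (ι : S →⋆ₐ[ℂ] A) (hι : DenseRange ι)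
    (φ : S →⋆ₐ[ℂ] D) (hle : ∀ a, ‖φ a‖ ≤ ‖ι a‖) : ∃ ψ : A →⋆ₐ[ℂ] D, ∀ a, ψ (ι a) = φ a := by
  let ψ : A →L[ℂ] D := φ.toAlgHom.toLinearMap.extendOfNorm ι.toAlgHom.toLinearMap
  have hψ : ∀ a, ψ (ι a) = φ a := fun a =>
    LinearMap.extendOfNorm_eq (f := φ.toAlgHom.toLinearMap) (e := ι.toAlgHom.toLinearMap) hι
      ⟨1, fun x => by rw [one_mul]; exact hle x⟩ a
  have h1 : ψ 1 = 1 := by rw [← map_one ι, hψ, map_one]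
  refine ⟨{ toFun := ψ
            map_one' := h1
            map_mul' := fun x y => ?_
            map_zero' := map_zero ψ
            map_add' := map_add ψ
            commutes' := fun c => ?_
            map_star' := fun x => ?_ }, hψ⟩
  · refine hι.induction_on₂ (p := fun x y => ψ (x * y) = ψ x * ψ y) ?_ ?_ x y
    · exact isClosed_eq (by fun_prop) (by fun_prop)
    · intro a b
      rw [← map_mul, hψ, hψ, hψ, map_mul]
  · rw [Algebra.algebraMap_eq_smul_one, map_smul, h1, Algebra.algebraMap_eq_smul_one]
  · refine hι.induction_on (p := fun x => ψ (star x) = star (ψ x)) x ?_ ?_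
    · exact isClosed_eq (by fun_prop) (by fun_prop)
    · intro a
      rw [← map_star, hψ, hψ, map_star]

end

/-! ### Amenability from vector states converging to the counit. -/

namespace WoronowiczPair

variable {A : Type u} [CStarAlgebra A] [Nontrivial A] {n : ℕ} {G : WoronowiczPair A n}
  {h : A →L[ℂ] ℂ} (hh : G.IsRightHaar h)

include hh in
-- Writing the twisted coproduct of `x` as `∑ e i ⊗ b i`, the slice followed by `φ` is the `gramMap`
-- of the `φ(e i)` and `b i`. It is unital because `h(x* x) = 1`.
theorem IsRightHaar.norm_slice_le {R : Type*} [CStarAlgebra R] {q : A →⋆ₐ[ℂ] R}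
    (hsurj : Function.Surjective q) (hq : ∀ x, q x = 0 → h (star x * x) = 0)
    {D : Type v} [CStarAlgebra D] (φ : coeffAlgebra G.u →⋆ₐ[ℂ] D) {x : coeffAlgebra G.u}
    (hx : G.res h (star x * x) = 1) (a : coeffAlgebra G.u) :
    ‖φ (G.sliceRight (G.res h ∘ₗ LinearMap.mulLeft ℂ (star x) ∘ₗ LinearMap.mulRight ℂ x)
      (G.comul a))‖ ≤ ‖q a‖ := by
  obtain ⟨N, e, b, he⟩ := TensorProduct.exists_sum_tmul_eq (G.twistedComul x)
  have key : ∀ a : coeffAlgebra G.u,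
      φ (G.sliceRight (G.res h ∘ₗ LinearMap.mulLeft ℂ (star x) ∘ₗ LinearMap.mulRight ℂ x)
        (G.comul a)) = gramMap h (fun i => φ (e i)) (fun i => (b i : A)) a := by
    intro a
    rw [← hh.slice_twistedComul, he, star_sum, Finset.sum_mul, Finset.sum_mul_sum, map_sum,
      map_sum, gramMap_apply]
    refine Finset.sum_congr rfl fun i _ => ?_
    rw [map_sum, map_sum]
    refine Finset.sum_congr rfl fun j _ => ?_
    rw [TensorProduct.star_tmul, Algebra.TensorProduct.tmul_mul_tmul,
      Algebra.TensorProduct.tmul_mul_tmul, sliceRight_tmul, mul_one, map_smul, map_mul φ,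
      map_star φ]
    rfl
  rw [key]
  refine norm_gramMap_le hh.nonneg hsurj hq _ _ ?_ a
  refine (key 1).symm.trans ?_
  rw [_root_.map_one G.comul, Algebra.TensorProduct.one_def, sliceRight_tmul]
  simp only [LinearMap.comp_apply, LinearMap.mulRight_apply, LinearMap.mulLeft_apply, one_mul]
  rw [hx, one_smul, _root_.map_one]

include hh in
/-- If the counit is a limit of vector states then the reduced norm dominates all `C*`-norms. -/
theorem IsRightHaar.norm_le_of_tendsto {R : Type*} [CStarAlgebra R] {q : A →⋆ₐ[ℂ] R}
    (hsurj : Function.Surjective q) (hq : ∀ x, q x = 0 → h (star x * x) = 0)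
    {x : ℕ → coeffAlgebra G.u} (hx : ∀ k, G.res h (star (x k) * x k) = 1)
    (hlim : ∀ b, Filter.Tendsto (fun k => G.res h (star (x k) * (b * x k))) Filter.atTop
      (nhds (G.counit b)))
    {D : Type v} [CStarAlgebra D] (φ : coeffAlgebra G.u →⋆ₐ[ℂ] D) (a : coeffAlgebra G.u) :
    ‖φ a‖ ≤ ‖q a‖ := by
  obtain ⟨N, y, z, hyz⟩ := TensorProduct.exists_sum_tmul_eq (G.comul a)
  have h1 : ∀ k, φ (G.sliceRight (G.res h ∘ₗ LinearMap.mulLeft ℂ (star (x k)) ∘ₗ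
      LinearMap.mulRight ℂ (x k)) (G.comul a)) =
      ∑ i, G.res h (star (x k) * (z i * x k)) • φ (y i) := by
    intro k
    rw [hyz, map_sum, map_sum]
    refine Finset.sum_congr rfl fun i _ => ?_
    rw [sliceRight_tmul, map_smul]
    rfl
  -- The identity `(id ⊗ ε) Δ = id`; hence the slices by the vector states converge to `φ a`.
  have h2 : φ a = ∑ i, G.counit (z i) • φ (y i) := by
    conv_lhs => rw [← sliceRight_counitLinear_comul a, hyz, map_sum, map_sum]
    refine Finset.sum_congr rfl fun i _ => ?_
    rw [sliceRight_tmul, map_smul]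
    rfl
  have h3 : Filter.Tendsto (fun k => ∑ i, G.res h (star (x k) * (z i * x k)) • φ (y i))
      Filter.atTop (nhds (φ a)) := by
    rw [h2]
    exact tendsto_finsetSum _ fun i _ => (hlim (z i)).smul_const _
  refine le_of_tendsto' h3.norm fun k => ?_
  rw [← h1]
  exact hh.norm_slice_le hsurj hq φ (hx k) a

include hh in
-- Every morphism from `A_s` is bounded for the reduced norm and so extends. The reduced algebra
-- itself serves as enveloping algebra, with the identity as canonical surjection.
theorem IsRightHaar.isAmenable_of_tendsto {x : ℕ → coeffAlgebra G.u}
    (hx : ∀ k, G.res h (star (x k) * x k) = 1)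
    (hlim : ∀ b, Filter.Tendsto (fun k => G.res h (star (x k) * (b * x k))) Filter.atTop
      (nhds (G.counit b))) : G.IsAmenable := by
  obtain ⟨R, _, q, hsurj, hq⟩ := hh.exists_reduced
  let ι : coeffAlgebra G.u →⋆ₐ[ℂ] R := q.comp (coeffAlgebra G.u).subtype
  have hι : DenseRange ι := by
    have h1 : DenseRange ((↑) : coeffAlgebra G.u → A) := by
      rw [DenseRange, Subtype.range_coe]
      exact G.dense
    exact hsurj.denseRange.comp h1 (continuous_starAlgHom q)
  refine ⟨R, inferInstance, ι, R, inferInstance, q, StarAlgHom.id ℂ R, ⟨hι, fun D _ φ => ?_⟩,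
    ⟨hsurj, h, hh.isHaarMeasure, hq⟩, fun a => rfl, Function.bijective_id⟩
  exact exists_starAlgHom_extension ι hι φ
    (hh.norm_le_of_tendsto hsurj (fun x => (hq x).1) hx hlim φ)

end WoronowiczPair

/-! ### Almost invariance passes from generators to `A_s`. -/

namespace WoronowiczPair

theorem coeffAlgebra_induction {A : Type u} [CStarAlgebra A] {n : ℕ} {G : WoronowiczPair A n}
    {p : coeffAlgebra G.u → Prop} (entry : ∀ i j, p (coeffEntry G.u i j))
    (scalar : ∀ c : ℂ, p (algebraMap ℂ _ c)) (add : ∀ a b, p a → p b → p (a + b))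
    (mul : ∀ a b, p a → p b → p (a * b)) (star : ∀ a, p a → p (star a))
    (a : coeffAlgebra G.u) : p a := by
  have key : ∀ (a : A) (ha : a ∈ StarAlgebra.adjoin ℂ {a | ∃ i j, a = G.u i j}), p ⟨a, ha⟩ := by
    intro a ha
    refine StarAlgebra.adjoin_induction (p := fun a ha => p ⟨a, ha⟩) ?_ scalar
      (fun a b ha hb => add ⟨a, ha⟩ ⟨b, hb⟩) (fun a b ha hb => mul ⟨a, ha⟩ ⟨b, hb⟩)
      (fun a ha => star ⟨a, ha⟩) ha
    rintro _ ⟨i, j, rfl⟩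
    exact entry i j
  exact key a a.2

section AlmostInvariant

variable {A : Type u} [CStarAlgebra A] [Nontrivial A] {n : ℕ} {G : WoronowiczPair A n}
  {V : Type u} [NormedAddCommGroup V] [InnerProductSpace ℂ V] {ω : A →ₗ[ℂ] V}
  (hω : ∀ a b, ‖ω (a * b)‖ ≤ ‖a‖ * ‖ω b‖) {x : ℕ → coeffAlgebra G.u}

variable (G) in
/-- The vectors `ω (x k)` are asymptotically invariant under `b`. -/
def AlmostInvariant (ω : A →ₗ[ℂ] V) (x : ℕ → coeffAlgebra G.u) (b : coeffAlgebra G.u) : Prop :=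
  Filter.Tendsto (fun k => ω ((b * x k : coeffAlgebra G.u) : A) - G.counit b • ω (x k))
    Filter.atTop (nhds 0)

theorem AlmostInvariant.add {b c : coeffAlgebra G.u} (hb : G.AlmostInvariant ω x b)
    (hc : G.AlmostInvariant ω x c) : G.AlmostInvariant ω x (b + c) := by
  have h1 := Filter.Tendsto.add hb hc
  rw [add_zero] at h1
  refine h1.congr fun k => ?_
  rw [add_mul, AddMemClass.coe_add, map_add, map_add, add_smul]
  abel

theorem almostInvariant_algebraMap (c : ℂ) :
    G.AlmostInvariant ω x (algebraMap ℂ (coeffAlgebra G.u) c) := by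
  refine tendsto_const_nhds.congr fun k => ?_
  rw [← Algebra.smul_def, AlgHomClass.commutes]
  refine (sub_eq_zero.2 ?_).symm
  exact map_smul ω c (x k : A)

include hω in
theorem tendsto_mul_left {y : ℕ → A} (hy : Filter.Tendsto (fun k => ω (y k)) Filter.atTop (nhds 0))
    (a : A) : Filter.Tendsto (fun k => ω (a * y k)) Filter.atTop (nhds 0) := by
  refine squeeze_zero_norm (fun k => hω a (y k)) ?_
  have := hy.norm.const_mul ‖a‖
  rwa [norm_zero, mul_zero] at this

theorem almostInvariant_iff {b : coeffAlgebra G.u} : G.AlmostInvariant ω x b ↔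
    Filter.Tendsto (fun k => ω ((b * x k - G.counit b • x k : coeffAlgebra G.u) : A))
      Filter.atTop (nhds 0) := by
  refine Filter.tendsto_congr fun k => ?_
  rw [AddSubgroupClass.coe_sub, map_sub]
  congr 1
  exact (map_smul ω _ (x k : A)).symm

include hω in
-- `b c x - ε(bc) x = b (c x - ε(c) x) + ε(c) (b x - ε(b) x)`, and left multiplication by `b` is
-- bounded on GNS vectors.
theorem AlmostInvariant.mul {b c : coeffAlgebra G.u} (hb : G.AlmostInvariant ω x b)
    (hc : G.AlmostInvariant ω x c) : G.AlmostInvariant ω x (b * c) := by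
  rw [almostInvariant_iff] at *
  have h1 := tendsto_mul_left hω hc (b : A)
  have h2 := (hb.const_smul (G.counit c)).add h1
  rw [smul_zero, add_zero] at h2
  refine h2.congr fun k => ?_
  rw [← map_smul, ← map_add]
  congr 1
  have h3 : G.counit c • (b * x k - G.counit b • x k) + b * (c * x k - G.counit c • x k) =
      b * c * x k - G.counit (b * c) • x k := by
    rw [smul_sub, mul_sub, map_mul, mul_smul_comm, smul_smul, mul_comm (G.counit c), mul_assoc]
    abel
  exact congrArg Subtype.val h3

include hω in
theorem AlmostInvariant.of_fundamental (h1 : ∀ i j, G.AlmostInvariant ω x (coeffEntry G.u i j))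
    (b : coeffAlgebra G.u) : G.AlmostInvariant ω x b := by
  have hε : ∀ i j, G.counit (coeffEntry G.u i j) = if i = j then 1 else 0 := fun i j =>
    (Corep.fundamental G).isCorep.counit_apply i j
  have hstar : ∀ i j, G.AlmostInvariant ω x (star (coeffEntry G.u i j)) := by
    intro i j
    rw [almostInvariant_iff]
    have h2 : Filter.Tendsto (fun k => -∑ l, ω ((star (coeffEntry G.u l j) : coeffAlgebra G.u) *
        ((coeffEntry G.u l i * x k - G.counit (coeffEntry G.u l i) • x k : coeffAlgebra G.u) : A)))
        Filter.atTop (nhds 0) := by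
      have h3 := (tendsto_finsetSum Finset.univ fun l _ => tendsto_mul_left hω
        (almostInvariant_iff.1 (h1 l i)) (star (coeffEntry G.u l j) : coeffAlgebra G.u)).neg
      rwa [Finset.sum_const_zero, neg_zero] at h3
    refine h2.congr fun k => ?_
    rw [← map_sum, ← map_neg]
    congr 1
    have h4 : ∑ l, star (coeffEntry G.u l j) * coeffEntry G.u l i = if j = i then 1 else 0 := by
      have : (star G.u * G.u) j i = (1 : Matrix (Fin n) (Fin n) A) j i := by
        rw [Unitary.star_mul_self_of_mem G.u_unitary]
      rw [Matrix.mul_apply, Matrix.one_apply] at this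
      apply Subtype.ext
      rw [AddSubmonoidClass.coe_finsetSum, apply_ite Subtype.val]
      exact this
    -- The relation `u* u = 1` turns almost invariance under the entries of column `i` into almost
    -- invariance under `star (u i j)`.
    have h5 : -∑ l, star (coeffEntry G.u l j) * (coeffEntry G.u l i * x k -
        G.counit (coeffEntry G.u l i) • x k) = star (coeffEntry G.u i j) * x k -
          G.counit (star (coeffEntry G.u i j)) • x k := by
      simp only [mul_sub, ← mul_assoc, Finset.sum_sub_distrib, ← Finset.sum_mul, h4]
      simp only [hε, map_star, ite_smul, one_smul, zero_smul]
      by_cases hij : i = j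
      · subst hij
        simp
      · have hji : ¬ j = i := fun h => hij h.symm
        simp [hij, hji]
    have h6 := congrArg Subtype.val h5
    rw [← h6, NegMemClass.coe_neg, AddSubmonoidClass.coe_finsetSum]
    rfl
  -- Almost invariance under `b` gives none directly under `star b`, so both are carried through the
  -- induction.
  have key : G.AlmostInvariant ω x b ∧ G.AlmostInvariant ω x (star b) := by
    induction b using coeffAlgebra_induction with
    | entry i j => exact ⟨h1 i j, hstar i j⟩
    | scalar c =>
      refine ⟨almostInvariant_algebraMap c, ?_⟩
      rw [← algebraMap_star_comm]
      exact almostInvariant_algebraMap _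
    | add b c hb hc =>
      rw [star_add]
      exact ⟨hb.1.add hc.1, hb.2.add hc.2⟩
    | mul b c hb hc =>
      rw [star_mul]
      exact ⟨hb.1.mul hω hc.1, hc.2.mul hω hb.2⟩
    | star b hb =>
      rw [star_star]
      exact ⟨hb.2, hb.1⟩
  exact key.1

end AlmostInvariant

end WoronowiczPair

namespace WoronowiczPair

/-! ### From the growth of moments to almost invariant vectors. -/

section LargeVectors

variable {A : Type u} [CStarAlgebra A] [Nontrivial A] {n : ℕ} {G : WoronowiczPair A n}
  {h : A →L[ℂ] ℂ} {V : Type u} [NormedAddCommGroup V] [InnerProductSpace ℂ V] {ω : A →ₗ[ℂ] V}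
  (hin : ∀ a b, inner ℂ (ω a) (ω b) = h (star a * b)) (hω : ∀ a b, ‖ω (a * b)‖ ≤ ‖a‖ * ‖ω b‖)

include hin in
theorem norm_sq_gns (a : A) : ‖ω a‖ ^ 2 = (h (star a * a)).re := by
  rw [← hin, inner_self_eq_norm_sq_to_K]
  norm_cast

include hin hω in
/-- If the moments of the character of `ȳ y` see the dimension of `y`, then that character has
vectors which are almost eigenvectors for the dimension. -/
theorem exists_large_vector (hh : G.IsRightHaar h) {y : G.FusionSemiring} (hy : 0 < y.dim)
    (hN : ∀ C : ℝ, 0 ≤ C → (∀ j, (h (((FusionSemiring.character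
      (FusionSemiring.conj y * y) : coeffAlgebra G.u) : A) ^ (2 * j))).re ≤ C ^ (2 * j)) →
        (y.dim : ℝ) ^ 2 ≤ C) {t : ℝ} (ht : 0 < t) (ht1 : t ≤ 1) :
    ∃ ξ : coeffAlgebra G.u, ‖ω ξ‖ = 1 ∧
      y.dim * (1 - t) ≤ ‖ω ((FusionSemiring.character y * ξ : coeffAlgebra G.u) : A)‖ := by
  set χ := FusionSemiring.character y with hχ
  have hX : FusionSemiring.character (FusionSemiring.conj y * y) = star χ * χ := by
    rw [map_mul, FusionSemiring.character_conj]
  rw [hX] at hN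
  set X : coeffAlgebra G.u := star χ * χ with hXdef
  have hXsa : star X = X := by rw [hXdef, star_mul, star_star]
  have hdim : (0 : ℝ) < y.dim := by exact_mod_cast hy
  set C : ℝ := (y.dim : ℝ) ^ 2 * (1 - t) with hC
  have hC0 : 0 ≤ C := mul_nonneg (by positivity) (by linarith)
  have hex : ∃ ξ : coeffAlgebra G.u, C * ‖ω ξ‖ < ‖ω ((X * ξ : coeffAlgebra G.u) : A)‖ := by
    -- Otherwise multiplication by `X` contracts GNS vectors of `A_s` by `C`. The moments, which are
    -- the squared norms of `ω (X ^ j)`, are then at most `C ^ (2 * j)`, so `hN` gives `dim² ≤ dim²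
    -- (1 - t)`.
    by_contra! hcon
    have h1 : ∀ j : ℕ, ‖ω ((X ^ j : coeffAlgebra G.u) : A)‖ ≤ C ^ j := by
      intro j
      induction j with
      | zero =>
        have := norm_sq_gns hin ((X ^ 0 : coeffAlgebra G.u) : A)
        rw [pow_zero, OneMemClass.coe_one, star_one, one_mul, hh.map_one, Complex.one_re] at this
        rw [pow_zero, pow_zero, OneMemClass.coe_one]
        nlinarith [norm_nonneg (ω 1)]
      | succ j ih =>
        rw [pow_succ', pow_succ']
        exact (hcon _).trans (mul_le_mul_of_nonneg_left ih hC0)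
    have h2 := hN C hC0 fun j => by
      have h3 := norm_sq_gns hin ((X ^ j : coeffAlgebra G.u) : A)
      have h4 : star ((X ^ j : coeffAlgebra G.u) : A) * ((X ^ j : coeffAlgebra G.u) : A) =
          (X : A) ^ (2 * j) := by
        have h5 : star (X ^ j) * X ^ j = X ^ (2 * j) := by
          rw [star_pow, hXsa, ← pow_add, two_mul]
        exact congrArg Subtype.val h5
      rw [h4] at h3
      rw [← h3, mul_comm 2 j, pow_mul]
      exact pow_le_pow_left₀ (norm_nonneg _) (h1 j) 2
    rw [hC] at h2
    nlinarith [sq_pos_of_pos hdim]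
  obtain ⟨ξ, hξ⟩ := hex
  have hξ0 : 0 < ‖ω ξ‖ := by
    refine (norm_nonneg _).lt_of_ne fun h0 => ?_
    have h1 := hω (X : A) (ξ : A)
    rw [← h0, mul_zero] at h1 hξ
    exact absurd (hξ.trans_le h1) (lt_irrefl _)
  refine ⟨((‖ω ξ‖⁻¹ : ℝ) : ℂ) • ξ, ?_, ?_⟩
  · have h1 : ω ((((‖ω ξ‖⁻¹ : ℝ) : ℂ) • ξ : coeffAlgebra G.u) : A) = ((‖ω ξ‖⁻¹ : ℝ) : ℂ) • ω ξ :=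
      map_smul ω _ (ξ : A)
    rw [h1, norm_smul, Complex.norm_real, norm_inv, norm_norm, inv_mul_cancel₀ hξ0.ne']
  · have h1 : ω ((χ * ((‖ω ξ‖⁻¹ : ℝ) : ℂ) • ξ : coeffAlgebra G.u) : A) =
        ((‖ω ξ‖⁻¹ : ℝ) : ℂ) • ω ((χ * ξ : coeffAlgebra G.u) : A) := by
      rw [mul_smul_comm]
      exact map_smul ω _ ((χ * ξ : coeffAlgebra G.u) : A)
    rw [h1, norm_smul, Complex.norm_real, norm_inv, norm_norm, ← div_eq_inv_mul, le_div_iff₀ hξ0]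
    -- Since `X = χ* χ` and `χ*` has norm at most `dim`, a vector large under `X` is large under
    -- `χ`.
    have h2 : ‖ω ((X * ξ : coeffAlgebra G.u) : A)‖ ≤
        y.dim * ‖ω ((χ * ξ : coeffAlgebra G.u) : A)‖ := by
      have h3 := hω (star (χ : A)) ((χ * ξ : coeffAlgebra G.u) : A)
      rw [norm_star] at h3
      have h4 : ((X * ξ : coeffAlgebra G.u) : A) = star (χ : A) * ((χ * ξ : coeffAlgebra G.u) : A) := by
        rw [hXdef, mul_assoc]
        rfl
      rw [h4]
      exact h3.trans (mul_le_mul_of_nonneg_right (FusionSemiring.norm_character_le hh y)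
        (norm_nonneg _))
    have h5 : y.dim * (y.dim * (1 - t) * ‖ω ξ‖) ≤
        y.dim * ‖ω ((χ * ξ : coeffAlgebra G.u) : A)‖ := by
      refine le_trans (le_of_eq ?_) (hξ.le.trans h2)
      rw [hC]
      ring
    exact le_of_mul_le_mul_left h5 hdim

theorem sum_star_u_mul (i j : Fin n) :
    ∑ k, star (G.u k i) * G.u k j = if i = j then 1 else 0 := by
  have : (star G.u * G.u) i j = (1 : Matrix (Fin n) (Fin n) A) i j := by
    rw [Unitary.star_mul_self_of_mem G.u_unitary]
  rwa [Matrix.mul_apply, Matrix.one_apply] at this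

include hω in
theorem norm_u_mul_le (ξ : A) (i j : Fin n) : ‖ω (G.u i j * ξ)‖ ≤ ‖ω ξ‖ :=
  (hω _ _).trans (mul_le_of_le_one_left (norm_nonneg _) (norm_unitary_entry_le sum_star_u_mul i j))

include hω in
-- The other `n - 1` diagonal terms contribute at most `1` each, so `‖u i i ξ + ξ‖ ≥ 2 - s` with `s
-- = (n + 1) t`. The parallelogram law bounds the squared difference by `4 - (2 - s)² ≤ 4 s` when `s
-- ≤ 2`; for `s > 2` the bound `4` suffices. The trivial summand of `1 ⊕ u` provides `ξ` itself as
-- the vector of comparison.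
theorem norm_diag_sub_sq_le {ξ : A} (hξ : ‖ω ξ‖ = 1) {t : ℝ} (ht : 0 ≤ t)
    (hle : (n + 1 : ℝ) * (1 - t) ≤ ‖ω ξ + ∑ i, ω (G.u i i * ξ)‖) (i : Fin n) :
    ‖ω (G.u i i * ξ) - ω ξ‖ ^ 2 ≤ 4 * ((n + 1) * t) := by
  have h1 : ‖ω ξ + ∑ i, ω (G.u i i * ξ)‖ ≤ ‖ω (G.u i i * ξ) + ω ξ‖ + (n - 1) := by
    rw [← Finset.add_sum_erase _ _ (Finset.mem_univ i), ← add_assoc, add_comm (ω ξ)]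
    refine (norm_add_le _ _).trans (add_le_add_right ((norm_sum_le _ _).trans ?_) _)
    refine (Finset.sum_le_card_nsmul _ _ 1 fun j _ => (norm_u_mul_le hω ξ j j).trans hξ.le).trans ?_
    rw [Finset.card_erase_of_mem (Finset.mem_univ i), Finset.card_univ, Fintype.card_fin,
      nsmul_eq_mul, mul_one, Nat.cast_sub i.pos, Nat.cast_one]
  have h2 := parallelogram_law_with_norm ℂ (ω (G.u i i * ξ)) (ω ξ)
  have h3 := norm_u_mul_le (G := G) hω ξ i i
  rw [hξ] at h2 h3
  have h4 := norm_nonneg (ω (G.u i i * ξ))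
  have h5 := norm_nonneg (ω (G.u i i * ξ) + ω ξ)
  have h6 : 2 - (n + 1) * t ≤ ‖ω (G.u i i * ξ) + ω ξ‖ := by linarith
  have h7 : 0 ≤ (n + 1) * t := by positivity
  rcases le_or_gt ((n + 1) * t) 2 with h8 | h8
  · nlinarith
  · nlinarith

include hin hω in
-- By unitarity the squared norms of the `u k j ξ` over a column add up to `1`. If the diagonal term
-- is close to `ξ` it already has norm nearly `1`, which leaves little for the others.
theorem norm_offdiag_sq_le {ξ : A} (hξ : ‖ω ξ‖ = 1) {i j : Fin n} (hij : i ≠ j) :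
    ‖ω (G.u i j * ξ)‖ ^ 2 ≤ 2 * ‖ω (G.u j j * ξ) - ω ξ‖ := by
  have h1 : ∑ k, ‖ω (G.u k j * ξ)‖ ^ 2 = 1 := by
    have h2 : ∑ k, star (G.u k j * ξ) * (G.u k j * ξ) = star ξ * ξ := by
      have := sum_star_u_mul (G := G) j j
      rw [if_pos rfl] at this
      calc _ = star ξ * (∑ k, star (G.u k j) * G.u k j) * ξ := by
            rw [Finset.mul_sum, Finset.sum_mul]
            exact Finset.sum_congr rfl fun k _ => by simp only [star_mul, mul_assoc]
        _ = _ := by rw [this, mul_one]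
    calc _ = (h (∑ k, star (G.u k j * ξ) * (G.u k j * ξ))).re := by
          rw [map_sum, Complex.re_sum]
          exact Finset.sum_congr rfl fun k _ => norm_sq_gns hin _
      _ = 1 := by rw [h2, ← norm_sq_gns hin, hξ, one_pow]
  have h2 : ‖ω (G.u i j * ξ)‖ ^ 2 + ‖ω (G.u j j * ξ)‖ ^ 2 ≤ 1 := by
    rw [← h1, ← Finset.sum_pair hij (f := fun k => ‖ω (G.u k j * ξ)‖ ^ 2)]
    exact Finset.sum_le_sum_of_subset_of_nonneg (Finset.subset_univ _)
      fun k _ _ => by positivity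
  have h3 := norm_sub_norm_le (ω ξ) (ω (G.u j j * ξ))
  rw [hξ, norm_sub_rev] at h3
  have h4 := norm_u_mul_le (G := G) hω ξ j j
  rw [hξ] at h4
  nlinarith [norm_nonneg (ω (G.u j j * ξ))]

include hin hω in
theorem almostInvariant_of_large {x : ℕ → coeffAlgebra G.u} (hx : ∀ k, ‖ω (x k)‖ = 1)
    (hle : ∀ k : ℕ, (n + 1 : ℝ) * (1 - 1 / (k + 1)) ≤
      ‖ω ((FusionSemiring.character (1 + FusionSemiring.fundamental G) * x k :
        coeffAlgebra G.u) : A)‖) (b : coeffAlgebra G.u) : G.AlmostInvariant ω x b := by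
  have hε : ∀ i j, G.counit (coeffEntry G.u i j) = if i = j then 1 else 0 := fun i j =>
    (Corep.fundamental G).isCorep.counit_apply i j
  have hχ : ∀ k, ω ((FusionSemiring.character (1 + FusionSemiring.fundamental G) * x k :
      coeffAlgebra G.u) : A) = ω (x k) + ∑ i, ω (G.u i i * (x k : A)) := by
    intro k
    have h1 : FusionSemiring.character (1 + FusionSemiring.fundamental G) =
        1 + ∑ i, coeffEntry G.u i i := by
      rw [map_add, map_one]
      rfl
    rw [h1, add_mul, one_mul, Finset.sum_mul, AddMemClass.coe_add,
      AddSubmonoidClass.coe_finsetSum, map_add, map_sum]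
    rfl
  have hdiag : ∀ i, Filter.Tendsto (fun k => ‖ω (G.u i i * (x k : A)) - ω (x k)‖) Filter.atTop
      (nhds 0) := by
    intro i
    have h1 : ∀ k : ℕ, ‖ω (G.u i i * (x k : A)) - ω (x k)‖ ^ 2 ≤
        4 * ((n + 1) * (1 / ((k : ℝ) + 1))) := fun k =>
      norm_diag_sub_sq_le hω (hx k) (by positivity) (hχ k ▸ hle k) i
    have h2 : Filter.Tendsto (fun k : ℕ => 4 * ((n + 1 : ℝ) * (1 / ((k : ℝ) + 1)))) Filter.atTop
        (nhds 0) := by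
      have := (tendsto_one_div_add_atTop_nhds_zero_nat (𝕜 := ℝ)).const_mul (n + 1 : ℝ)
        |>.const_mul 4
      rwa [mul_zero, mul_zero] at this
    have h3 := squeeze_zero (fun k => by positivity) h1 h2
    have h4 := h3.sqrt
    rw [Real.sqrt_zero] at h4
    exact h4.congr fun k => Real.sqrt_sq (norm_nonneg _)
  refine AlmostInvariant.of_fundamental hω (fun i j => ?_) b
  rw [AlmostInvariant, hε]
  by_cases hij : i = j
  · subst hij
    rw [if_pos rfl]
    simp only [one_smul]
    exact tendsto_zero_iff_norm_tendsto_zero.2 (hdiag i)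
  · rw [if_neg hij]
    simp only [zero_smul, sub_zero]
    refine tendsto_zero_iff_norm_tendsto_zero.2 ?_
    have h1 : ∀ k, ‖ω (G.u i j * (x k : A))‖ ^ 2 ≤ 2 * ‖ω (G.u j j * (x k : A)) - ω (x k)‖ :=
      fun k => norm_offdiag_sq_le hin hω (hx k) hij
    have h2 := (hdiag j).const_mul 2
    rw [mul_zero] at h2
    have h4 := (squeeze_zero (fun k => by positivity) h1 h2).sqrt
    rw [Real.sqrt_zero] at h4
    exact h4.congr fun k => Real.sqrt_sq (norm_nonneg _)

end LargeVectors

variable {A : Type u} [CStarAlgebra A] [Nontrivial A] {n : ℕ} {G : WoronowiczPair A n}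

/-- A Kesten type criterion: `A` is amenable if the moments of the character of the corepresentation
`1 ⊕ u` see its dimension. -/
theorem isAmenable_of_moments {h : A →L[ℂ] ℂ} (hh : G.IsRightHaar h)
    (hN : ∀ C : ℝ, 0 ≤ C → (∀ j, (h (((FusionSemiring.character
      (FusionSemiring.conj (1 + FusionSemiring.fundamental G) *
        (1 + FusionSemiring.fundamental G)) : coeffAlgebra G.u) : A) ^ (2 * j))).re ≤
          C ^ (2 * j)) → (n + 1 : ℝ) ^ 2 ≤ C) : G.IsAmenable := by
  obtain ⟨V, _, _, ω, hin, hω⟩ := exists_gns_vectors hh.nonneg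
  have hdim : (1 + FusionSemiring.fundamental G).dim = n + 1 := by
    rw [FusionSemiring.dim_add, add_comm]
    rfl
  have hdim' : ((1 + FusionSemiring.fundamental G).dim : ℝ) = n + 1 := by
    rw [hdim, Nat.cast_succ]
  have hex : ∀ k : ℕ, ∃ ξ : coeffAlgebra G.u, ‖ω ξ‖ = 1 ∧ (n + 1 : ℝ) * (1 - 1 / (k + 1)) ≤
      ‖ω ((FusionSemiring.character (1 + FusionSemiring.fundamental G) * ξ :
        coeffAlgebra G.u) : A)‖ := by
    intro k
    rw [← hdim']
    refine exists_large_vector hin hω hh (by omega) (fun C hC hj => ?_) (by positivity) ?_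
    · rw [hdim']
      exact hN C hC hj
    · rw [div_le_one (by positivity)]
      linarith [Nat.cast_nonneg (α := ℝ) k]
  choose x hx hle using hex
  have hinv := almostInvariant_of_large hin hω hx hle
  refine hh.isAmenable_of_tendsto (x := x) (fun k => ?_) fun b => ?_
  · change h (star (x k : A) * (x k : A)) = 1
    rw [← hin, inner_self_eq_norm_sq_to_K, hx]
    norm_num
  · have h1 : ∀ k, G.res h (star (x k) * (b * x k)) - G.counit b =
        inner ℂ (ω (x k)) (ω ((b * x k : coeffAlgebra G.u) : A) - G.counit b • ω (x k)) := by
      intro k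
      rw [inner_sub_right, inner_smul_right, hin, inner_self_eq_norm_sq_to_K, hx]
      norm_num
      rfl
    refine tendsto_iff_norm_sub_tendsto_zero.2 ?_
    have h2 := (hinv b).norm
    rw [norm_zero] at h2
    refine squeeze_zero (fun k => norm_nonneg _) (fun k => ?_) h2
    rw [h1 k]
    refine (norm_inner_le_norm _ _).trans ?_
    rw [hx, one_mul]

end WoronowiczPair

theorem proposition6p1 {A : Type u} [CStarAlgebra A] [Nontrivial A]
    {B : Type v} [CStarAlgebra B] [Nontrivial B] {n m : ℕ}
    (G : WoronowiczPair A n) (K : WoronowiczPair B m)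
    (f : G.FusionSemiring ≃+* K.FusionSemiring)
    (hf : f (WoronowiczPair.FusionSemiring.fundamental G) =
      WoronowiczPair.FusionSemiring.fundamental K)
    (hA : G.IsAmenable) :
    (∀ r : G.FusionSemiring, r.dim ≤ (f r).dim) ∧
    List.TFAE [∀ r : G.FusionSemiring, (f r).dim = r.dim,
      (WoronowiczPair.FusionSemiring.fundamental K).dim =
        (WoronowiczPair.FusionSemiring.fundamental G).dim,
      K.IsAmenable] := by
  refine ⟨fun r => WoronowiczPair.dim_le_dim_map f hA r, ?_⟩
  tfae_have 1 → 2 := fun h => by rw [← hf]; exact h _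
  -- A growth bound for the moments of `1 + v` in `B` transfers to `1 + u` in the amenable `A`,
  -- whence `(n + 1)² ≤ C`. The equality `m = n` turns this into the criterion for `B`.
  tfae_have 2 → 3 := fun hdim => by
    obtain ⟨k, hk⟩ := K.exists_isRightHaar
    have hmn : m = n := hdim
    refine WoronowiczPair.isAmenable_of_moments hk fun C hC hmom => ?_
    set x := 1 + WoronowiczPair.FusionSemiring.fundamental G with hx
    have hfx : f x = 1 + WoronowiczPair.FusionSemiring.fundamental K := by
      rw [hx, map_add, map_one, hf]
    have hxC := WoronowiczPair.dim_sq_le_of_moments_map f hA hk x (D := 1) hC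
      fun j => by rw [one_mul, hfx]; exact hmom j
    have hdx : x.dim = n + 1 := by
      rw [hx, WoronowiczPair.FusionSemiring.dim_add, add_comm]
      rfl
    rwa [hdx, Nat.cast_succ, ← hmn] at hxC
  -- With both algebras amenable, the dimension inequality holds for `f` and for its inverse.
  tfae_have 3 → 1 := fun hK r => by
    refine le_antisymm ?_ (WoronowiczPair.dim_le_dim_map f hA r)
    have := WoronowiczPair.dim_le_dim_map f.symm hK (f r)
    rwa [f.symm_apply_apply] at this
  tfae_finish

end
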